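/- Let $d_1,\dots,d_r$ be positive integers. A simultaneous Waring decomposition with $k$ summands of a vector $f=(f_1,\dots,f_r)$ of complex forms $f_j\in\mathbb{C}[x_0,x_1,x_2]_{d_j}$ consists of linear forms $\ell_1,\dots,\ell_k\in\mathbb{C}[x_0,x_1,x_2]_1$ and coefficients $\lambda_i^j\in\mathbb{C}$, with $(\lambda_1^j,\dots,\lambda_k^j)\neq 0$ for every $j$, such that $$f=\sum_{i=1}^{k}\bigl(\lambda_i^1\ell_i^{d_1},\dots,\lambda_i^r\ell_i^{d_r}\bigr).$$ Two decompositions are regarded as the same if they have the same summands up to order (so reordering the summands, or rescaling the $\ell_i$ and compensating in the coefficients, gives nothing new). The rank of $f$ is the least positive $k$ for which such a decomposition exists, and $f$ is identifiable if it has exactly one decomposition whose number of summands is its rank. A property holds for the general vector if it holds on a nonempty Zariski open subset of the affine space of all vectors of forms of the given degrees. Theorem. The general vector $f=(f_1,f_2,f_3,f_4)$ with $f_1,f_2,f_3\in\mathbb{C}[x_0,x_1,x_2]_4$ and $f_4\in\mathbb{C}[x_0,x_1,x_2]_5$ has at least $36$ distinct simultaneous Waring decompositions with $11$ summands, and it is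 not identifiable. Consequently the case $d=4$ of the following conjecture is false: for every $d\ge 2$, the general vector of $d-1$ ternary forms of degree $d$ and one ternary form of degree $d+1$ has a unique simultaneous Waring decomposition with $\frac{d^2+d+2}{2}$ summands. -/

import Mathlib

namespace SimWaring

/-- A polynomial vector: complex forms `f j` of degree `d j` in the variables `x_0, …, x_n`. -/
abbrev PolyVec (n : ℕ) {r : ℕ} (d : Fin r → ℕ) : Type :=
  (j : Fin r) → MvPolynomial.homogeneousSubmodule (Fin (n + 1)) ℂ (d j)

/-- The summand `(λ¹ ℓ^{d_1}, …, λʳ ℓ^{d_r})`. -/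
noncomputable def summand {n r : ℕ} (d : Fin r → ℕ) (l : MvPolynomial (Fin (n + 1)) ℂ)
    (c : Fin r → ℂ) : Fin r → MvPolynomial (Fin (n + 1)) ℂ :=
  fun j => MvPolynomial.C (c j) * l ^ d j

/-- A simultaneous Waring decomposition of `f` with `k` summands: linear forms `l i` and
coefficients `c i j` (the coefficient vector of each `f j` being nonzero) with
`f j = ∑ i, c i j * (l i) ^ d j` for all `j`. -/
structure Decomposition {n r : ℕ} {d : Fin r → ℕ} (f : PolyVec n d) (k : ℕ) where
  l : Fin k → MvPolynomial (Fin (n + 1)) ℂ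
  c : Fin k → Fin r → ℂ
  l_linear : ∀ i, (l i).IsHomogeneous 1
  c_ne_zero : ∀ j, (fun i => c i j) ≠ 0
  sum_eq : ∀ j, (f j : MvPolynomial (Fin (n + 1)) ℂ) = ∑ i, summand d (l i) (c i) j

/-- The unordered family of summands of a decomposition. Reordering the summands, or replacing
`l i` by a multiple and rescaling the coefficients accordingly, does not change it. -/
noncomputable def Decomposition.summands {n r k : ℕ} {d : Fin r → ℕ} {f : PolyVec n d}
    (D : Decomposition f k) : Multiset (Fin r → MvPolynomial (Fin (n + 1)) ℂ) :=
  Finset.univ.val.map fun i => summand d (D.l i) (D.c i)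

/-- The simultaneous Waring decompositions of `f` with `k` summands, up to reordering the
summands and rescaling. -/
def decompositions {n r : ℕ} {d : Fin r → ℕ} (f : PolyVec n d) (k : ℕ) :
    Set (Multiset (Fin r → MvPolynomial (Fin (n + 1)) ℂ)) :=
  Set.range fun D : Decomposition f k => D.summands

/-- `k` is the simultaneous Waring rank of `f`. -/
def HasRank {n r : ℕ} {d : Fin r → ℕ} (f : PolyVec n d) (k : ℕ) : Prop :=
  IsLeast {m : ℕ | 0 < m ∧ Nonempty (Decomposition f m)} k

/-- `f` is simultaneous Waring identifiable: with `k` its rank, it has exactly one simultaneous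
Waring decomposition with `k` summands, up to reordering and rescaling. -/
def Identifiable {n r : ℕ} {d : Fin r → ℕ} (f : PolyVec n d) : Prop :=
  ∃ k, HasRank f k ∧ ∃! S, S ∈ decompositions f k

/-- Coordinates on the space of polynomial vectors: pairs of an index `j` and a monomial of
degree `d j`. -/
abbrev CoeffIndex (n : ℕ) {r : ℕ} (d : Fin r → ℕ) : Type :=
  (j : Fin r) × {m : Fin (n + 1) →₀ ℕ // m.degree = d j}

/-- The coefficients of a polynomial vector. -/
noncomputable def coeffs {n r : ℕ} {d : Fin r → ℕ} (f : PolyVec n d) : CoeffIndex n d → ℂ :=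
  fun p => (f p.1 : MvPolynomial (Fin (n + 1)) ℂ).coeff p.2.1

/-- The general polynomial vector of degrees `d` satisfies `P`: `P` holds on a nonempty Zariski
open subset of the affine space of polynomial vectors, equivalently outside the zero locus of
some nonzero polynomial in the coefficients. -/
def Generally (n : ℕ) {r : ℕ} (d : Fin r → ℕ) (P : PolyVec n d → Prop) : Prop :=
  ∃ Φ : MvPolynomial (CoeffIndex n d) ℂ, Φ ≠ 0 ∧
    ∀ f : PolyVec n d, MvPolynomial.eval (coeffs f) Φ ≠ 0 → P f

/-- The degrees `(d, …, d, d + 1)`, with `d - 1` entries equal to `d`. -/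
def conjDegrees (d : ℕ) : Fin d → ℕ :=
  fun j => if (j : ℕ) + 1 = d then d + 1 else d

/-- The instance `d` of the conjecture (which asserts it for all `d ≥ 2`): the general vector of
`d - 1` ternary forms of degree `d` and one of degree `d + 1` has a unique simultaneous Waring
decomposition with `(d² + d + 2) / 2` summands. -/
def ConjectureAt (d : ℕ) : Prop :=
  Generally 2 (conjDegrees d) fun f => ∃! S, S ∈ decompositions f ((d ^ 2 + d + 2) / 2)

end SimWaring

/-! Forms of degrees 4, 4, 4, 5 have 15 + 15 + 15 + 21 = 66 coefficients, and eleven summands built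
on linear forms X_0 + a X_1 + b X_2 have 11 · (2 + 4) = 66 parameters. After division by multinomial
coefficients, decompositions of this shape are the solutions of a square polynomial system
`waringMap x = y` over the integers. It suffices to find 36 solutions for general `y` that give
different sets of summands, and to see that ten summands never suffice in general.

Ten summands: they have only 60 parameters, so in each choice of charts for the linear forms the 66
coefficients satisfy an algebraic relation (`exists_relation`). Hence the general vector has rank at
least 11, and two decompositions with 11 summands contradict identifiability. Since (4² + 4 + 2) / 2
= 11, they contradict the conjecture as well.

From one point to the general point: suppose that all `y` near a rational vector have 36 solutions
with distinct values of the invariant ∑ c_{i1}². Some such `y` has algebraically independent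
coordinates. As there are as many parameters as equations, the solutions are algebraic over ℚ(y).
After inverting one polynomial, the solutions and the inverses of the differences of invariants
become integral over ℚ[y], so the evaluation of `y` at a general `f` extends to them
(`exists_specialization`). The images are 36 solutions for `f`, still with distinct invariants.

Near the rational vector: it is chosen sparse, so as to be fixed by complex conjugation, by a
rotation of order three that gives X_1 and X_2 the weights 1 and 2, and by the exchange of X_1 and
X_2 together with that of the components 1 and 2. Five approximate solutions are certified; the
exchange turns the first into a sixth value of the invariant. Conjugation gives 12 values and the
rotation, which multiplies the invariant by a cube root of unity, gives 36.

Certification is a Newton-type argument (`eventually_exists_eq_of_approx`): with an approximate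
inverse of the differential and a small residual, all nearby right-hand sides are attained. The
inverse comes from duality. A row of it is a vector of polynomials of degrees 4, 4, 4, 5, and
pairing it with the differential evaluates these polynomials and their derivatives at the eleven
points (a_i, b_i) (`sum_mul_waringDeriv`). Quartics dual to the points recover the c. Vectors of
polynomials vanishing at the points, of which there are 4 + 4 + 4 + 10 = 22 independent ones when
the points impose independent conditions, recover the 22 numbers a, b. All numerical conditions are
verified in exact Gaussian integer arithmetic. -/

namespace SimWaring

/-! ### Specialization of algebraic solutions to a general point -/

open MvPolynomial

/-- A homomorphism into an algebraically closed field extends along an integral extension. -/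
theorem exists_ringHom_extension {R S M : Type*} [CommRing R] [CommRing S] [Field M]
    [IsAlgClosed M] [Algebra R S] [Algebra.IsIntegral R S] [FaithfulSMul R S] (φ : R →+* M) :
    ∃ ψ : S →+* M, ∀ r, ψ (algebraMap R S r) = φ r := by
  have hP : (RingHom.ker φ).IsPrime := RingHom.ker_isPrime φ
  -- Lying over: a prime `Q` of `S` contracts to the kernel of `φ`. Then `S ⧸ Q` is a domain
  -- integral over a subring of `M`, and it maps to the algebraically closed field `M`.
  obtain ⟨Q, -, hQ, hQP⟩ := Ideal.exists_ideal_over_prime_of_isIntegral (RingHom.ker φ)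
    (⊥ : Ideal S) (by
      rw [← RingHom.ker_eq_comap_bot,
        (RingHom.injective_iff_ker_eq_bot _).1 (FaithfulSMul.algebraMap_injective R S)]
      exact bot_le)
  have : Q.LiesOver (RingHom.ker φ) := ⟨hQP.symm⟩
  let : Algebra (R ⧸ RingHom.ker φ) M := (RingHom.kerLift φ).toAlgebra
  have hinj : Function.Injective (algebraMap (R ⧸ RingHom.ker φ) M) := RingHom.kerLift_injective φ
  have : Module.IsTorsionFree (R ⧸ RingHom.ker φ) M :=
    Module.isTorsionFree_iff_algebraMap_injective.2 hinj
  have hinj' : Function.Injective (algebraMap (R ⧸ RingHom.ker φ) (S ⧸ Q)) :=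
    FaithfulSMul.algebraMap_injective _ _
  have : Module.IsTorsionFree (R ⧸ RingHom.ker φ) (S ⧸ Q) :=
    Module.isTorsionFree_iff_algebraMap_injective.2 hinj'
  let ψ : S ⧸ Q →ₐ[R ⧸ RingHom.ker φ] M := IsAlgClosed.lift
  refine ⟨(ψ : S ⧸ Q →+* M).comp (Ideal.Quotient.mk Q), fun r => ?_⟩
  have h := ψ.commutes (Ideal.Quotient.mk _ r)
  exact h

/-- Specialization: finitely many elements algebraic over `ℚ[y]`, with `y` algebraically
independent, can be specialized along with `y` to a general point. -/
theorem exists_specialization {ι : Type*} (y : ι → ℂ) (hy : AlgebraicIndependent ℚ y)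
    (T : Finset ℂ) (hT : ∀ t ∈ T, IsAlgebraic (Algebra.adjoin ℚ (Set.range y)) t) :
    ∃ Φ : MvPolynomial ι ℚ, Φ ≠ 0 ∧ ∀ f : ι → ℂ, aeval f Φ ≠ 0 →
      ∃ (B : Subring ℂ) (ψ : B →+* ℂ), (∀ t ∈ T, t ∈ B) ∧
        ∀ i, ∃ h : y i ∈ B, ψ ⟨y i, h⟩ = f i := by
  classical
  let : Algebra (MvPolynomial ι ℚ) ℂ := (aeval y : MvPolynomial ι ℚ →ₐ[ℚ] ℂ).toAlgebra
  have hmap : ∀ p : MvPolynomial ι ℚ, algebraMap (MvPolynomial ι ℚ) ℂ p = aeval y p := fun _ => rfl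
  have hinj : Function.Injective (algebraMap (MvPolynomial ι ℚ) ℂ) := hy
  have hT' : ∀ t ∈ T, IsAlgebraic (MvPolynomial ι ℚ) t := by
    intro t ht
    have h := hT t ht
    refine IsAlgebraic.of_ringHom_of_comp_eq hy.aevalEquiv (RingHom.id ℂ) h
      hy.aevalEquiv.surjective Function.injective_id ?_
    exact RingHom.ext fun p => hy.algebraMap_aevalEquiv p
  -- Each `t` becomes integral after multiplication by a nonzero polynomial `r t`. Once the product
  -- `Φ` of these is inverted, the `t` themselves are integral.
  choose! r hr0 hr using fun t ht => (hT' t ht).exists_integral_multiple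
  have hΦ : ∏ t ∈ T, r t ≠ 0 := Finset.prod_ne_zero_iff.2 hr0
  refine ⟨∏ t ∈ T, r t, hΦ, fun f hf => ?_⟩
  set Φ := ∏ t ∈ T, r t with hΦdef
  have hu : IsUnit (algebraMap (MvPolynomial ι ℚ) ℂ Φ) :=
    isUnit_iff_ne_zero.2 ((map_ne_zero_iff _ hinj).2 hΦ)
  let : Algebra (Localization.Away Φ) ℂ := (IsLocalization.Away.lift Φ hu).toAlgebra
  have : IsScalarTower (MvPolynomial ι ℚ) (Localization.Away Φ) ℂ :=
    IsScalarTower.of_algebraMap_eq fun p => (IsLocalization.Away.lift_eq Φ hu p).symm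
  have hint : ∀ t ∈ T, IsIntegral (Localization.Away Φ) t := by
    intro t ht
    have h1 : IsIntegral (Localization.Away Φ) (r t • t) := (hr t ht).tower_top
    have h2 : IsUnit (algebraMap _ (Localization.Away Φ) (r t)) :=
      isUnit_of_dvd_unit (map_dvd _ (Finset.dvd_prod_of_mem r ht))
        (IsLocalization.Away.algebraMap_isUnit Φ)
    obtain ⟨u, hu⟩ := h2
    have h3 : t = ((u⁻¹ : (Localization.Away Φ)ˣ) : Localization.Away Φ) • (r t • t) := by
      rw [← algebraMap_smul (Localization.Away Φ) (r t) t, ← hu, smul_smul]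
      simp
    rw [h3]
    exact h1.smul _
  let B := Algebra.adjoin (Localization.Away Φ) (T : Set ℂ)
  have : Algebra.IsIntegral (Localization.Away Φ) B := Algebra.IsIntegral.adjoin hint
  -- The localization still embeds in ℂ, which gives the faithfulness needed for lying over.
  have hinjL : Function.Injective (algebraMap (Localization.Away Φ) ℂ) := by
    refine (IsLocalization.lift_injective_iff _).2 fun a b => ?_
    rw [(IsLocalization.injective (Localization.Away Φ)
      (powers_le_nonZeroDivisors_of_noZeroDivisors hΦ)).eq_iff, hinj.eq_iff]
  have : FaithfulSMul (Localization.Away Φ) B := (faithfulSMul_iff_algebraMap_injective _ _).2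
    fun a b hab => hinjL (congrArg Subtype.val hab)
  have hf' : IsUnit ((aeval f : MvPolynomial ι ℚ →ₐ[ℚ] ℂ).toRingHom Φ) := isUnit_iff_ne_zero.2 hf
  obtain ⟨ψ, hψ⟩ := exists_ringHom_extension (R := Localization.Away Φ) (S := B) (IsLocalization.Away.lift Φ hf')
  refine ⟨B.toSubring, ψ, fun t ht => Algebra.subset_adjoin ht, fun i => ?_⟩
  have hyi : algebraMap (Localization.Away Φ) ℂ
      (algebraMap (MvPolynomial ι ℚ) (Localization.Away Φ) (X i)) = y i := by
    rw [← IsScalarTower.algebraMap_apply, hmap, aeval_X]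
  refine ⟨hyi ▸ B.algebraMap_mem _, ?_⟩
  have h := hψ (algebraMap (MvPolynomial ι ℚ) (Localization.Away Φ) (X i))
  rw [IsLocalization.Away.lift_eq] at h
  simp only [AlgHom.toRingHom_eq_coe, RingHom.coe_coe, aeval_X] at h
  rw [← h]
  congr 1
  exact Subtype.ext hyi.symm

/-- If `n` polynomials in the `n` numbers `x` take algebraically independent values, then
the `x` are algebraic over these values. -/
theorem isAlgebraic_of_mem_adjoin {ι κ : Type} [Finite ι] [Finite κ]
    (h : Nat.card κ ≤ Nat.card ι) {y : ι → ℂ} (hy : AlgebraicIndependent ℚ y) {x : κ → ℂ}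
    (hyx : ∀ i, y i ∈ Algebra.adjoin ℚ (Set.range x)) (k : κ) :
    IsAlgebraic (Algebra.adjoin ℚ (Set.range y)) (x k) := by
  classical
  let A := Algebra.adjoin ℚ (Set.range x)
  let y' : ι → A := fun i => ⟨y i, hyx i⟩
  have hy' : AlgebraicIndependent ℚ y' := by
    refine AlgebraicIndependent.of_comp A.val ?_
    exact hy
  -- `A` is generated by the `x`, so its transcendence degree is at most their number. The `y'` are
  -- independent and at least as many, hence a transcendence basis, over which `A` is algebraic.
  have hle : Algebra.trdeg ℚ A ≤ Cardinal.mk ι := by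
    have hs : Algebra.adjoin ℚ (Set.range fun k => (⟨x k, Algebra.subset_adjoin ⟨k, rfl⟩⟩ : A)) = ⊤ := by
      rw [← Algebra.adjoin_adjoin_coe_preimage]
      congr 1
      ext a
      simp [Subtype.ext_iff]
    have : Algebra.IsAlgebraic (Algebra.adjoin ℚ
        (Set.range fun k => (⟨x k, Algebra.subset_adjoin ⟨k, rfl⟩⟩ : A))) A := by
      rw [hs]
      exact ⟨fun a => isAlgebraic_algebraMap (⟨a, trivial⟩ : (⊤ : Subalgebra ℚ A))⟩
    refine (Algebra.IsAlgebraic.trdeg_le_cardinalMk ℚ (Set.range fun k => (⟨x k, Algebra.subset_adjoin ⟨k, rfl⟩⟩ : A))).trans ?_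
    refine Cardinal.mk_range_le.trans ?_
    rw [← Nat.cast_card, ← Nat.cast_card]
    exact_mod_cast h
  have hb := hy'.isTranscendenceBasis_of_trdeg_le_of_finite hle
  have halg := hb.isAlgebraic.isAlgebraic (⟨x k, Algebra.subset_adjoin ⟨k, rfl⟩⟩ : A)
  have hmem : ∀ p ∈ Algebra.adjoin ℚ (Set.range y'), A.val p ∈ Algebra.adjoin ℚ (Set.range y) := by
    intro p hp
    have := (Subalgebra.mem_map (f := A.val)).2 ⟨p, hp, rfl⟩
    rwa [AlgHom.map_adjoin, ← Set.range_comp] at this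
  let g : Algebra.adjoin ℚ (Set.range y') →+* Algebra.adjoin ℚ (Set.range y) :=
    (A.val.toRingHom.comp (Subalgebra.val _).toRingHom).codRestrict _ fun p => hmem p p.2
  refine IsAlgebraic.ringHom_of_comp_eq g A.val.toRingHom halg ?_ ?_
  · intro a b hab
    exact Subtype.ext (Subtype.ext (congrArg (fun z : Algebra.adjoin ℚ (Set.range y) => (z : ℂ)) hab))
  · ext p
    rfl

end SimWaring

/-! ### Decompositions as solutions of a square polynomial system -/

namespace SimWaring

open MvPolynomial

/-- The exponents `(p, q)` of the monomials `a ^ p * b ^ q` with `p + q ≤ 5`, by degree. -/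
def exponents : List (ℕ × ℕ) :=
  [(0, 0), (1, 0), (0, 1), (2, 0), (1, 1), (0, 2), (3, 0), (2, 1), (1, 2), (0, 3),
    (4, 0), (3, 1), (2, 2), (1, 3), (0, 4), (5, 0), (4, 1), (3, 2), (2, 3), (1, 4), (0, 5)]

/-- The exponents of the monomial number `m`. -/
def expo (m : ℕ) : ℕ × ℕ := exponents.getD m (0, 0)

/-- Enumeration of the coefficients of a vector of degrees `(4, 4, 4, 5)`: the component of the
`k`-th coefficient. -/
def comp (k : Fin 66) : Fin 4 := if k.1 < 45 then Fin.ofNat 4 (k.1 / 15) else 3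

/-- Enumeration of the coefficients of a vector of degrees `(4, 4, 4, 5)`: the monomial of the
`k`-th coefficient. -/
def mono (k : Fin 66) : Fin 21 := if k.1 < 45 then Fin.ofNat 21 (k.1 % 15) else Fin.ofNat 21 (k.1 - 45)

/-- The position of the coefficient `c_j` among the parameters `(a, b, c_0, c_1, c_2, c_3)`. -/
def cpos (j : Fin 4) : Fin 6 := Fin.natAdd 2 j

/-- The normalized coefficients of `∑ i, c_{ij} (X_0 + a_i X_1 + b_i X_2) ^ {d_j}`. -/
def waringMap {R : Type*} [CommSemiring R] (x : Fin 11 × Fin 6 → R) (k : Fin 66) : R :=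
  ∑ i, x (i, cpos (comp k)) * (x (i, 0) ^ (expo (mono k)).1 * x (i, 1) ^ (expo (mono k)).2)

theorem waringMap_map {R S : Type*} [CommSemiring R] [CommSemiring S] (ψ : R →+* S)
    (x : Fin 11 × Fin 6 → R) (k : Fin 66) :
    waringMap (fun p => ψ (x p)) k = ψ (waringMap x k) := by
  simp [waringMap]

/-- The exponent vector of `X_0 ^ {d - p - q} * X_1 ^ p * X_2 ^ q`. -/
noncomputable def monomialExponent (d p q : ℕ) : Fin (2 + 1) →₀ ℕ :=
  Finsupp.equivFunOnFinite.symm ![d - p - q, p, q]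

theorem expo_le (k : Fin 66) :
    (expo (mono k)).1 + (expo (mono k)).2 ≤ (![4, 4, 4, 5] : Fin 4 → ℕ) (comp k) := by
  revert k; decide

theorem exists_index (j : Fin 4) (p q : ℕ) (h : p + q ≤ (![4, 4, 4, 5] : Fin 4 → ℕ) j) :
    ∃ k : Fin 66, comp k = j ∧ expo (mono k) = (p, q) := by
  have h5 : (![4, 4, 4, 5] : Fin 4 → ℕ) j ≤ 5 := by clear h; revert j; decide
  have key : ∀ (j : Fin 4) (p q : Fin 6), p.1 + q.1 ≤ (![4, 4, 4, 5] : Fin 4 → ℕ) j →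
      ∃ k : Fin 66, comp k = j ∧ expo (mono k) = (p.1, q.1) := by decide +kernel
  exact key j ⟨p, by omega⟩ ⟨q, by omega⟩ h

theorem index_injective (k l : Fin 66) (h : comp k = comp l) (h' : expo (mono k) = expo (mono l)) :
    k = l := by
  revert k l; decide +kernel

theorem degree_monomialExponent (d p q : ℕ) (h : p + q ≤ d) :
    (monomialExponent d p q).degree = d := by
  simp [Finsupp.degree_eq_sum, monomialExponent, Fin.sum_univ_three]
  omega

theorem eq_monomialExponent (m : Fin (2 + 1) →₀ ℕ) (d : ℕ) (h : m.degree = d) :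
    m = monomialExponent d (m 1) (m 2) ∧ m 1 + m 2 ≤ d := by
  have h' : m 0 + m 1 + m 2 = d := by
    simpa [Finsupp.degree_eq_sum, Fin.sum_univ_three] using h
  refine ⟨Finsupp.ext fun i => ?_, by omega⟩
  fin_cases i
  · simp [monomialExponent]; omega
  · simp [monomialExponent]
  · simp [monomialExponent]

/-- The coordinate of the space of vectors numbered `k`. -/
noncomputable def coeffIndex (k : Fin 66) : CoeffIndex 2 ![4, 4, 4, 5] :=
  ⟨comp k, monomialExponent _ (expo (mono k)).1 (expo (mono k)).2,
    degree_monomialExponent _ _ _ (expo_le k)⟩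

theorem coeffIndex_surjective : Function.Surjective coeffIndex := by
  rintro ⟨j, m, hm⟩
  obtain ⟨h1, h2⟩ := eq_monomialExponent m _ hm
  obtain ⟨k, rfl, hk⟩ := exists_index j _ _ h2
  refine ⟨k, ?_⟩
  simp only [coeffIndex, hk]
  congr 2
  exact h1.symm

theorem coeffIndex_injective : Function.Injective coeffIndex := by
  intro k l h
  have h1 : comp k = comp l := congrArg Sigma.fst h
  have h2 : (coeffIndex k).2.1 = (coeffIndex l).2.1 := by rw [h]
  refine index_injective k l h1 (Prod.ext ?_ ?_)
  · simpa [coeffIndex, monomialExponent] using DFunLike.congr_fun h2 1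
  · simpa [coeffIndex, monomialExponent] using DFunLike.congr_fun h2 2

/-- The linear form `X_0 + a X_1 + b X_2`. -/
noncomputable def affineForm (a b : ℂ) : MvPolynomial (Fin (2 + 1)) ℂ :=
  ∑ i, (![1, a, b] : Fin (2 + 1) → ℂ) i • X i

theorem affineForm_isHomogeneous (a b : ℂ) : (affineForm a b).IsHomogeneous 1 :=
  (homogeneousSubmodule (Fin (2 + 1)) ℂ 1).sum_mem fun i _ =>
    Submodule.smul_mem _ _ (isHomogeneous_X ℂ i)

/-- The multinomial factor depends on the monomial alone, not on the form. It is left out of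
`waringMap` and comes back as `weight`. -/
theorem coeff_affineForm_pow (a b : ℂ) {d p q : ℕ} (h : p + q ≤ d) :
    coeff (monomialExponent d p q) (affineForm a b ^ d) =
      (monomialExponent d p q).multinomial * (a ^ p * b ^ q) := by
  have hd : (monomialExponent d p q).sum (fun _ m => m) = d := degree_monomialExponent d p q h
  rw [affineForm, coeff_linearCombination_X_pow_of_fintype, if_pos hd]
  congr 1
  rw [Finsupp.prod_fintype _ _ (by simp)]
  simp [Fin.prod_univ_three, monomialExponent]

theorem multinomial_ne_zero (m : Fin (2 + 1) →₀ ℕ) : (m.multinomial : ℂ) ≠ 0 := by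
  rw [Finsupp.multinomial_eq]
  exact_mod_cast (Nat.multinomial_pos _ _).ne'

/-- The multinomial coefficient of the coordinate number `k`. -/
noncomputable def weight (k : Fin 66) : ℚ := ((coeffIndex k).2.1.multinomial : ℚ)

theorem weight_ne_zero (k : Fin 66) : weight k ≠ 0 := by
  have := multinomial_ne_zero (coeffIndex k).2.1
  unfold weight
  exact_mod_cast this

/-- A solution of the polynomial system gives a decomposition. -/
noncomputable def decompositionOfSolution (f : PolyVec 2 ![4, 4, 4, 5]) (hf : ∀ j, f j ≠ 0)
    (x : Fin 11 × Fin 6 → ℂ)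
    (hx : ∀ k, coeffs f (coeffIndex k) = weight k * waringMap x k) : Decomposition f 11 :=
  have hsum : ∀ j, (f j : MvPolynomial (Fin (2 + 1)) ℂ) =
      ∑ i, summand ![4, 4, 4, 5] (affineForm (x (i, 0)) (x (i, 1)))
        (fun j => x (i, cpos j)) j := by
    intro j
    ext m
    by_cases hm : m.degree = (![4, 4, 4, 5] : Fin 4 → ℕ) j
    · obtain ⟨k, hk⟩ := coeffIndex_surjective ⟨j, m, hm⟩
      have hj : comp k = j := congrArg Sigma.fst hk
      have h := hx k
      subst hj
      have hm' : monomialExponent ((![4, 4, 4, 5] : Fin 4 → ℕ) (comp k)) (expo (mono k)).1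
          (expo (mono k)).2 = m := by
        have h := eq_of_heq (Sigma.mk.inj hk).2
        exact congrArg Subtype.val h
      subst hm'
      have h0 : coeffs f (coeffIndex k) = coeff (monomialExponent _ (expo (mono k)).1
        (expo (mono k)).2) (f (comp k) : MvPolynomial (Fin (2 + 1)) ℂ) := rfl
      rw [← h0, h, coeff_sum, waringMap, Finset.mul_sum]
      refine Finset.sum_congr rfl fun i _ => ?_
      rw [summand, coeff_C_mul, coeff_affineForm_pow _ _ (expo_le k)]
      simp only [weight, coeffIndex, Rat.cast_natCast]
      ring
    -- Monomials of the wrong degree have coefficient zero on both sides, by homogeneity.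
    · have h1 : ((f j : MvPolynomial (Fin (2 + 1)) ℂ)).IsHomogeneous
        ((![4, 4, 4, 5] : Fin 4 → ℕ) j) := (f j).2
      have h2 : (∑ i, summand ![4, 4, 4, 5] (affineForm (x (i, 0)) (x (i, 1)))
        (fun j => x (i, cpos j)) j).IsHomogeneous ((![4, 4, 4, 5] : Fin 4 → ℕ) j) := by
        refine IsHomogeneous.sum _ _ _ fun i _ => ?_
        have h3 := ((affineForm_isHomogeneous (x (i, 0)) (x (i, 1))).pow
          ((![4, 4, 4, 5] : Fin 4 → ℕ) j)).C_mul (x (i, cpos j))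
        rwa [one_mul] at h3
      rw [h1.coeff_eq_zero hm, h2.coeff_eq_zero hm]
  { l := fun i => affineForm (x (i, 0)) (x (i, 1))
    c := fun i j => x (i, cpos j)
    l_linear := fun i => affineForm_isHomogeneous _ _
    c_ne_zero := by
      intro j h
      apply hf j
      apply Subtype.ext
      rw [hsum j]
      refine Finset.sum_eq_zero fun i _ => ?_
      have : x (i, cpos j) = 0 := congrFun h i
      simp [summand, this]
    sum_eq := hsum }

/-- An invariant of the set of summands: the sum of the squares of the coefficients of `X_0 ^ 4`
in the second components. -/
noncomputable def squareSum (S : Multiset (Fin 4 → MvPolynomial (Fin (2 + 1)) ℂ)) : ℂ :=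
  (S.map fun s => coeff (monomialExponent 4 0 0) (s 1) ^ 2).sum

/-- The linear forms have first coefficient 1, so the coefficient of X_0 ^ 4 in the second component
of a summand is its `c` at position 1. Squares are needed: the plain sum of these numbers is a
coefficient of `f`, the same for all decompositions. -/
theorem squareSum_decompositionOfSolution (f : PolyVec 2 ![4, 4, 4, 5]) (hf : ∀ j, f j ≠ 0)
    (x : Fin 11 × Fin 6 → ℂ) (hx : ∀ k, coeffs f (coeffIndex k) = weight k * waringMap x k) :
    squareSum (decompositionOfSolution f hf x hx).summands = ∑ i, x (i, cpos 1) ^ 2 := by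
  have h1 : (monomialExponent 4 0 0).multinomial = 1 := by
    rw [Finsupp.multinomial_eq_of_support_subset (Finset.subset_univ _)]
    change Nat.multinomial Finset.univ ![4, 0, 0] = 1
    rw [Nat.multinomial_univ_three]
    rfl
  have h : ∀ i, coeff (monomialExponent 4 0 0) (summand ![4, 4, 4, 5]
      (affineForm (x (i, 0)) (x (i, 1))) (fun j => x (i, cpos j)) 1) = x (i, cpos 1) := by
    intro i
    have := coeff_affineForm_pow (x (i, 0)) (x (i, 1)) (by norm_num : 0 + 0 ≤ 4)
    rw [summand, coeff_C_mul]
    change _ * coeff (monomialExponent 4 0 0) (affineForm (x (i, 0)) (x (i, 1)) ^ 4) = _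
    rw [this, h1]
    simp
  unfold squareSum Decomposition.summands
  rw [Multiset.map_map]
  change ∑ i, _ = _
  refine Finset.sum_congr rfl fun i _ => ?_
  exact congrArg (· ^ 2) (h i)

end SimWaring

/-! ### Dimension count: ten summands do not suffice -/

namespace SimWaring

open MvPolynomial

/-- Normalized coefficients of a linear form whose first nonzero coefficient is at position `s`. -/
def chartCoeff {R : Type*} [CommSemiring R] (s : Fin 3) (a b : R) : Fin (2 + 1) → R :=
  match s with
  | 0 => ![1, a, b]
  | 1 => ![0, 1, b]
  | 2 => ![0, 0, 1]

/-- The linear form with coefficients `chartCoeff s a b`. -/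
noncomputable def chartForm {R : Type*} [CommSemiring R] (s : Fin 3) (a b : R) :
    MvPolynomial (Fin (2 + 1)) R :=
  ∑ t, C (chartCoeff s a b t) * X t

/-- The components of a sum of ten summands in given charts. -/
noncomputable def chartSum {R : Type*} [CommSemiring R] (s : Fin 10 → Fin 3)
    (x : Fin 10 × Fin 6 → R) (j : Fin 4) : MvPolynomial (Fin (2 + 1)) R :=
  ∑ i, C (x (i, cpos j)) * chartForm (s i) (x (i, 0)) (x (i, 1)) ^ (![4, 4, 4, 5] : Fin 4 → ℕ) j

theorem map_chartSum {R S : Type*} [CommSemiring R] [CommSemiring S] (ψ : R →+* S)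
    (s : Fin 10 → Fin 3) (x : Fin 10 × Fin 6 → R) (j : Fin 4) :
    map ψ (chartSum s x j) = chartSum s (fun p => ψ (x p)) j := by
  have h : ∀ (t : Fin 3) (a b : R) (u : Fin (2 + 1)),
      ψ (chartCoeff t a b u) = chartCoeff t (ψ a) (ψ b) u := by
    intro t a b u
    fin_cases t <;> fin_cases u <;> simp [chartCoeff]
  simp [chartSum, chartForm, h]

/-- The form is divided by its first nonzero coefficient `w`, and `w ^ d_j` is absorbed in the
coefficient of component `j`. In contrast with `affineForm`, all charts are needed here, because
every decomposition must be excluded. -/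
theorem exists_chart {l : MvPolynomial (Fin (2 + 1)) ℂ} (hl : l.IsHomogeneous 1)
    (c : Fin 4 → ℂ) : ∃ (s : Fin 3) (v : Fin 6 → ℂ), ∀ j,
      summand ![4, 4, 4, 5] l c j =
        C (v (cpos j)) * chartForm s (v 0) (v 1) ^ (![4, 4, 4, 5] : Fin 4 → ℕ) j := by
  have hd : ∀ j, (![4, 4, 4, 5] : Fin 4 → ℕ) j ≠ 0 := by decide
  obtain ⟨u, hu⟩ : ∃ u : Fin (2 + 1) → ℂ, l = ∑ t, C (u t) * X t := by
    refine ⟨fun t => coeff (Finsupp.single t 1) l, ?_⟩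
    ext m
    by_cases hm : m.degree = 1
    · obtain ⟨t, rfl⟩ : ∃ t, m = Finsupp.single t 1 := by
        have h' : m 0 + m 1 + m 2 = 1 := by
          simpa [Finsupp.degree_eq_sum, Fin.sum_univ_three] using hm
        obtain ⟨t, ht⟩ : ∃ t, m t ≠ 0 := by
          by_contra! h
          simp [h] at h'
        refine ⟨t, Finsupp.ext fun i => ?_⟩
        fin_cases t <;> fin_cases i <;> simp at ht ⊢ <;> omega
      rw [coeff_sum, Finset.sum_eq_single t]
      · simp
      · intro b _ hb
        rw [coeff_C_mul, coeff_X, if_neg, mul_zero]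
        intro h
        exact hb ((Finsupp.single_left_inj one_ne_zero).1 h)
      · simp
    · rw [hl.coeff_eq_zero hm]
      refine (IsHomogeneous.coeff_eq_zero (n := 1) ?_ hm).symm
      exact IsHomogeneous.sum _ _ _ fun t _ => (isHomogeneous_X ℂ t).C_mul _
  have scale : ∀ (s : Fin 3) (w a b : ℂ), (∀ t, u t = w * chartCoeff s a b t) →
      ∃ (s : Fin 3) (v : Fin 6 → ℂ), ∀ j, summand ![4, 4, 4, 5] l c j =
        C (v (cpos j)) * chartForm s (v 0) (v 1) ^ (![4, 4, 4, 5] : Fin 4 → ℕ) j := by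
    intro s w a b h
    refine ⟨s, Fin.append ![a, b] (fun j => c j * w ^ (![4, 4, 4, 5] : Fin 4 → ℕ) j), fun j => ?_⟩
    have h0 : (Fin.append ![a, b] (fun j => c j * w ^ (![4, 4, 4, 5] : Fin 4 → ℕ) j)
      : Fin (2 + 4) → ℂ) 0 = a := rfl
    have h1 : (Fin.append ![a, b] (fun j => c j * w ^ (![4, 4, 4, 5] : Fin 4 → ℕ) j)
      : Fin (2 + 4) → ℂ) 1 = b := rfl
    have h2 : (Fin.append ![a, b] (fun j => c j * w ^ (![4, 4, 4, 5] : Fin 4 → ℕ) j)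
      : Fin (2 + 4) → ℂ) (cpos j) = c j * w ^ (![4, 4, 4, 5] : Fin 4 → ℕ) j :=
      Fin.append_right _ _ _
    have hlw : l = C w * chartForm s a b := by
      rw [hu, chartForm, Finset.mul_sum]
      refine Finset.sum_congr rfl fun t _ => ?_
      rw [h t, C_mul, mul_assoc]
    refine Eq.trans ?_ (congrArg₂ (· * ·) (congrArg C h2.symm) (congrArg
      (· ^ (![4, 4, 4, 5] : Fin 4 → ℕ) j) (congrArg₂ (chartForm s) h0.symm h1.symm)))
    simp only [summand]
    rw [hlw, mul_pow, C_mul, C_pow, mul_assoc]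
  by_cases h0 : u 0 = 0
  · by_cases h1 : u 1 = 0
    -- This case includes `l = 0`, where the factor `u 2` vanishes.
    · exact scale 2 (u 2) 0 0 (by intro t; fin_cases t <;> simp [chartCoeff, h0, h1])
    · refine scale 1 (u 1) 0 (u 2 / u 1) ?_
      intro t; fin_cases t <;> simp [chartCoeff, h0]; field_simp
  · refine scale 0 (u 0) (u 1 / u 0) (u 2 / u 0) ?_
    intro t; fin_cases t <;> simp [chartCoeff] <;> field_simp

/-- The sums of ten summands in given charts satisfy an algebraic relation. -/
theorem exists_relation (s : Fin 10 → Fin 3) : ∃ Φ : MvPolynomial (Fin 66) ℂ, Φ ≠ 0 ∧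
    ∀ x : Fin 10 × Fin 6 → ℂ,
      eval (fun k => coeff (coeffIndex k).2.1 (chartSum s x (comp k))) Φ = 0 := by
  let g : Fin 66 → MvPolynomial (Fin 10 × Fin 6) ℂ := fun k =>
    coeff (coeffIndex k).2.1 (chartSum s X (comp k))
  -- Independence of 66 polynomials in 60 variables would contradict the transcendence degree.
  have hg : ¬ AlgebraicIndependent ℂ g := by
    intro h
    have h1 := h.cardinalMk_le_trdeg
    rw [MvPolynomial.trdeg_of_isDomain] at h1
    simp only [Cardinal.mk_fin, Cardinal.mk_prod, Cardinal.lift_id] at h1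
    norm_cast at h1
  rw [algebraicIndependent_iff] at hg
  push Not at hg
  obtain ⟨Φ, hΦ, hne⟩ := hg
  refine ⟨Φ, hne, fun x => ?_⟩
  have h : eval x (aeval g Φ) = 0 := by rw [hΦ, map_zero]
  rw [← h, map_aeval]
  have hC : (eval x).comp (algebraMap ℂ (MvPolynomial (Fin 10 × Fin 6) ℂ)) = RingHom.id ℂ :=
    RingHom.ext fun z => by simp [algebraMap_eq]
  have hg : ∀ k, eval x (g k) = coeff (coeffIndex k).2.1 (chartSum s x (comp k)) := by
    intro k
    rw [← coeff_map, map_chartSum]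
    simp
  simp only [hC, hg]
  rfl

/-- The sum of `k ≤ 10` summands can be written in charts. -/
theorem exists_chartSum_eq {f : PolyVec 2 ![4, 4, 4, 5]} {k : ℕ} (hk : k ≤ 10)
    (D : Decomposition f k) : ∃ (s : Fin 10 → Fin 3) (x : Fin 10 × Fin 6 → ℂ),
      ∀ j, (f j : MvPolynomial (Fin (2 + 1)) ℂ) = chartSum s x j := by
  choose s v hv using fun i => exists_chart (D.l_linear i) (D.c i)
  -- Missing summands are filled up with zero coefficients, so that all `k ≤ 10` are treated at
  -- once.
  refine ⟨fun i => if h : i.1 < k then s ⟨i, h⟩ else 0,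
    fun p => if h : p.1.1 < k then v ⟨p.1, h⟩ p.2 else 0, fun j => ?_⟩
  rw [D.sum_eq j]
  let G : ℕ → MvPolynomial (Fin (2 + 1)) ℂ := fun n => if h : n < k then
    summand ![4, 4, 4, 5] (D.l ⟨n, h⟩) (D.c ⟨n, h⟩) j else 0
  have h1 : ∑ i, summand ![4, 4, 4, 5] (D.l i) (D.c i) j = ∑ n ∈ Finset.range k, G n := by
    rw [Finset.sum_range]
    exact Finset.sum_congr rfl fun i _ => by simp [G]
  have h2 : ∑ n ∈ Finset.range k, G n = ∑ n ∈ Finset.range 10, G n := by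
    refine Finset.sum_subset (Finset.range_subset_range.2 hk) fun n _ hn => ?_
    rw [Finset.mem_range] at hn
    simp [G, hn]
  rw [h1, h2, Finset.sum_range, chartSum]
  refine Finset.sum_congr rfl fun i _ => ?_
  by_cases h : i.1 < k
  · simp only [G, h, dif_pos]
    exact hv ⟨i, h⟩ j
  · simp [G, h]

/-- The general vector is not a sum of at most ten summands. -/
theorem generally_isEmpty_decomposition :
    Generally 2 ![4, 4, 4, 5] fun f => ∀ k ≤ 10, IsEmpty (Decomposition f k) := by
  choose Φ hne hΦ using exists_relation
  -- The product runs over the finitely many choices of a chart for each of the ten summands.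
  refine ⟨∏ s, rename coeffIndex (Φ s), Finset.prod_ne_zero_iff.2 fun s _ =>
    (map_ne_zero_iff _ (rename_injective _ coeffIndex_injective)).2 (hne s), ?_⟩
  intro f hf k hk
  refine ⟨fun D => ?_⟩
  obtain ⟨s, x, hx⟩ := exists_chartSum_eq hk D
  rw [map_prod] at hf
  apply Finset.prod_ne_zero_iff.1 hf s (Finset.mem_univ s)
  rw [eval_rename, ← hΦ s x]
  congr 1
  refine congrArg eval (funext fun k => ?_)
  rw [← hx]
  rfl

end SimWaring

/-! ### From a neighbourhood of a rational vector to the general vector -/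

namespace SimWaring

open MvPolynomial Filter Topology

/-- Since ℚ is countable, a transcendence basis of ℂ over it has the cardinality of the continuum.
-/
theorem exists_algebraicIndependent (n : ℕ) : ∃ ξ : Fin n → ℂ, AlgebraicIndependent ℚ ξ := by
  obtain ⟨s, hs⟩ := exists_isTranscendenceBasis ℚ ℂ
  have hcard := IsAlgClosed.cardinal_eq_cardinal_transcendence_basis_of_aleph0_lt _ hs
    (Cardinal.mk_le_aleph0_iff.2 inferInstance)
    (by rw [Cardinal.mk_complex]; exact Cardinal.aleph0_lt_continuum)
  have hinf : Infinite s := by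
    rw [Cardinal.infinite_iff]
    rw [Cardinal.lift_id, Cardinal.lift_id] at hcard
    rw [← hcard, Cardinal.mk_complex]
    exact Cardinal.aleph0_le_continuum
  let e : Fin n ↪ s := Fin.valEmbedding.trans (Infinite.natEmbedding s)
  exact ⟨_, hs.1.comp e e.injective⟩

/-- A property that holds near a rational point holds at some point with algebraically
independent coordinates. -/
theorem exists_algebraicIndependent_of_eventually {n : ℕ} (f₀ : Fin n → ℚ)
    {P : (Fin n → ℂ) → Prop} (h : ∀ᶠ y in 𝓝 (fun k => (f₀ k : ℂ)), P y) :
    ∃ y, AlgebraicIndependent ℚ y ∧ P y := by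
  obtain ⟨ξ, hξ⟩ := exists_algebraicIndependent n
  -- The points `f₀ + ξ / (m + 1)` tend to `f₀`, and each coordinate is a rational polynomial of
  -- degree one in the corresponding `ξ k`, so independence persists.
  have ht : Tendsto (fun (m : ℕ) (k : Fin n) => (f₀ k : ℂ) + (1 / ((m : ℂ) + 1)) * ξ k) atTop
      (𝓝 fun k => (f₀ k : ℂ)) := by
    rw [tendsto_pi_nhds]
    intro k
    have := (tendsto_one_div_add_atTop_nhds_zero_nat (𝕜 := ℂ)).mul_const (ξ k)
    simpa using this.const_add (f₀ k : ℂ)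
  obtain ⟨m, hm⟩ := (ht.eventually h).exists
  refine ⟨_, ?_, hm⟩
  have key := hξ.polynomial_aeval_of_transcendental
    (f := fun k => Polynomial.C (1 / ((m : ℚ) + 1)) * Polynomial.X + Polynomial.C (f₀ k)) fun k => by
      have h1 : (1 / ((m : ℚ) + 1)) ≠ 0 := by positivity
      refine Polynomial.transcendental _ ?_ ?_
      · rw [Polynomial.natDegree_linear h1]; exact one_ne_zero
      · rw [Polynomial.leadingCoeff_linear h1]
        exact mem_nonZeroDivisors_of_ne_zero h1
  convert key using 2 with k
  simp [add_comm]

/-- If near a rational point all vectors have many solutions with distinct invariants, then the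
general vector has at least as many decompositions. -/
theorem generally_le_encard_decompositions {N : ℕ} (f₀ : Fin 66 → ℚ)
    (h : ∀ᶠ y in 𝓝 (fun k => (f₀ k : ℂ)), ∃ x : Fin N → Fin 11 × Fin 6 → ℂ,
      (∀ n k, waringMap (x n) k = y k) ∧ Function.Injective fun n => ∑ i, x n (i, cpos 1) ^ 2) :
    Generally 2 ![4, 4, 4, 5] fun f => (N : ℕ∞) ≤ (decompositions f 11).encard := by
  classical
  obtain ⟨y, hy, x, hxy, hinj⟩ := exists_algebraicIndependent_of_eventually f₀ h
  have halg : ∀ n p, IsAlgebraic (Algebra.adjoin ℚ (Set.range y)) (x n p) := by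
    intro n p
    refine isAlgebraic_of_mem_adjoin (by simp) hy (x := x n) (fun k => ?_) p
    rw [← hxy n k, waringMap]
    refine Subalgebra.sum_mem _ fun i _ => Subalgebra.mul_mem _ (Algebra.subset_adjoin (Set.mem_range_self _))
      (Subalgebra.mul_mem _ (Subalgebra.pow_mem _ (Algebra.subset_adjoin (Set.mem_range_self _)) _)
        (Subalgebra.pow_mem _ (Algebra.subset_adjoin (Set.mem_range_self _)) _))
  set τ : Fin N → ℂ := fun n => ∑ i, x n (i, cpos 1) ^ 2 with hτ
  have hτalg : ∀ n, IsAlgebraic (Algebra.adjoin ℚ (Set.range y)) (τ n) := fun n =>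
    Finset.sum_induction _ _ (fun _ _ ha hb => ha.add hb) isAlgebraic_zero
      fun i _ => (halg n _).pow 2
  -- The inverses of the differences of invariants keep the invariants distinct after
  -- specialization. On the diagonal the entry is `0⁻¹ = 0`, which is harmless.
  let T : Finset ℂ := (Finset.univ.image fun q : Fin N × (Fin 11 × Fin 6) => x q.1 q.2) ∪
    Finset.univ.image fun q : Fin N × Fin N => (τ q.1 - τ q.2)⁻¹
  obtain ⟨Φ, hΦ, hspec⟩ := exists_specialization y hy T (by
    intro t ht
    rcases Finset.mem_union.1 ht with ht | ht
    · obtain ⟨q, -, rfl⟩ := Finset.mem_image.1 ht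
      exact halg _ _
    · obtain ⟨q, -, rfl⟩ := Finset.mem_image.1 ht
      exact ((hτalg _).sub (hτalg _)).inv)
  -- The first factor is `Φ` in the normalized coefficients. The second makes all coefficients of
  -- `f` nonzero, so that no component vanishes, as a decomposition with nonzero coefficient vectors
  -- requires.
  refine ⟨aeval (fun k => C (((weight k)⁻¹ : ℚ) : ℂ) * X (coeffIndex k)) Φ *
    ∏ k, X (coeffIndex k), ?_, ?_⟩
  · intro h0
    have h1 : map (algebraMap ℚ ℂ) Φ * ∏ k, X k ≠ 0 := mul_ne_zero
      ((map_ne_zero_iff _ (map_injective _ (algebraMap ℚ ℂ).injective)).2 hΦ)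
      (Finset.prod_ne_zero_iff.2 fun k _ => X_ne_zero k)
    obtain ⟨v, hv⟩ : ∃ v, eval v (map (algebraMap ℚ ℂ) Φ * ∏ k, X k) ≠ 0 := by
      by_contra! hcon
      exact h1 (MvPolynomial.funext fun v => by rw [hcon v, map_zero])
    let e := Equiv.ofBijective coeffIndex ⟨coeffIndex_injective, coeffIndex_surjective⟩
    have he : ∀ k, e.symm (coeffIndex k) = k := fun k => e.symm_apply_apply k
    -- At the point with coordinates `weight k * v k` the first factor takes the value of `Φ` at
    -- `v`.
    have h2 := congrArg (eval fun c => (weight (e.symm c) : ℂ) * v (e.symm c)) h0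
    have hw : ∀ k, (weight k : ℂ) ≠ 0 := fun k => Rat.cast_ne_zero.2 (weight_ne_zero k)
    rw [map_mul, map_aeval, map_prod, map_zero] at h2
    simp only [map_mul, eval_X, eval_C, he, Finset.prod_mul_distrib, map_prod] at h2 hv
    rw [eval_map] at hv
    rcases mul_eq_zero.1 h2 with h3 | h3
    · apply left_ne_zero_of_mul hv
      rw [← h3]
      change _ = eval₂ _ _ Φ
      congr 1
      · exact Subsingleton.elim _ _
      · funext k
        rw [Rat.cast_inv, inv_mul_cancel_left₀ (hw k)]
    · rcases mul_eq_zero.1 h3 with h4 | h4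
      · exact Finset.prod_ne_zero_iff.2 (fun k _ => hw k) h4
      · exact right_ne_zero_of_mul hv h4
  · intro f hf
    rw [map_mul, map_aeval, map_prod] at hf
    simp only [map_mul, eval_X, eval_C] at hf
    have hf1 := left_ne_zero_of_mul hf
    have hf2 := Finset.prod_ne_zero_iff.1 (right_ne_zero_of_mul hf)
    have hfj : ∀ j, f j ≠ 0 := by
      intro j hj
      obtain ⟨k, rfl, -⟩ := exists_index j 0 0 (Nat.zero_le _)
      apply hf2 k (Finset.mem_univ k)
      change coeff _ (f (comp k) : MvPolynomial (Fin (2 + 1)) ℂ) = 0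
      rw [hj]
      simp
    obtain ⟨B, ψ, hTB, hψ⟩ := hspec (fun k => (((weight k)⁻¹ : ℚ) : ℂ) * coeffs f (coeffIndex k)) (by
      convert hf1 using 1
      rw [aeval_def, coe_eval₂Hom]
      congr 1
      exact Subsingleton.elim _ _)
    have hxB : ∀ n p, x n p ∈ B := fun n p => hTB _ (Finset.mem_union_left _
      (Finset.mem_image.2 ⟨(n, p), Finset.mem_univ _, rfl⟩))
    let x' : Fin N → Fin 11 × Fin 6 → ℂ := fun n p => ψ ⟨x n p, hxB n p⟩
    have hx' : ∀ n k, coeffs f (coeffIndex k) = weight k * waringMap (x' n) k := by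
      intro n k
      obtain ⟨hk, hψk⟩ := hψ k
      -- The equation holds in ℂ between elements of the subring `B`, hence in `B`, and `ψ` carries
      -- it to the equation for `f`.
      have h1 : waringMap (fun p => (⟨x n p, hxB n p⟩ : B)) k = ⟨y k, hk⟩ := by
        apply Subtype.ext
        exact (waringMap_map B.subtype (fun p => (⟨x n p, hxB n p⟩ : B)) k).symm.trans (hxy n k)
      rw [waringMap_map ψ, h1, hψk, Rat.cast_inv, mul_inv_cancel_left₀]
      exact Rat.cast_ne_zero.2 (weight_ne_zero k)
    have hinj' : Function.Injective fun n => ∑ i, x' n (i, cpos 1) ^ 2 := by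
      intro n m hnm
      by_contra hne
      have hne' : τ n - τ m ≠ 0 := sub_ne_zero.2 fun h => hne (hinj h)
      have hB : (τ n - τ m)⁻¹ ∈ B := hTB _ (Finset.mem_union_right _
        (Finset.mem_image.2 ⟨(n, m), Finset.mem_univ _, rfl⟩))
      let t : Fin N → B := fun n => ∑ i, (⟨x n (i, cpos 1), hxB _ _⟩ : B) ^ 2
      have ht : ∀ n, (t n : ℂ) = τ n := fun n => by simp [t, hτ]
      have htψ : ∀ n, ψ (t n) = ∑ i, x' n (i, cpos 1) ^ 2 := fun n => by
        simp only [t, x', map_sum, map_pow]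
      -- In `B` the difference of invariants is a unit; if `ψ` identified the two invariants, this
      -- identity would become 0 = 1.
      have h1 : (t n - t m) * ⟨_, hB⟩ = 1 := by
        apply Subtype.ext
        simp [ht, hne']
      have h2 := congrArg ψ h1
      rw [map_mul, map_sub, htψ, htψ] at h2
      simp only at hnm
      rw [hnm, sub_self, zero_mul, map_one] at h2
      exact zero_ne_one h2
    let D : Fin N → Multiset (Fin 4 → MvPolynomial (Fin (2 + 1)) ℂ) := fun n =>
      (decompositionOfSolution f hfj (x' n) (hx' n)).summands
    have hD : Function.Injective D := by
      intro n m hnm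
      apply hinj'
      simp only
      rw [← squareSum_decompositionOfSolution f hfj (x' n) (hx' n),
        ← squareSum_decompositionOfSolution f hfj (x' m) (hx' m)]
      exact congrArg squareSum hnm
    have hle : Set.range D ⊆ decompositions f 11 := by
      rintro _ ⟨n, rfl⟩
      exact ⟨_, rfl⟩
    refine le_trans ?_ (Set.encard_le_encard hle)
    rw [← Set.image_univ, hD.encard_image, Set.encard_univ]
    simp

theorem Generally.and {n r : ℕ} {d : Fin r → ℕ} {P Q : PolyVec n d → Prop}
    (hP : Generally n d P) (hQ : Generally n d Q) : Generally n d fun f => P f ∧ Q f := by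
  obtain ⟨Φ, hΦ, hP⟩ := hP
  obtain ⟨Ψ, hΨ, hQ⟩ := hQ
  refine ⟨Φ * Ψ, mul_ne_zero hΦ hΨ, fun f hf => ?_⟩
  rw [map_mul] at hf
  exact ⟨hP f (left_ne_zero_of_mul hf), hQ f (right_ne_zero_of_mul hf)⟩

theorem Generally.exists {n r : ℕ} {d : Fin r → ℕ} {P : PolyVec n d → Prop}
    (hP : Generally n d P) : ∃ f, P f := by
  classical
  obtain ⟨Φ, hΦ, hP⟩ := hP
  obtain ⟨v, hv⟩ : ∃ v, eval v Φ ≠ 0 := by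
    by_contra! hcon
    exact hΦ (MvPolynomial.funext fun v => by rw [hcon v, map_zero])
  have hfin : ∀ j, {m : Fin (n + 1) →₀ ℕ | m.degree = d j}.Finite := fun j =>
    Finsupp.finite_of_degree_le (d j) |>.subset fun m hm => le_of_eq hm
  let f : PolyVec n d := fun j => ⟨∑ m ∈ (hfin j).toFinset.attach,
    monomial m.1 (v ⟨j, m.1, (hfin j).mem_toFinset.1 m.2⟩),
    Submodule.sum_mem _ fun m _ => isHomogeneous_monomial _ ((hfin j).mem_toFinset.1 m.2)⟩
  refine ⟨f, hP f ?_⟩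
  convert hv using 2
  refine congrArg eval ?_
  funext ⟨j, m, hm⟩
  simp only [coeffs, f, coeff_sum, coeff_monomial]
  rw [Finset.sum_eq_single ⟨m, (hfin j).mem_toFinset.2 hm⟩]
  · simp
  · intro b _ hb
    rw [if_neg]
    intro h
    exact hb (Subtype.ext h)
  · intro h
    exact absurd (Finset.mem_attach _ _) h

theorem not_existsUnique_of_two_le_encard {α : Type*} {s : Set α} {N : ℕ} (hN : 2 ≤ N)
    (h : (N : ℕ∞) ≤ s.encard) : ¬ ∃! a, a ∈ s := by
  rintro ⟨a, ha, hu⟩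
  have : s = {a} := Set.eq_singleton_iff_unique_mem.2 ⟨ha, hu⟩
  rw [this, Set.encard_singleton] at h
  have : N ≤ 1 := by exact_mod_cast h
  omega

/-- The main theorem, from the existence of many solutions near a rational point. -/
theorem main_of_eventually (f₀ : Fin 66 → ℚ)
    (h : ∀ᶠ y in 𝓝 (fun k => (f₀ k : ℂ)), ∃ x : Fin 36 → Fin 11 × Fin 6 → ℂ,
      (∀ n k, waringMap (x n) k = y k) ∧ Function.Injective fun n => ∑ i, x n (i, cpos 1) ^ 2) :
    Generally 2 ![4, 4, 4, 5] (fun f =>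
      36 ≤ (decompositions f 11).encard ∧ ¬ Identifiable f) ∧ ¬ ConjectureAt 4 := by
  have h36 := generally_le_encard_decompositions f₀ h
  have hd : conjDegrees 4 = ![4, 4, 4, 5] := by
    funext j
    fin_cases j <;> rfl
  refine ⟨?_, fun hconj => ?_⟩
  · obtain ⟨Φ, hΦ, hP⟩ := h36.and generally_isEmpty_decomposition
    refine ⟨Φ, hΦ, fun f hf => ?_⟩
    obtain ⟨h1, h2⟩ := hP f hf
    refine ⟨h1, ?_⟩
    rintro ⟨k, hk, hu⟩
    have hk11 : k = 11 := by
      apply le_antisymm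
      · have hne : (decompositions f 11).Nonempty := by
          rw [← Set.encard_pos]
          exact lt_of_lt_of_le (by norm_num) h1
        obtain ⟨_, D, -⟩ := hne
        exact hk.2 ⟨by norm_num, ⟨D⟩⟩
      · by_contra! hlt
        obtain ⟨D⟩ := hk.1.2
        exact (h2 k (by omega)).false D
    subst hk11
    exact not_existsUnique_of_two_le_encard (by norm_num) h1 hu
  · unfold ConjectureAt at hconj
    rw [hd] at hconj
    -- Two general properties hold together at some vector. The number of summands in the
    -- conjecture, (4 ^ 2 + 4 + 2) / 2, reduces to 11.
    obtain ⟨f, h1, h2⟩ := (h36.and hconj).exists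
    exact not_existsUnique_of_two_le_encard (by norm_num) h1 h2

end SimWaring

/-! ### A quantitative inverse function theorem for the Waring map -/

namespace SimWaring

open Filter Topology Metric

/-- A quantitative inverse function theorem: if `A ∘ F` is close to the identity near `x₀` and
`A (F x₀)` is close to `A f₀`, then `F` takes all values near `f₀`. -/
theorem eventually_exists_eq_of_approx {ι κ : Type*} [Fintype ι] [Fintype κ]
    (hcard : Fintype.card ι = Fintype.card κ) (F : (ι → ℂ) → κ → ℂ) (A : Matrix ι κ ℂ)
    (x₀ : ι → ℂ) (f₀ : κ → ℂ) {r : ℝ} (hr : 0 < r)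
    (h1 : ∀ x ∈ closedBall x₀ r, ∀ x' ∈ closedBall x₀ r,
      ‖A.mulVec (F x - F x') - (x - x')‖ ≤ 1 / 2 * ‖x - x'‖)
    (h2 : ‖A.mulVec (F x₀ - f₀)‖ ≤ r / 4) :
    ∀ᶠ y in 𝓝 f₀, ∃ x ∈ closedBall x₀ r, F x = y := by
  classical
  have happ : ApproximatesLinearOn (fun x => A.mulVec (F x)) (ContinuousLinearMap.id ℂ (ι → ℂ))
      (closedBall x₀ r) (1 / 2) := by
    intro x hx x' hx'
    have := h1 x hx x' hx'
    rw [Matrix.mulVec_sub] at this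
    simpa using this
  let inv : (ContinuousLinearMap.id ℂ (ι → ℂ)).NonlinearRightInverse :=
    { toFun := id, nnnorm := 1, bound' := fun y => by simp, right_inv' := fun y => rfl }
  -- A map within 1/2 of the identity on a ball of radius `r` covers the ball of radius `(1 - 1/2)
  -- r` about the image of the center.
  have hsurj := happ.surjOn_closedBall_of_nonlinearRightInverse inv hr.le subset_rfl
  have hinv : (inv.nnnorm : ℝ) = 1 := rfl
  rw [hinv] at hsurj
  norm_num at hsurj
  -- Invertibility of `A` is not assumed: a small multiple of any `v`, added to `A (F x₀)`, is a
  -- value of `A ∘ F`, so `v` is in the range of `A`. As `A` is square, it is injective, and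
  -- equality of the `A`-images gives `F x = y`.
  have hAsurj : Function.Surjective A.mulVecLin := by
    intro v
    obtain ⟨t, ht0, ht⟩ : ∃ t : ℝ, 0 < t ∧ t * ‖v‖ ≤ 1 / 2 * r := by
      refine ⟨r / (2 * (‖v‖ + 1)), by positivity, ?_⟩
      rw [div_mul_eq_mul_div, div_le_iff₀ (by positivity)]
      nlinarith [norm_nonneg v]
    have hmem : A.mulVec (F x₀) + (t : ℂ) • v ∈
        closedBall (A.mulVec (F x₀)) (1 / 2 * r) := by
      rw [mem_closedBall, dist_eq_norm, add_sub_cancel_left, norm_smul]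
      simpa [abs_of_pos ht0] using ht
    obtain ⟨x, -, hx⟩ := hsurj hmem
    refine ⟨(t : ℂ)⁻¹ • (F x - F x₀), ?_⟩
    have hx' : A.mulVec (F x) = A.mulVec (F x₀) + (t : ℂ) • v := hx
    rw [map_smul, Matrix.mulVecLin_apply, Matrix.mulVec_sub, hx', add_sub_cancel_left,
      inv_smul_smul₀ (by exact_mod_cast ht0.ne')]
  have hAinj : Function.Injective A.mulVecLin :=
    (LinearMap.injective_iff_surjective_of_finrank_eq_finrank (by simp [hcard])).2 hAsurj
  have hcont : Continuous fun y : κ → ℂ => A.mulVec (y - f₀) :=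
    Continuous.matrix_mulVec continuous_const (continuous_id.sub continuous_const)
  -- Half of the radius `r / 2` is reserved for the residual at `x₀`, the other half for the
  -- distance from `y` to `f₀`.
  have hev : ∀ᶠ y in 𝓝 f₀, ‖A.mulVec (y - f₀)‖ < r / 4 := by
    have := (continuous_norm.comp hcont).tendsto f₀
    simp only [Function.comp_def, sub_self, Matrix.mulVec_zero, norm_zero] at this
    exact this.eventually (gt_mem_nhds (by positivity))
  filter_upwards [hev] with y hy
  have hmem : A.mulVec y ∈ closedBall (A.mulVec (F x₀)) (1 / 2 * r) := by
    rw [mem_closedBall, dist_eq_norm, ← Matrix.mulVec_sub]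
    have : y - F x₀ = (y - f₀) - (F x₀ - f₀) := by abel
    rw [this, Matrix.mulVec_sub]
    refine (norm_sub_le _ _).trans ?_
    linarith
  obtain ⟨x, hx, hxy⟩ := hsurj hmem
  exact ⟨x, hx, hAinj hxy⟩

/-- First order data of a product of `n` factors of size at most `B`: values `u`, `v` at two points
at distance `δ`, value `w` at a point at distance `r` from both, linearization `D` at the
latter point. -/
structure FirstOrder (B r δ : ℝ) (n : ℕ) (u v w D : ℂ) : Prop where
  norm_u : ‖u‖ ≤ B ^ n
  norm_v : ‖v‖ ≤ B ^ n
  norm_w : ‖w‖ ≤ B ^ n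
  sub_uw : ‖u - w‖ ≤ n * B ^ n * r
  sub_vw : ‖v - w‖ ≤ n * B ^ n * r
  sub_uv : ‖u - v‖ ≤ n * B ^ n * δ
  sub_D : ‖u - v - D‖ ≤ n ^ 2 * B ^ n * r * δ

theorem FirstOrder.one {B r δ : ℝ} : FirstOrder B r δ 0 1 1 1 0 := by
  constructor <;> simp

/-- The bounds are chosen to be closed under products: powers of `B` multiply, first order bounds
add as n₁ + n₂, and the error of the linearization is a sum of four products with constants n₁²,
n₁n₂, n₂², n₁n₂, which make (n₁ + n₂)². -/
theorem FirstOrder.mul {B r δ : ℝ} {n₁ n₂ : ℕ}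
    {u₁ v₁ w₁ D₁ u₂ v₂ w₂ D₂ : ℂ} (h₁ : FirstOrder B r δ n₁ u₁ v₁ w₁ D₁)
    (h₂ : FirstOrder B r δ n₂ u₂ v₂ w₂ D₂) :
    FirstOrder B r δ (n₁ + n₂) (u₁ * u₂) (v₁ * v₂) (w₁ * w₂) (D₁ * w₂ + w₁ * D₂) := by
  have hm : ∀ {a b : ℂ} {s t : ℝ}, ‖a‖ ≤ s → ‖b‖ ≤ t → ‖a * b‖ ≤ s * t := fun ha hb => by
    rw [norm_mul]; exact mul_le_mul ha hb (norm_nonneg _) ((norm_nonneg _).trans ha)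
  have hadd : ∀ {a b : ℂ} {s t : ℝ}, ‖a‖ ≤ s → ‖b‖ ≤ t → ‖a + b‖ ≤ s + t := fun ha hb =>
    (norm_add_le _ _).trans (add_le_add ha hb)
  obtain ⟨a1, a2, a3, a4, a5, a6, a7⟩ := h₁
  obtain ⟨b1, b2, b3, b4, b5, b6, b7⟩ := h₂
  constructor
  · rw [pow_add]; exact hm a1 b1
  · rw [pow_add]; exact hm a2 b2
  · rw [pow_add]; exact hm a3 b3
  · have := hadd (hm a4 b1) (hm a3 b4)
    convert this using 1
    · congr 1; ring
    · push_cast; ring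
  · have := hadd (hm a5 b2) (hm a3 b5)
    convert this using 1
    · congr 1; ring
    · push_cast; ring
  · have := hadd (hm a6 b1) (hm a2 b6)
    convert this using 1
    · congr 1; ring
    · push_cast; ring
  · have := hadd (hadd (hm a7 b3) (hm a6 b4)) (hadd (hm a3 b7) (hm a5 b6))
    convert this using 1
    · congr 1; ring
    · push_cast; ring

theorem FirstOrder.pow {B r δ : ℝ} {u v w D : ℂ}
    (h : FirstOrder B r δ 1 u v w D) (p : ℕ) :
    FirstOrder B r δ p (u ^ p) (v ^ p) (w ^ p) (p * w ^ (p - 1) * D) := by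
  induction p with
  | zero => simpa using FirstOrder.one
  | succ p ih =>
    have := ih.mul h
    convert this using 1
    · rw [pow_succ]
    · rw [pow_succ]
    · rw [pow_succ]
    · rcases p with _ | p
      · simp
      · rw [show p + 1 + 1 - 1 = p + 1 from rfl, show p + 1 - 1 = p from rfl]
        push_cast
        ring

/-- The differential of `waringMap` at `x₀`. -/
def waringDeriv (x₀ v : Fin 11 × Fin 6 → ℂ) (k : Fin 66) : ℂ :=
  ∑ i, (v (i, cpos (comp k)) * (x₀ (i, 0) ^ (expo (mono k)).1 * x₀ (i, 1) ^ (expo (mono k)).2) +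
    x₀ (i, cpos (comp k)) *
      ((expo (mono k)).1 * x₀ (i, 0) ^ ((expo (mono k)).1 - 1) * v (i, 0) *
          x₀ (i, 1) ^ (expo (mono k)).2 +
        x₀ (i, 0) ^ (expo (mono k)).1 *
          ((expo (mono k)).2 * x₀ (i, 1) ^ ((expo (mono k)).2 - 1) * v (i, 1))))

/-- Each of the eleven summands is a product of at most six factors: one `c` and at most five among
`a`, `b`. With n ≤ 6 the error n² B ^ n of `FirstOrder` is at most 36 B ^ 6. The bound is
proportional to both the radius and the distance of the points, so it is a small Lipschitz constant.
-/
theorem norm_waringMap_sub_sub_le {B r : ℝ} (hB1 : 1 ≤ B) (hr : 0 ≤ r)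
    {x₀ x x' : Fin 11 × Fin 6 → ℂ} (hB : ∀ p, ‖x₀ p‖ + r ≤ B)
    (hx : x ∈ closedBall x₀ r) (hx' : x' ∈ closedBall x₀ r) (k : Fin 66) :
    ‖waringMap x k - waringMap x' k - waringDeriv x₀ (x - x') k‖ ≤
      11 * (36 * B ^ 6 * r * ‖x - x'‖) := by
  have hB0 : 0 ≤ B := by linarith
  have hδ := norm_nonneg (x - x')
  have hcoord : ∀ {z : Fin 11 × Fin 6 → ℂ}, z ∈ closedBall x₀ r → ∀ p, ‖z p - x₀ p‖ ≤ r :=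
    fun hz p => (norm_le_pi_norm (_ - x₀) p).trans (by rwa [mem_closedBall, dist_eq_norm] at hz)
  have h1 : ∀ p, FirstOrder B r ‖x - x'‖ 1 (x p) (x' p) (x₀ p) ((x - x') p) := by
    intro p
    have e1 := hcoord hx p
    have e2 := hcoord hx' p
    have e3 := hB p
    constructor
    · rw [pow_one]; have := norm_le_norm_add_norm_sub (x₀ p) (x p)
      rw [norm_sub_rev] at this; linarith
    · rw [pow_one]; have := norm_le_norm_add_norm_sub (x₀ p) (x' p)
      rw [norm_sub_rev] at this; linarith
    · rw [pow_one]; linarith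
    -- A single coordinate moves by at most `r`, and `B ≥ 1` allows the factor `B ^ 1`.
    · simp only [Nat.cast_one, one_mul, pow_one]; nlinarith
    · simp only [Nat.cast_one, one_mul, pow_one]; nlinarith
    · have := norm_le_pi_norm (x - x') p
      simp only [Nat.cast_one, one_mul, pow_one]
      rw [Pi.sub_apply] at this
      nlinarith
    · simp only [Pi.sub_apply, sub_self, norm_zero]
      positivity
  have h2 : ∀ i, ‖x (i, cpos (comp k)) * (x (i, 0) ^ (expo (mono k)).1 *
        x (i, 1) ^ (expo (mono k)).2) - x' (i, cpos (comp k)) * (x' (i, 0) ^ (expo (mono k)).1 *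
        x' (i, 1) ^ (expo (mono k)).2) - ((x - x') (i, cpos (comp k)) *
        (x₀ (i, 0) ^ (expo (mono k)).1 * x₀ (i, 1) ^ (expo (mono k)).2) +
      x₀ (i, cpos (comp k)) *
        ((expo (mono k)).1 * x₀ (i, 0) ^ ((expo (mono k)).1 - 1) * (x - x') (i, 0) *
          x₀ (i, 1) ^ (expo (mono k)).2 +
        x₀ (i, 0) ^ (expo (mono k)).1 *
          ((expo (mono k)).2 * x₀ (i, 1) ^ ((expo (mono k)).2 - 1) * (x - x') (i, 1))))‖ ≤
      36 * B ^ 6 * r * ‖x - x'‖ := by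
    intro i
    have h := ((h1 (i, cpos (comp k))).mul
      (((h1 (i, 0)).pow (expo (mono k)).1).mul
        ((h1 (i, 1)).pow (expo (mono k)).2))).sub_D
    refine h.trans ?_
    have hn : 1 + ((expo (mono k)).1 + (expo (mono k)).2) ≤ 6 := by
      have := expo_le k
      have h5 : ∀ j, (![4, 4, 4, 5] : Fin 4 → ℕ) j ≤ 5 := by decide
      have := h5 (comp k)
      omega
    have hn' : ((1 + ((expo (mono k)).1 + (expo (mono k)).2) : ℕ) : ℝ) ≤ 6 := by exact_mod_cast hn
    have hp : ((1 + ((expo (mono k)).1 + (expo (mono k)).2) : ℕ) : ℝ) ^ 2 ≤ 36 := by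
      have h0 : (0 : ℝ) ≤ ((1 + ((expo (mono k)).1 + (expo (mono k)).2) : ℕ) : ℝ) :=
        Nat.cast_nonneg _
      nlinarith
    gcongr
  simp only [waringMap, waringDeriv]
  rw [← Finset.sum_sub_distrib, ← Finset.sum_sub_distrib]
  refine (norm_sum_le_of_le _ fun i _ => h2 i).trans ?_
  simp

/-- The 66 coordinates sit in the 4 × 21 rectangle of components and monomials; the other places are
the quintic monomials in the quartic components, where `g` vanishes. -/
theorem sum_comp_mono {M : Type*} [AddCommMonoid M] (g : Fin 4 → Fin 21 → M)
    (h : ∀ j m, j ≠ 3 → 15 ≤ m.1 → g j m = 0) :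
    ∑ k, g (comp k) (mono k) = ∑ j, ∑ m, g j m := by
  classical
  rw [← Finset.sum_product', Finset.univ_product_univ]
  have hinj : ∀ k l : Fin 66, comp k = comp l → mono k = mono l → k = l := by decide +kernel
  have hmem : ∀ (j : Fin 4) (m : Fin 21), (j = 3 ∨ m.1 < 15) → ∃ k, comp k = j ∧ mono k = m := by
    decide +kernel
  refine Finset.sum_of_injOn (fun k => (comp k, mono k)) ?_ (by simp) ?_ (fun _ _ => rfl)
  · intro k _ l _ hkl
    exact hinj k l (congrArg Prod.fst hkl) (congrArg Prod.snd hkl)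
  · rintro ⟨j, m⟩ - hjm
    apply h
    · rintro rfl
      obtain ⟨k, h1, h2⟩ := hmem 3 m (Or.inl rfl)
      exact hjm ⟨k, by simp, by simp [h1, h2]⟩
    · by_contra! hlt
      obtain ⟨k, h1, h2⟩ := hmem j m (Or.inr hlt)
      exact hjm ⟨k, by simp, by simp [h1, h2]⟩

/-- Value of the polynomial with coefficients `A`. -/
def polyVal (A : Fin 21 → ℂ) (a b : ℂ) : ℂ := ∑ m, A m * (a ^ (expo m).1 * b ^ (expo m).2)

/-- Derivative in the first variable of the polynomial with coefficients `A`. -/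
def polyDerivA (A : Fin 21 → ℂ) (a b : ℂ) : ℂ :=
  ∑ m, A m * ((expo m).1 * a ^ ((expo m).1 - 1) * b ^ (expo m).2)

/-- Derivative in the second variable of the polynomial with coefficients `A`. -/
def polyDerivB (A : Fin 21 → ℂ) (a b : ℂ) : ℂ :=
  ∑ m, A m * ((expo m).2 * a ^ (expo m).1 * b ^ ((expo m).2 - 1))

/-- This is the duality behind the approximate inverse. A row, read as a vector of polynomials, sees
a variation of `c` through its values at the points and a variation of `a` or `b` through its
derivatives weighted by the `c`. Inverting the differential thus becomes an interpolation problem.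
-/
theorem sum_mul_waringDeriv (A : Fin 4 → Fin 21 → ℂ) (hA : ∀ j m, j ≠ 3 → 15 ≤ m.1 → A j m = 0)
    (x₀ v : Fin 11 × Fin 6 → ℂ) :
    ∑ k, A (comp k) (mono k) * waringDeriv x₀ v k =
      ∑ i, (∑ j, polyVal (A j) (x₀ (i, 0)) (x₀ (i, 1)) * v (i, cpos j) +
        (∑ j, x₀ (i, cpos j) * polyDerivA (A j) (x₀ (i, 0)) (x₀ (i, 1))) * v (i, 0) +
        (∑ j, x₀ (i, cpos j) * polyDerivB (A j) (x₀ (i, 0)) (x₀ (i, 1))) * v (i, 1)) := by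
  simp only [waringDeriv, Finset.mul_sum]
  rw [Finset.sum_comm]
  refine Finset.sum_congr rfl fun i _ => ?_
  rw [sum_comp_mono (fun j m => A j m * (v (i, cpos j) * (x₀ (i, 0) ^ (expo m).1 *
      x₀ (i, 1) ^ (expo m).2) + x₀ (i, cpos j) * ((expo m).1 * x₀ (i, 0) ^ ((expo m).1 - 1) *
      v (i, 0) * x₀ (i, 1) ^ (expo m).2 + x₀ (i, 0) ^ (expo m).1 *
      ((expo m).2 * x₀ (i, 1) ^ ((expo m).2 - 1) * v (i, 1)))))
    (fun j m h1 h2 => by rw [hA j m h1 h2, zero_mul])]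
  rw [Finset.sum_mul, Finset.sum_mul, ← Finset.sum_add_distrib, ← Finset.sum_add_distrib]
  refine Finset.sum_congr rfl fun j _ => ?_
  simp only [polyVal, polyDerivA, polyDerivB, Finset.mul_sum, Finset.sum_mul]
  rw [← Finset.sum_add_distrib, ← Finset.sum_add_distrib]
  refine Finset.sum_congr rfl fun m _ => ?_
  ring

/-- The indicator of `p = q`. -/
def delta (p q : Fin 11 × Fin 6) : ℂ := if p = q then 1 else 0

/-- A certificate for an approximate solution `x₀` of `waringMap x = f₀`, with approximate
inverse `A` of the differential. -/
theorem eventually_exists_waringMap_eq {x₀ : Fin 11 × Fin 6 → ℂ} {f₀ : Fin 66 → ℂ}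
    {A : Fin 11 × Fin 6 → Fin 4 → Fin 21 → ℂ} {r α B : ℝ} (hr : 0 < r) (hB1 : 1 ≤ B)
    (hA : ∀ p j m, j ≠ 3 → 15 ≤ m.1 → A p j m = 0) (hB : ∀ p, ‖x₀ p‖ + r ≤ B)
    (hα : ∀ p, ∑ j, ∑ m, ‖A p j m‖ ≤ α)
    (hdev : ∀ p, ∑ i, (∑ j, ‖polyVal (A p j) (x₀ (i, 0)) (x₀ (i, 1)) - delta p (i, cpos j)‖ +
      ‖∑ j, x₀ (i, cpos j) * polyDerivA (A p j) (x₀ (i, 0)) (x₀ (i, 1)) - delta p (i, 0)‖ +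
      ‖∑ j, x₀ (i, cpos j) * polyDerivB (A p j) (x₀ (i, 0)) (x₀ (i, 1)) - delta p (i, 1)‖) ≤ 1 / 4)
    (hres : ∀ p, ‖∑ k, A p (comp k) (mono k) * (waringMap x₀ k - f₀ k)‖ ≤ r / 4)
    (hsmall : α * (11 * (36 * B ^ 6 * r)) ≤ 1 / 4) :
    ∀ᶠ y in 𝓝 f₀, ∃ x ∈ closedBall x₀ r, ∀ k, waringMap x k = y k := by
  have key := eventually_exists_eq_of_approx (by simp) (waringMap (R := ℂ))
    (Matrix.of fun p k => A p (comp k) (mono k)) x₀ f₀ hr ?_ ?_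
  · filter_upwards [key] with y ⟨x, hx, hxy⟩
    exact ⟨x, hx, fun k => congrFun hxy k⟩
  · intro x hx x' hx'
    refine (pi_norm_le_iff_of_nonneg (by positivity)).2 fun p => ?_
    set v := x - x' with hv
    have hv0 : 0 ≤ ‖v‖ := norm_nonneg v
    have hsplit : v p = ∑ i, (∑ j, delta p (i, cpos j) * v (i, cpos j) +
        delta p (i, 0) * v (i, 0) + delta p (i, 1) * v (i, 1)) := by
      have h1 : ∀ i, ∑ j, delta p (i, cpos j) * v (i, cpos j) + delta p (i, 0) * v (i, 0) +
          delta p (i, 1) * v (i, 1) = ∑ s, delta p (i, s) * v (i, s) := by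
        intro i
        rw [Fin.sum_univ_six, Fin.sum_univ_four]
        simp only [cpos]
        change (delta p (i, 2) * v (i, 2) + delta p (i, 3) * v (i, 3) + delta p (i, 4) * v (i, 4)
          + delta p (i, 5) * v (i, 5)) + _ + _ = _
        ring
      simp only [h1]
      rw [← Finset.sum_product', Finset.univ_product_univ]
      simp [delta]
    -- The deviation from the identity splits into a linear part, the matrix times the differential
    -- minus the identity, and the remainder of the linearization. Each contributes at most 1/4.
    have e1 : (Matrix.of fun p k => A p (comp k) (mono k)).mulVec
        (waringMap x - waringMap x') p - v p =
        (∑ k, A p (comp k) (mono k) * waringDeriv x₀ v k - v p) +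
        ∑ k, A p (comp k) (mono k) * (waringMap x k - waringMap x' k - waringDeriv x₀ v k) := by
      simp only [Matrix.mulVec, dotProduct, Matrix.of_apply, Pi.sub_apply]
      simp only [mul_sub, Finset.sum_sub_distrib]
      ring
    rw [Pi.sub_apply, e1]
    have e2 : ‖∑ k, A p (comp k) (mono k) * waringDeriv x₀ v k - v p‖ ≤ 1 / 4 * ‖v‖ := by
      rw [sum_mul_waringDeriv _ (hA p), hsplit, ← Finset.sum_sub_distrib]
      refine (norm_sum_le _ _).trans (le_trans ?_ (mul_le_mul_of_nonneg_right (hdev p) hv0))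
      rw [Finset.sum_mul]
      refine Finset.sum_le_sum fun i _ => ?_
      have e3 : ∀ (a b c a' b' c' : ℂ), a + b + c - (a' + b' + c') = (a - a') + (b - b') + (c - c') :=
        fun _ _ _ _ _ _ => by ring
      rw [e3, ← Finset.sum_sub_distrib, add_mul, add_mul]
      refine (norm_add₃_le).trans (add_le_add (add_le_add ((norm_sum_le _ _).trans
        ((Finset.sum_le_sum fun j _ => ?_).trans_eq (Finset.sum_mul ..).symm)) ?_) ?_) <;>
      · rw [← sub_mul, norm_mul]
        exact mul_le_mul_of_nonneg_left (norm_le_pi_norm v _) (norm_nonneg _)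
    have e4 : ‖∑ k, A p (comp k) (mono k) *
        (waringMap x k - waringMap x' k - waringDeriv x₀ v k)‖ ≤ 1 / 4 * ‖v‖ := by
      have hb := fun k => norm_waringMap_sub_sub_le hB1 hr.le hB hx hx' k
      calc _ ≤ ∑ k, ‖A p (comp k) (mono k)‖ * (11 * (36 * B ^ 6 * r * ‖v‖)) := by
            refine norm_sum_le_of_le _ fun k _ => ?_
            rw [norm_mul]
            exact mul_le_mul_of_nonneg_left (hb k) (norm_nonneg _)
        _ = (∑ j, ∑ m, ‖A p j m‖) * (11 * (36 * B ^ 6 * r * ‖v‖)) := by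
            rw [← Finset.sum_mul, sum_comp_mono (fun j m => ‖A p j m‖)
              (fun j m h1 h2 => by rw [hA p j m h1 h2, norm_zero])]
        _ ≤ α * (11 * (36 * B ^ 6 * r * ‖v‖)) :=
            mul_le_mul_of_nonneg_right (hα p) (by positivity)
        _ = α * (11 * (36 * B ^ 6 * r)) * ‖v‖ := by ring
        _ ≤ 1 / 4 * ‖v‖ := mul_le_mul_of_nonneg_right hsmall hv0
    calc _ ≤ 1 / 4 * ‖v‖ + 1 / 4 * ‖v‖ := (norm_add_le _ _).trans (add_le_add e2 e4)
      _ = 1 / 2 * ‖v‖ := by ring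
  · refine (pi_norm_le_iff_of_nonneg (by positivity)).2 fun p => ?_
    simpa [Matrix.mulVec, dotProduct] using hres p

end SimWaring

/-! ### The approximate inverse from quartics dual to the points and vanishing there -/

namespace SimWaring

open Filter Topology Metric

/-- Coefficients of the product of a quartic by the first variable. -/
def shiftA (f : Fin 21 → ℂ) : Fin 21 → ℂ :=
  ![0, f 0, 0, f 1, f 2, 0, f 3, f 4, f 5, 0, f 6, f 7, f 8, f 9, 0, f 10, f 11, f 12, f 13, f 14, 0]

/-- Coefficients of the product of a quartic by the second variable. -/
def shiftB (f : Fin 21 → ℂ) : Fin 21 → ℂ :=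
  ![0, 0, f 0, 0, f 1, f 2, 0, f 3, f 4, f 5, 0, f 6, f 7, f 8, f 9, 0, f 10, f 11, f 12, f 13, f 14]

/-- The six ways to use a quartic as a component of a vector of polynomials: in one of the
components `0, 1, 2, 3`, or multiplied by a variable in the component `3`. -/
def shift (e : Fin 6) (f : Fin 21 → ℂ) : Fin 21 → ℂ :=
  if e = 4 then shiftA f else if e = 5 then shiftB f else f

/-- The component in which `shift e` is used. -/
def block (e : Fin 6) : Fin 4 := ![0, 1, 2, 3, 3, 3] e

theorem sum_fin21 {M : Type*} [AddCommMonoid M] (f : Fin 21 → M) :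
    ∑ i, f i = f 0 + f 1 + f 2 + f 3 + f 4 + f 5 + f 6 + f 7 + f 8 + f 9 + f 10 + f 11 + f 12 +
      f 13 + f 14 + f 15 + f 16 + f 17 + f 18 + f 19 + f 20 := by
  simp only [Fin.sum_univ_castSucc]
  simp

/-- The coefficients of a polynomial of degree at most `4`. -/
def IsQuartic (f : Fin 21 → ℂ) : Prop := ∀ m : Fin 21, 15 ≤ m.1 → f m = 0

theorem polyVal_shiftA {f : Fin 21 → ℂ} (hf : IsQuartic f) (a b : ℂ) :
    polyVal (shiftA f) a b = a * polyVal f a b := by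
  simp only [polyVal, sum_fin21, hf 15 (by decide), hf 16 (by decide), hf 17 (by decide),
    hf 18 (by decide), hf 19 (by decide), hf 20 (by decide)]
  simp [shiftA, expo, exponents]
  ring

theorem polyDerivA_shiftA {f : Fin 21 → ℂ} (hf : IsQuartic f) (a b : ℂ) :
    polyDerivA (shiftA f) a b = polyVal f a b + a * polyDerivA f a b := by
  simp only [polyVal, polyDerivA, sum_fin21, hf 15 (by decide), hf 16 (by decide), hf 17 (by decide),
    hf 18 (by decide), hf 19 (by decide), hf 20 (by decide)]
  simp [shiftA, expo, exponents]
  ring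

theorem polyDerivB_shiftA {f : Fin 21 → ℂ} (hf : IsQuartic f) (a b : ℂ) :
    polyDerivB (shiftA f) a b = a * polyDerivB f a b := by
  simp only [polyDerivB, sum_fin21, hf 15 (by decide), hf 16 (by decide), hf 17 (by decide),
    hf 18 (by decide), hf 19 (by decide), hf 20 (by decide)]
  simp [shiftA, expo, exponents]
  ring

theorem polyVal_shiftB {f : Fin 21 → ℂ} (hf : IsQuartic f) (a b : ℂ) :
    polyVal (shiftB f) a b = b * polyVal f a b := by
  simp only [polyVal, sum_fin21, hf 15 (by decide), hf 16 (by decide), hf 17 (by decide),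
    hf 18 (by decide), hf 19 (by decide), hf 20 (by decide)]
  simp [shiftB, expo, exponents]
  ring

theorem polyDerivA_shiftB {f : Fin 21 → ℂ} (hf : IsQuartic f) (a b : ℂ) :
    polyDerivA (shiftB f) a b = b * polyDerivA f a b := by
  simp only [polyDerivA, sum_fin21, hf 15 (by decide), hf 16 (by decide), hf 17 (by decide),
    hf 18 (by decide), hf 19 (by decide), hf 20 (by decide)]
  simp [shiftB, expo, exponents]
  ring

theorem polyDerivB_shiftB {f : Fin 21 → ℂ} (hf : IsQuartic f) (a b : ℂ) :
    polyDerivB (shiftB f) a b = polyVal f a b + b * polyDerivB f a b := by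
  simp only [polyVal, polyDerivB, sum_fin21, hf 15 (by decide), hf 16 (by decide), hf 17 (by decide),
    hf 18 (by decide), hf 19 (by decide), hf 20 (by decide)]
  simp [shiftB, expo, exponents]
  ring

theorem sum_norm_shift {f : Fin 21 → ℂ} (hf : IsQuartic f) (e : Fin 6) :
    ∑ m, ‖shift e f m‖ = ∑ m, ‖f m‖ := by
  unfold shift
  split_ifs
  · simp only [sum_fin21, hf 15 (by decide), hf 16 (by decide), hf 17 (by decide),
      hf 18 (by decide), hf 19 (by decide), hf 20 (by decide)]
    simp [shiftA]
  · simp only [sum_fin21, hf 15 (by decide), hf 16 (by decide), hf 17 (by decide),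
      hf 18 (by decide), hf 19 (by decide), hf 20 (by decide)]
    simp [shiftB]
  · rfl

theorem sum_norm_le_of_isQuartic {f : Fin 21 → ℂ} (hf : IsQuartic f) {b : ℝ}
    (hb : ∀ m, ‖f m‖ ≤ b) : ∑ m, ‖f m‖ ≤ 15 * b := by
  simp only [sum_fin21, hf 15 (by decide), hf 16 (by decide), hf 17 (by decide),
    hf 18 (by decide), hf 19 (by decide), hf 20 (by decide), norm_zero]
  linarith [hb 0, hb 1, hb 2, hb 3, hb 4, hb 5, hb 6, hb 7, hb 8, hb 9, hb 10, hb 11, hb 12,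
    hb 13, hb 14]

/-- The vector of polynomials `∑ u, c u * shift (e u) (q u)`. -/
def combination (c : Fin 22 → ℂ) (e : Fin 22 → Fin 6) (q : Fin 22 → Fin 21 → ℂ) (j : Fin 4)
    (m : Fin 21) : ℂ :=
  ∑ u, c u * if block (e u) = j then shift (e u) (q u) m else 0

section combination

variable (c : Fin 22 → ℂ) (e : Fin 22 → Fin 6) (q : Fin 22 → Fin 21 → ℂ)

/-- Multiplication by a variable raises the degree to five, but it occurs only in the component 3;
the other blocks receive unshifted quartics. -/
theorem combination_eq_zero (hq : ∀ u, IsQuartic (q u)) (j : Fin 4) (m : Fin 21) (hj : j ≠ 3)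
    (hm : 15 ≤ m.1) : combination c e q j m = 0 := by
  refine Finset.sum_eq_zero fun u _ => ?_
  split_ifs with h
  · have : ∀ e : Fin 6, block e ≠ 3 → e ≠ 4 ∧ e ≠ 5 := by decide
    obtain ⟨h4, h5⟩ := this (e u) (h ▸ hj)
    rw [shift, if_neg h4, if_neg h5, hq u m hm, mul_zero]
  · rw [mul_zero]

theorem sum_mul_combination (g : Fin 21 → ℂ) (j : Fin 4) :
    ∑ m, combination c e q j m * g m =
      ∑ u, c u * if block (e u) = j then ∑ m, shift (e u) (q u) m * g m else 0 := by
  simp only [combination, Finset.sum_mul]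
  rw [Finset.sum_comm]
  refine Finset.sum_congr rfl fun u _ => ?_
  split_ifs
  · rw [Finset.mul_sum]
    exact Finset.sum_congr rfl fun m _ => by ring
  · simp

theorem sum_ite_block (g : Fin 22 → ℂ) (y : Fin 4 → ℂ) :
    ∑ j, y j * ∑ u, c u * (if block (e u) = j then g u else 0) =
      ∑ u, c u * (y (block (e u)) * g u) := by
  simp only [Finset.mul_sum]
  rw [Finset.sum_comm]
  refine Finset.sum_congr rfl fun u _ => ?_
  rw [Finset.sum_eq_single (block (e u))]
  · rw [if_pos rfl]; ring
  · intro j _ hj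
    rw [if_neg hj.symm]; simp
  · simp

/-- Every index `u` contributes to a single component, so the sum over `j` costs no factor 4. -/
theorem sum_norm_ite_block_le (g : Fin 22 → ℂ) {κ γ : ℝ} (hκ : ∀ u, ‖c u‖ ≤ κ)
    (hγ : ∀ u, ‖g u‖ ≤ γ) :
    ∑ j, ‖∑ u, c u * (if block (e u) = j then g u else 0)‖ ≤ 22 * (κ * γ) := by
  calc _ ≤ ∑ j, ∑ u, ‖c u‖ * (if block (e u) = j then ‖g u‖ else 0) := by
        refine Finset.sum_le_sum fun j _ => norm_sum_le_of_le _ fun u _ => ?_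
        rw [norm_mul]
        split_ifs <;> simp
    _ = ∑ u, ‖c u‖ * ‖g u‖ := by
        rw [Finset.sum_comm]
        refine Finset.sum_congr rfl fun u _ => ?_
        rw [← Finset.mul_sum]
        simp
    _ ≤ ∑ u : Fin 22, κ * γ := Finset.sum_le_sum fun u _ =>
        mul_le_mul (hκ u) (hγ u) (norm_nonneg _) ((norm_nonneg _).trans (hκ u))
    _ = 22 * (κ * γ) := by simp

theorem sum_norm_combination_le {κ γ : ℝ} (hκ : ∀ u, ‖c u‖ ≤ κ)
    (hγ : ∀ u, ∑ m, ‖shift (e u) (q u) m‖ ≤ γ) :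
    ∑ j, ∑ m, ‖combination c e q j m‖ ≤ 22 * (κ * γ) := by
  calc _ ≤ ∑ j, ∑ m, ∑ u, ‖c u‖ * (if block (e u) = j then ‖shift (e u) (q u) m‖ else 0) := by
        refine Finset.sum_le_sum fun j _ => Finset.sum_le_sum fun m _ =>
          norm_sum_le_of_le _ fun u _ => ?_
        rw [norm_mul]
        split_ifs <;> simp
    _ = ∑ u, ‖c u‖ * ∑ m, ‖shift (e u) (q u) m‖ := by
        simp only [Finset.mul_sum]
        rw [Finset.sum_comm]
        simp_rw [Finset.sum_comm (s := (Finset.univ : Finset (Fin 4)))]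
        rw [Finset.sum_comm]
        refine Finset.sum_congr rfl fun u _ => Finset.sum_congr rfl fun m _ => ?_
        rw [← Finset.mul_sum]
        simp
    _ ≤ ∑ u : Fin 22, κ * γ := Finset.sum_le_sum fun u _ =>
        mul_le_mul (hκ u) (hγ u) (Finset.sum_nonneg fun _ _ => norm_nonneg _)
          ((norm_nonneg _).trans (hκ u))
    _ = 22 * (κ * γ) := by simp

end combination

/-- Approximate left inverse of the differential of `waringMap`: the parameters `c` are read off
by the quartics `l`, which are dual to the points, and the parameters `a`, `b` by combinations
of the quartics `q`, which vanish at the points. -/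
def approxInverse (l : Fin 11 → Fin 21 → ℂ) (C : Fin 11 → Fin 2 → Fin 22 → ℂ)
    (e : Fin 22 → Fin 6) (q : Fin 22 → Fin 21 → ℂ) (p : Fin 11 × Fin 6) (j : Fin 4)
    (m : Fin 21) : ℂ :=
  if p.2 = 0 then combination (C p.1 0) e q j m
  else if p.2 = 1 then combination (C p.1 1) e q j m
  else if p.2 = cpos j then l p.1 m else 0

theorem cpos_cases (z : Fin 6) : z = 0 ∨ z = 1 ∨ ∃ j, z = cpos j := by revert z; decide

theorem approxInverse_zero (l C e q i j) :
    approxInverse l C e q (i, 0) j = combination (C i 0) e q j := rfl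

theorem approxInverse_one (l C e q i j) :
    approxInverse l C e q (i, 1) j = combination (C i 1) e q j := rfl

theorem cpos_ne (j : Fin 4) : cpos j ≠ 0 ∧ cpos j ≠ 1 := by revert j; decide

theorem cpos_injective : Function.Injective cpos := by decide

theorem approxInverse_cpos (l C e q i j j') :
    approxInverse l C e q (i, cpos j) j' = if j = j' then l i else 0 := by
  funext m
  simp only [approxInverse, (cpos_ne j).1, (cpos_ne j).2, if_false, cpos_injective.eq_iff]
  split_ifs <;> rfl

theorem polyVal_zero (a b : ℂ) : polyVal 0 a b = 0 := by simp [polyVal]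
theorem polyDerivA_zero (a b : ℂ) : polyDerivA 0 a b = 0 := by simp [polyDerivA]
theorem polyDerivB_zero (a b : ℂ) : polyDerivB 0 a b = 0 := by simp [polyDerivB]

theorem delta_cpos (i k : Fin 11) (j j' : Fin 4) :
    delta (i, cpos j) (k, cpos j') = if j = j' then (if i = k then 1 else 0) else 0 := by
  simp only [delta, Prod.mk.injEq, cpos_injective.eq_iff]
  split_ifs <;> simp_all

theorem delta_cpos_zero (i k : Fin 11) (j : Fin 4) : delta (i, cpos j) (k, 0) = 0 := by
  simp [delta, (cpos_ne j).1]

theorem delta_cpos_one (i k : Fin 11) (j : Fin 4) : delta (i, cpos j) (k, 1) = 0 := by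
  simp [delta, (cpos_ne j).2]

/-- Numerical conditions that guarantee solutions of `waringMap x = y` near `x₀` for `y`
near `f₀`. -/
structure IsCertificate (x₀ : Fin 11 × Fin 6 → ℂ) (f₀ : Fin 66 → ℂ) (l : Fin 11 → Fin 21 → ℂ)
    (C : Fin 11 → Fin 2 → Fin 22 → ℂ) (e : Fin 22 → Fin 6) (q : Fin 22 → Fin 21 → ℂ) : Prop where
  isQuartic_l : ∀ i, IsQuartic (l i)
  isQuartic_q : ∀ u, IsQuartic (q u)
  norm_x : ∀ p, ‖x₀ p‖ ≤ 11 / 2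
  norm_c : ∀ i j, ‖x₀ (i, cpos j)‖ ≤ 2 / 10 ^ 4
  norm_l : ∀ i m, ‖l i m‖ ≤ 4
  norm_q : ∀ u m, ‖q u m‖ ≤ 1
  norm_C : ∀ i z u, ‖C i z u‖ ≤ 2 * 10 ^ 6
  val_l : ∀ i k, ‖polyVal (l i) (x₀ (k, 0)) (x₀ (k, 1)) - if i = k then 1 else 0‖ ≤ 1 / 10 ^ 3
  derivA_l : ∀ i k, ‖polyDerivA (l i) (x₀ (k, 0)) (x₀ (k, 1))‖ ≤ 40
  derivB_l : ∀ i k, ‖polyDerivB (l i) (x₀ (k, 0)) (x₀ (k, 1))‖ ≤ 40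
  val_q : ∀ u k, ‖polyVal (q u) (x₀ (k, 0)) (x₀ (k, 1))‖ ≤ 1 / 10 ^ 11
  derivA_q : ∀ i z k, ‖∑ u, C i z u * (x₀ (k, cpos (block (e u))) *
    polyDerivA (shift (e u) (q u)) (x₀ (k, 0)) (x₀ (k, 1))) -
      if i = k ∧ z = 0 then 1 else 0‖ ≤ 1 / 200
  derivB_q : ∀ i z k, ‖∑ u, C i z u * (x₀ (k, cpos (block (e u))) *
    polyDerivB (shift (e u) (q u)) (x₀ (k, 0)) (x₀ (k, 1))) -
      if i = k ∧ z = 1 then 1 else 0‖ ≤ 1 / 200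
  residual : ∀ k, ‖waringMap x₀ k - f₀ k‖ ≤ 1 / 10 ^ 27

namespace IsCertificate

variable {x₀ : Fin 11 × Fin 6 → ℂ} {f₀ : Fin 66 → ℂ} {l : Fin 11 → Fin 21 → ℂ}
  {C : Fin 11 → Fin 2 → Fin 22 → ℂ} {e : Fin 22 → Fin 6} {q : Fin 22 → Fin 21 → ℂ}

theorem approxInverse_eq_zero (h : IsCertificate x₀ f₀ l C e q) (p : Fin 11 × Fin 6) (j : Fin 4)
    (m : Fin 21) (hj : j ≠ 3) (hm : 15 ≤ m.1) : approxInverse l C e q p j m = 0 := by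
  obtain ⟨i, z⟩ := p
  rcases cpos_cases z with rfl | rfl | ⟨j', rfl⟩
  · exact combination_eq_zero _ _ _ h.isQuartic_q j m hj hm
  · exact combination_eq_zero _ _ _ h.isQuartic_q j m hj hm
  · rw [approxInverse_cpos]
    split_ifs
    · exact h.isQuartic_l i m hm
    · rfl

theorem sum_norm_combination (h : IsCertificate x₀ f₀ l C e q) (i : Fin 11) (z : Fin 2) :
    ∑ j, ∑ m, ‖combination (C i z) e q j m‖ ≤ 7 * 10 ^ 8 := by
  refine (sum_norm_combination_le _ _ _ (h.norm_C i z) (γ := 15 * 1) fun u => ?_).trans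
    (by norm_num)
  rw [sum_norm_shift (h.isQuartic_q u)]
  exact sum_norm_le_of_isQuartic (h.isQuartic_q u) (h.norm_q u)

theorem sum_norm_approxInverse (h : IsCertificate x₀ f₀ l C e q) (p : Fin 11 × Fin 6) :
    ∑ j, ∑ m, ‖approxInverse l C e q p j m‖ ≤ 7 * 10 ^ 8 := by
  obtain ⟨i, z⟩ := p
  rcases cpos_cases z with rfl | rfl | ⟨j', rfl⟩
  · exact h.sum_norm_combination i 0
  · exact h.sum_norm_combination i 1
  · have : ∀ j, ∑ m, ‖approxInverse l C e q (i, cpos j') j m‖ =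
        if j' = j then ∑ m, ‖l i m‖ else 0 := by
      intro j
      rw [approxInverse_cpos]
      split_ifs <;> simp
    simp only [this, Finset.sum_ite_eq, Finset.mem_univ, if_true]
    exact (sum_norm_le_of_isQuartic (h.isQuartic_l i) (h.norm_l i)).trans (by norm_num)

/-- The quartic is at most 10 ^ (-11) at the points, and a variable multiplies this by at most 11/2.
-/
theorem norm_polyVal_shift (h : IsCertificate x₀ f₀ l C e q) (u : Fin 22) (k : Fin 11) :
    ‖polyVal (shift (e u) (q u)) (x₀ (k, 0)) (x₀ (k, 1))‖ ≤ 6 / 10 ^ 11 := by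
  have hv := h.val_q u k
  have h0 := h.norm_x (k, 0)
  have h1 := h.norm_x (k, 1)
  have hn := norm_nonneg (polyVal (q u) (x₀ (k, 0)) (x₀ (k, 1)))
  unfold shift
  split_ifs
  · rw [polyVal_shiftA (h.isQuartic_q u), norm_mul]
    nlinarith
  · rw [polyVal_shiftB (h.isQuartic_q u), norm_mul]
    nlinarith
  · linarith

/-- The rows for `a` and `b` are combinations of polynomials nearly vanishing at the points, so they
hardly see the `c`; on `a` and `b` they are the product of `C` with the matrix of derivatives, which
is nearly the identity. The bound 1/44 is one eleventh of the 1/4 allowed for a row. -/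
theorem deviation_combination (h : IsCertificate x₀ f₀ l C e q) (i : Fin 11) (z : Fin 2)
    (k : Fin 11) :
    ∑ j, ‖polyVal (combination (C i z) e q j) (x₀ (k, 0)) (x₀ (k, 1))‖ +
      ‖∑ j, x₀ (k, cpos j) * polyDerivA (combination (C i z) e q j) (x₀ (k, 0)) (x₀ (k, 1)) -
        if i = k ∧ z = 0 then 1 else 0‖ +
      ‖∑ j, x₀ (k, cpos j) * polyDerivB (combination (C i z) e q j) (x₀ (k, 0)) (x₀ (k, 1)) -
        if i = k ∧ z = 1 then 1 else 0‖ ≤ 1 / 44 := by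
  have e1 : ∑ j, ‖polyVal (combination (C i z) e q j) (x₀ (k, 0)) (x₀ (k, 1))‖ ≤
      22 * (2 * 10 ^ 6 * (6 / 10 ^ 11)) := by
    simp only [polyVal, sum_mul_combination]
    exact sum_norm_ite_block_le _ _ _ (h.norm_C i z) fun u => h.norm_polyVal_shift u k
  have e2 := h.derivA_q i z k
  have e3 := h.derivB_q i z k
  have e4 : ∑ j, x₀ (k, cpos j) *
      polyDerivA (combination (C i z) e q j) (x₀ (k, 0)) (x₀ (k, 1)) =
      ∑ u, C i z u * (x₀ (k, cpos (block (e u))) *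
        polyDerivA (shift (e u) (q u)) (x₀ (k, 0)) (x₀ (k, 1))) := by
    simp only [polyDerivA, sum_mul_combination]
    exact sum_ite_block _ _ _ fun j => x₀ (k, cpos j)
  have e5 : ∑ j, x₀ (k, cpos j) *
      polyDerivB (combination (C i z) e q j) (x₀ (k, 0)) (x₀ (k, 1)) =
      ∑ u, C i z u * (x₀ (k, cpos (block (e u))) *
        polyDerivB (shift (e u) (q u)) (x₀ (k, 0)) (x₀ (k, 1))) := by
    simp only [polyDerivB, sum_mul_combination]
    exact sum_ite_block _ _ _ fun j => x₀ (k, cpos j)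
  rw [e4, e5]
  -- 22 · 2·10^6 · 6/10^11 is below 3/1000, and the derivatives add 2/200.
  refine (add_le_add (add_le_add e1 e2) e3).trans (by norm_num)

/-- For the rows that recover the `c`, the dual quartics give nearly the identity on the `c`, but
their derivatives at the points are only bounded by 40. These derivatives enter multiplied by the
`c`, which are at most 2/10^4, so no correction of the dual quartics is needed: 1/10^3 + 2 · 40 ·
2/10^4 is below 1/44. Scaling a vector scales its `c`, and the special vector is taken small for
this purpose. -/
theorem deviation (h : IsCertificate x₀ f₀ l C e q) (p : Fin 11 × Fin 6) (k : Fin 11) :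
    ∑ j, ‖polyVal (approxInverse l C e q p j) (x₀ (k, 0)) (x₀ (k, 1)) - delta p (k, cpos j)‖ +
      ‖∑ j, x₀ (k, cpos j) * polyDerivA (approxInverse l C e q p j) (x₀ (k, 0)) (x₀ (k, 1)) -
        delta p (k, 0)‖ +
      ‖∑ j, x₀ (k, cpos j) * polyDerivB (approxInverse l C e q p j) (x₀ (k, 0)) (x₀ (k, 1)) -
        delta p (k, 1)‖ ≤ 1 / 44 := by
  obtain ⟨i, z⟩ := p
  rcases cpos_cases z with rfl | rfl | ⟨j', rfl⟩
  · convert h.deviation_combination i 0 k using 2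
    · congr 1
      · refine Finset.sum_congr rfl fun j _ => ?_
        rw [delta, if_neg (by simpa using fun _ => (cpos_ne j).1.symm), sub_zero,
          approxInverse_zero]
      · simp [delta, approxInverse_zero]
    · simp [delta, approxInverse_zero]
  · convert h.deviation_combination i 1 k using 2
    · congr 1
      · refine Finset.sum_congr rfl fun j _ => ?_
        rw [delta, if_neg (by simpa using fun _ => (cpos_ne j).2.symm), sub_zero,
          approxInverse_one]
      · simp [delta, approxInverse_one]
    · simp [delta, approxInverse_one]
  · have hsum : ∀ j, ‖polyVal (approxInverse l C e q (i, cpos j') j) (x₀ (k, 0)) (x₀ (k, 1)) -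
        delta (i, cpos j') (k, cpos j)‖ =
        if j' = j then ‖polyVal (l i) (x₀ (k, 0)) (x₀ (k, 1)) - if i = k then 1 else 0‖ else 0 := by
      intro j
      rw [approxInverse_cpos, delta_cpos]
      split_ifs <;> simp [polyVal_zero]
    have hA : ∀ j, x₀ (k, cpos j) *
        polyDerivA (approxInverse l C e q (i, cpos j') j) (x₀ (k, 0)) (x₀ (k, 1)) =
        if j' = j then x₀ (k, cpos j) * polyDerivA (l i) (x₀ (k, 0)) (x₀ (k, 1)) else 0 := by
      intro j
      rw [approxInverse_cpos]
      split_ifs <;> simp [polyDerivA_zero]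
    have hB : ∀ j, x₀ (k, cpos j) *
        polyDerivB (approxInverse l C e q (i, cpos j') j) (x₀ (k, 0)) (x₀ (k, 1)) =
        if j' = j then x₀ (k, cpos j) * polyDerivB (l i) (x₀ (k, 0)) (x₀ (k, 1)) else 0 := by
      intro j
      rw [approxInverse_cpos]
      split_ifs <;> simp [polyDerivB_zero]
    simp only [hsum, hA, hB, Finset.sum_ite_eq, Finset.mem_univ, if_true, delta_cpos_zero,
      delta_cpos_one, sub_zero, norm_mul]
    have h1 := h.val_l i k
    have h2 := h.derivA_l i k
    have h3 := h.derivB_l i k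
    have h4 := h.norm_c k j'
    have h5 := norm_nonneg (x₀ (k, cpos j'))
    have h6 := mul_le_mul h4 h2 (norm_nonneg _) (by norm_num)
    have h7 := mul_le_mul h4 h3 (norm_nonneg _) (by norm_num)
    linarith

/-- The radius 10^(-17) lies between two constraints. It must be small for the remainder: 7·10^8 ·
11 · 36 · 6^6 · 10^(-17) ≤ 1/4. It must be large for the residual: 7·10^8 · 10^(-27) ≤ 10^(-17)/4.
The bound `B = 6` leaves room above 11/2. -/
theorem eventually_exists (h : IsCertificate x₀ f₀ l C e q) :
    ∀ᶠ y in 𝓝 f₀, ∃ x ∈ closedBall x₀ (1 / 10 ^ 17), ∀ k, waringMap x k = y k := by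
  refine eventually_exists_waringMap_eq (A := approxInverse l C e q) (α := 7 * 10 ^ 8) (B := 6)
    (by norm_num) (by norm_num) h.approxInverse_eq_zero
    (fun p => (add_le_add_left (h.norm_x p) _).trans (by norm_num)) h.sum_norm_approxInverse
    (fun p => (Finset.sum_le_sum fun k _ => h.deviation p k).trans (by simp; norm_num))
    (fun p => ?_) (by norm_num)
  calc _ ≤ ∑ k, ‖approxInverse l C e q p (comp k) (mono k)‖ * (1 / 10 ^ 27) := by
        refine norm_sum_le_of_le _ fun k _ => ?_
        rw [norm_mul]
        exact mul_le_mul_of_nonneg_left (h.residual k) (norm_nonneg _)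
    _ = (∑ j, ∑ m, ‖approxInverse l C e q p j m‖) * (1 / 10 ^ 27) := by
        rw [← Finset.sum_mul, sum_comp_mono (fun j m => ‖approxInverse l C e q p j m‖)
          (fun j m h1 h2 => by rw [h.approxInverse_eq_zero p j m h1 h2, norm_zero])]
    _ ≤ 7 * 10 ^ 8 * (1 / 10 ^ 27) :=
        mul_le_mul_of_nonneg_right (h.sum_norm_approxInverse p) (by norm_num)
    _ ≤ 1 / 10 ^ 17 / 4 := by norm_num

end IsCertificate

end SimWaring

namespace SimWaring

open Filter Topology Metric

/-! ### Arithmetic adapted to evaluation by the kernel -/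

/-- Evaluate `n`, then continue with `k`. -/
noncomputable def forceNat {β : Type} (n : ℕ) (k : ℕ → β) : β :=
  -- Both branches are `k n`. Recursion on `n` forces its reduction to a literal before `k` can copy
  -- it unevaluated.
  Nat.rec (k 0) (fun m _ => k (Nat.succ m)) n

theorem forceNat_eq {β : Type} (n : ℕ) (k : ℕ → β) : forceNat n k = k n := by
  cases n <;> rfl

/-- Evaluate `z`, then continue with `k`. -/
noncomputable def forceInt {β : Type} (z : ℤ) (k : ℤ → β) : β :=
  Int.rec (fun n => forceNat n fun n => k (Int.ofNat n))
    (fun n => forceNat n fun n => k (Int.negSucc n)) z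

theorem forceInt_eq {β : Type} (z : ℤ) (k : ℤ → β) : forceInt z k = k z := by
  cases z <;> simp only [forceInt, forceNat_eq]

/-- Evaluate `z`, then continue with `k`. -/
noncomputable def forceGauss {β : Type} (z : ℤ × ℤ) (k : ℤ × ℤ → β) : β :=
  forceInt z.1 fun a => forceInt z.2 fun b => k (a, b)

theorem forceGauss_eq {β : Type} (z : ℤ × ℤ) (k : ℤ × ℤ → β) : forceGauss z k = k z := by
  simp only [forceGauss, forceInt_eq]

/-- Evaluate the entries of `l` by means of `f`, then continue with `k`. -/
noncomputable def forceList {α β : Type} (f : α → (α → β) → β) (l : List α) : (List α → β) → β :=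
  List.rec (fun k => k []) (fun x _ ih k => f x fun y => ih fun l => k (y :: l)) l

theorem forceList_eq {α β : Type} {f : α → (α → β) → β} (hf : ∀ x k, f x k = k x) (l : List α)
    (k : List α → β) : forceList f l k = k l := by
  induction l generalizing k with
  | nil => rfl
  | cons x l ih =>
    change f x _ = _
    rw [hf]
    exact ih _

/-- Evaluate the entries of a matrix, then continue with `k`. -/
noncomputable def forceMatrix (M : List (List (ℤ × ℤ))) (k : List (List (ℤ × ℤ)) → Bool) : Bool :=
  forceList (forceList forceGauss) M k

theorem forceMatrix_eq (M : List (List (ℤ × ℤ))) (k : List (List (ℤ × ℤ)) → Bool) :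
    forceMatrix M k = k M :=
  forceList_eq (forceList_eq forceGauss_eq) M k

/-- The `i`-th entry of a list, with default value `d`. -/
noncomputable def nth {α : Type} (d : α) (l : List α) : ℕ → α :=
  List.rec (fun _ => d) (fun x _ ih i => Nat.rec x (fun j _ => ih j) i) l

theorem nth_eq_getD {α : Type} (d : α) (l : List α) (i : ℕ) : nth d l i = l.getD i d := by
  induction l generalizing i with
  | nil => simp [nth]
  | cons x l ih =>
    cases i with
    | zero => simp [nth]
    | succ i =>
      rw [List.getD_cons_succ]
      exact ih i

/-- The entry `(i, j)` of a matrix. -/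
noncomputable def ent (M : List (List (ℤ × ℤ))) (i j : ℕ) : ℤ × ℤ := nth (0, 0) (nth [] M i) j

/-- The list of the values of `f` at `i, …, i + n - 1`. -/
noncomputable def tabFrom {α : Type} (f : ℕ → α) (n : ℕ) : ℕ → List α :=
  Nat.rec (fun _ => []) (fun _ ih i => f i :: ih (Nat.succ i)) n

/-- The list of the values of `f` at `0, …, n - 1`. -/
noncomputable def tab {α : Type} (f : ℕ → α) (n : ℕ) : List α := tabFrom f n 0

theorem tabFrom_succ {α : Type} (f : ℕ → α) (n i : ℕ) :
    tabFrom f (n + 1) i = f i :: tabFrom f n (i + 1) := rfl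

theorem nth_tabFrom {α : Type} (d : α) (f : ℕ → α) (n i j : ℕ) (h : j < n) :
    nth d (tabFrom f n i) j = f (i + j) := by
  induction n generalizing i j with
  | zero => omega
  | succ n ih =>
    rw [tabFrom_succ]
    cases j with
    | zero => rfl
    | succ j =>
      refine (ih (i + 1) j (by omega)).trans ?_
      congr 1; omega

theorem nth_tab {α : Type} (d : α) (f : ℕ → α) {n j : ℕ} (h : j < n) : nth d (tab f n) j = f j := by
  rw [tab, nth_tabFrom _ _ _ _ _ h, Nat.zero_add]

theorem ent_tab (f : ℕ → ℕ → ℤ × ℤ) {m n i j : ℕ} (hi : i < m) (hj : j < n) :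
    ent (tab (fun i => tab (f i) n) m) i j = f i j := by
  rw [ent, nth_tab _ _ hi, nth_tab _ _ hj]

/-- Lazy conjunction. -/
noncomputable def andThen (a b : Bool) : Bool := Bool.rec false b a

theorem andThen_eq_true {a b : Bool} : andThen a b = true ↔ a = true ∧ b = true := by
  cases a <;> simp [andThen]

/-- Whether `p` holds at all numbers less than `n`. -/
noncomputable def allBelow (n : ℕ) (p : ℕ → Bool) : Bool :=
  Nat.rec true (fun i ih => andThen ih (p i)) n

theorem allBelow_eq_true {n : ℕ} {p : ℕ → Bool} : allBelow n p = true ↔ ∀ i < n, p i = true := by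
  induction n with
  | zero => simp [allBelow]
  | succ n ih =>
    change andThen (allBelow n p) (p n) = true ↔ _
    rw [andThen_eq_true, ih, Nat.forall_lt_succ_right]

/-- The complex number `z.1 + z.2 * I`. -/
noncomputable def toC (z : ℤ × ℤ) : ℂ := z.1 + z.2 * Complex.I

/-- Sum of Gaussian integers. -/
def gadd (x y : ℤ × ℤ) : ℤ × ℤ := (Int.add x.1 y.1, Int.add x.2 y.2)

/-- Product of Gaussian integers. -/
def gmul (x y : ℤ × ℤ) : ℤ × ℤ :=
  (Int.sub (Int.mul x.1 y.1) (Int.mul x.2 y.2), Int.add (Int.mul x.1 y.2) (Int.mul x.2 y.1))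

/-- Multiple of a Gaussian integer. -/
def gsmul (n : ℕ) (x : ℤ × ℤ) : ℤ × ℤ := (Int.mul (Int.ofNat n) x.1, Int.mul (Int.ofNat n) x.2)

/-- Powers of Gaussian integers. -/
noncomputable def gpow (x : ℤ × ℤ) (n : ℕ) : ℤ × ℤ :=
  Nat.rec (Int.ofNat 1, Int.ofNat 0) (fun _ ih => forceGauss ih fun y => gmul y x) n

/-- The Gaussian integer `x - n` if `p` holds and `x` otherwise. -/
noncomputable def gsubIf (p : Bool) (n : ℤ) (x : ℤ × ℤ) : ℤ × ℤ :=
  Bool.rec x (Int.sub x.1 n, x.2) p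

theorem toC_gadd (x y : ℤ × ℤ) : toC (gadd x y) = toC x + toC y := by
  have h : gadd x y = (x.1 + y.1, x.2 + y.2) := rfl
  simp only [h, toC]
  push_cast
  ring

theorem toC_gmul (x y : ℤ × ℤ) : toC (gmul x y) = toC x * toC y := by
  have h : gmul x y = (x.1 * y.1 - x.2 * y.2, x.1 * y.2 + x.2 * y.1) := rfl
  simp only [h, toC]
  push_cast
  linear_combination (-(x.2 : ℂ) * y.2) * Complex.I_sq

theorem toC_gsmul (n : ℕ) (x : ℤ × ℤ) : toC (gsmul n x) = n * toC x := by
  have h : gsmul n x = ((n : ℤ) * x.1, (n : ℤ) * x.2) := rfl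
  simp only [h, toC]
  push_cast
  ring

theorem toC_gpow (x : ℤ × ℤ) (n : ℕ) : toC (gpow x n) = toC x ^ n := by
  induction n with
  | zero =>
    have h : gpow x 0 = (1, 0) := rfl
    simp [h, toC]
  | succ n ih =>
    have h : gpow x (n + 1) = forceGauss (gpow x n) fun y => gmul y x := rfl
    rw [h, forceGauss_eq, toC_gmul, ih, pow_succ]

theorem toC_gsubIf (p : Bool) (n : ℤ) (x : ℤ × ℤ) :
    toC (gsubIf p n x) = toC x - if p = true then (n : ℂ) else 0 := by
  cases p
  · simp [gsubIf]
  · have h : gsubIf true n x = (x.1 - n, x.2) := rfl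
    simp only [h, toC, if_true]
    push_cast
    ring

/-- Whether the sum of the absolute values of the coordinates of `z` is at most `b`. -/
def small (b : ℕ) (z : ℤ × ℤ) : Bool := Nat.ble (Nat.add (Int.natAbs z.1) (Int.natAbs z.2)) b

theorem norm_le_of_small {b : ℕ} {z : ℤ × ℤ} (h : small b z = true) : ‖toC z‖ ≤ b := by
  have h1 : z.1.natAbs + z.2.natAbs ≤ b := Nat.le_of_ble_eq_true h
  have h2 : ∀ n : ℤ, ‖(n : ℂ)‖ = n.natAbs := fun n => by
    rw [Complex.norm_intCast, Nat.cast_natAbs, Int.cast_abs]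
  calc ‖toC z‖ ≤ ‖(z.1 : ℂ)‖ + ‖(z.2 : ℂ) * Complex.I‖ := norm_add_le _ _
    _ = z.1.natAbs + z.2.natAbs := by rw [norm_mul, Complex.norm_I, mul_one, h2, h2]
    _ ≤ b := by exact_mod_cast h1

/-- Add `x * y` to the integer `p - n`. -/
noncomputable def mulAcc {β : Type} (x y : ℤ) (p n : ℕ) (k : ℕ → ℕ → β) : β :=
  Int.rec
    (fun a => Int.rec (fun b => k (Nat.add p (Nat.mul a b)) n)
      (fun b => k p (Nat.add n (Nat.mul a (Nat.succ b)))) y)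
    (fun a => Int.rec (fun b => k p (Nat.add n (Nat.mul (Nat.succ a) b)))
      (fun b => k (Nat.add p (Nat.mul (Nat.succ a) (Nat.succ b))) n) y) x

/-- Positive and negative parts are accumulated separately, so that only natural numbers are
multiplied. Which accumulator grows depends on the signs; the only invariant needed is their
difference. -/
theorem mulAcc_eq {β : Type} (x y : ℤ) (p n : ℕ) (k : ℕ → ℕ → β) :
    ∃ p' n' : ℕ, mulAcc x y p n k = k p' n' ∧ (p' : ℤ) - n' = p - n + x * y := by
  cases x <;> cases y
  all_goals
    refine ⟨_, _, rfl, ?_⟩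
    simp only [Nat.add_eq, Nat.mul_eq, Int.negSucc_eq, Nat.succ_eq_add_one, Int.ofNat_eq_natCast]
    push_cast
    ring

/-- The sum of `(p - n) + (p' - n') * I` and of the dot product of `u` and `v`. -/
noncomputable def dotAcc (u : List (ℤ × ℤ)) : List (ℤ × ℤ) → ℕ → ℕ → ℕ → ℕ → ℤ × ℤ :=
  List.rec (fun _ p n p' n' => (Int.subNatNat p n, Int.subNatNat p' n'))
    (fun x _ ih v => List.rec (fun p n p' n' => (Int.subNatNat p n, Int.subNatNat p' n'))
      -- In the second product the accumulators are exchanged, which subtracts it, as I ^ 2 = -1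
      -- demands.
      (fun y v _ p n p' n' => mulAcc x.1 y.1 p n fun p n => mulAcc x.2 y.2 n p fun n p =>
        mulAcc x.1 y.2 p' n' fun p' n' => mulAcc x.2 y.1 p' n' fun p' n' => ih v p n p' n') v) u

/-- The dot product of `u` and `v`. -/
noncomputable def gdot (u v : List (ℤ × ℤ)) : ℤ × ℤ := dotAcc u v 0 0 0 0

theorem toC_subNatNat (p n p' n' : ℕ) :
    toC (Int.subNatNat p n, Int.subNatNat p' n') =
      ((p : ℤ) - n : ℤ) + ((p' : ℤ) - n' : ℤ) * Complex.I := by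
  simp only [toC, Int.subNatNat_eq_coe]

/-- The loop stops with the shorter list. Entries of `u` past its end default to zero, so the sum
may run over all of `range m`. -/
theorem toC_dotAcc (u : List (ℤ × ℤ)) (f : ℕ → ℤ × ℤ) (i m p n p' n' : ℕ) :
    toC (dotAcc u (tabFrom f m i) p n p' n') =
      (((p : ℤ) - n : ℤ) + ((p' : ℤ) - n' : ℤ) * Complex.I) +
        ∑ j ∈ Finset.range m, toC (nth (0, 0) u j) * toC (f (i + j)) := by
  induction u generalizing i m p n p' n' with
  | nil =>
    have h : ∀ j, toC (nth (0, 0) [] j) = 0 := fun j => by simp [nth, toC]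
    simp only [h, zero_mul, Finset.sum_const_zero, add_zero]
    exact toC_subNatNat _ _ _ _
  | cons x u ih =>
    cases m with
    | zero =>
      rw [Finset.sum_range_zero, add_zero]
      exact toC_subNatNat _ _ _ _
    | succ m =>
      change toC (mulAcc x.1 (f i).1 p n fun p n => mulAcc x.2 (f i).2 n p fun n p =>
        mulAcc x.1 (f i).2 p' n' fun p' n' => mulAcc x.2 (f i).1 p' n' fun p' n' =>
          dotAcc u (tabFrom f m (i + 1)) p n p' n') = _
      obtain ⟨p₁, n₁, h, e₁⟩ := mulAcc_eq x.1 (f i).1 p n fun p n => mulAcc x.2 (f i).2 n p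
        fun n p => mulAcc x.1 (f i).2 p' n' fun p' n' => mulAcc x.2 (f i).1 p' n' fun p' n' =>
          dotAcc u (tabFrom f m (i + 1)) p n p' n'
      rw [h]
      obtain ⟨n₂, p₂, h, e₂⟩ := mulAcc_eq x.2 (f i).2 n₁ p₁ fun n p =>
        mulAcc x.1 (f i).2 p' n' fun p' n' => mulAcc x.2 (f i).1 p' n' fun p' n' =>
          dotAcc u (tabFrom f m (i + 1)) p n p' n'
      rw [h]
      obtain ⟨p₃, n₃, h, e₃⟩ := mulAcc_eq x.1 (f i).2 p' n' fun p' n' =>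
        mulAcc x.2 (f i).1 p' n' fun p' n' => dotAcc u (tabFrom f m (i + 1)) p₂ n₂ p' n'
      rw [h]
      obtain ⟨p₄, n₄, h, e₄⟩ := mulAcc_eq x.2 (f i).1 p₃ n₃ fun p' n' =>
        dotAcc u (tabFrom f m (i + 1)) p₂ n₂ p' n'
      rw [h, ih, Finset.sum_range_succ', e₄, e₃,
        show (p₂ : ℤ) - n₂ = p - n + x.1 * (f i).1 - x.2 * (f i).2 by linarith]
      have h0 : nth (0, 0) (x :: u) 0 = x := rfl
      have h1 : ∀ j, nth (0, 0) (x :: u) (j + 1) = nth (0, 0) u j := fun _ => rfl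
      have h2 : ∀ j, i + 1 + j = i + (j + 1) := fun j => by ring
      simp only [h0, h1, h2, Nat.add_zero]
      simp only [toC]
      push_cast
      linear_combination (-(x.2 : ℂ) * (f i).2) * Complex.I_sq

theorem toC_gdot (u : List (ℤ × ℤ)) (f : ℕ → ℤ × ℤ) (m : ℕ) :
    toC (gdot u (tab f m)) = ∑ j ∈ Finset.range m, toC (nth (0, 0) u j) * toC (f j) := by
  rw [gdot, tab, toC_dotAcc]
  simp

end SimWaring

/-! ### Certificates in Gaussian integers and their verification -/

namespace SimWaring

open Filter Topology Metric

/-- Integral data for a certificate. -/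
structure CertificateData where
  /-- The parameters of the eleven summands, in units of `10 ^ (-31)`. -/
  points : List (List (ℤ × ℤ))
  /-- Quartics dual to the points, in units of `10 ^ (-7)`. -/
  dual : List (List (ℤ × ℤ))
  /-- Quartics vanishing at the points, in units of `10 ^ (-15)`. -/
  vanishing : List (List (ℤ × ℤ))
  /-- Inverse of the matrix of derivatives. -/
  inverse : List (List (ℤ × ℤ))
  /-- The number of the quartic and the way to use it, for each column of the inverse matrix. -/
  choice : List (ℕ × ℕ)

/-- The pair of exponents of the monomial number `m`. -/
noncomputable def pairAt (m : ℕ) : ℕ × ℕ := nth (0, 0) exponents m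

/-- The monomial number `m` at the point `(a, b)`, homogenized to degree `5` by the unit. -/
noncomputable def gmonomial (a b : ℤ × ℤ) (m : ℕ) : ℤ × ℤ :=
  forceGauss (gpow a (pairAt m).1) fun x => forceGauss (gpow b (pairAt m).2) fun y =>
    gsmul ((10 ^ 31) ^ (5 - (pairAt m).1 - (pairAt m).2)) (gmul x y)

/-- The coefficients of the derivative of a quartic in the first variable. -/
noncomputable def gderivA (f : List (ℤ × ℤ)) (n : ℕ) : ℤ × ℤ :=
  -- In the list of monomials by degree, multiplying a monomial of degree d by the first variable
  -- moves it d + 1 places on, by the second variable d + 2 places.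
  gsmul ((pairAt n).1 + 1) (nth (0, 0) f (n + (pairAt n).1 + (pairAt n).2 + 1))

/-- The coefficients of the derivative of a quartic in the second variable. -/
noncomputable def gderivB (f : List (ℤ × ℤ)) (n : ℕ) : ℤ × ℤ :=
  gsmul ((pairAt n).2 + 1) (nth (0, 0) f (n + (pairAt n).1 + (pairAt n).2 + 2))

/-- The multiple by `c` of `10 ^ 31 * d`, of `10 ^ 31 * v + z * d` or of `z' * d`, if `e` is less
than `4`, equal to `4` or greater. -/
noncomputable def gcolumn (e : ℕ) (c v z z' d : ℤ × ℤ) : ℤ × ℤ :=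
  forceGauss
    (Bool.rec (Bool.rec (gmul z' d) (gadd (gsmul (10 ^ 31) v) (gmul z d)) (Nat.beq e 4))
      (gsmul (10 ^ 31) d) (Nat.blt e 4)) fun w => gmul c w

/-- The component of the coefficient number `k`. -/
noncomputable def compAt (k : ℕ) : ℕ := Bool.rec 3 (k / 15) (Nat.blt k 45)

/-- The monomial of the coefficient number `k`. -/
noncomputable def monoAt (k : ℕ) : ℕ := Bool.rec (k - 45) (k % 15) (Nat.blt k 45)

/-- The component in which the quartic is used. -/
noncomputable def blockAt (e : ℕ) : ℕ := Bool.rec 3 e (Nat.blt e 4)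

section tables

variable (X Q M V VA VB : List (List (ℤ × ℤ))) (s : List (ℕ × ℕ))

/-- The monomials (rows) at the points (columns). -/
noncomputable def monomialTable : List (List (ℤ × ℤ)) :=
  tab (fun m => tab (fun k => gmonomial (ent X k 0) (ent X k 1) m) 11) 21

/-- The monomials of degree at most four (columns) at the points (rows). -/
noncomputable def quarticTable : List (List (ℤ × ℤ)) :=
  tab (fun k => tab (fun m => ent M m k) 15) 11

/-- The derivatives in the first variable of the quartics. -/
noncomputable def derivATable (n : ℕ) : List (List (ℤ × ℤ)) :=
  tab (fun i => tab (gderivA (nth [] Q i)) 10) n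

/-- The derivatives in the second variable of the quartics. -/
noncomputable def derivBTable (n : ℕ) : List (List (ℤ × ℤ)) :=
  tab (fun i => tab (gderivB (nth [] Q i)) 10) n

/-- The values of the polynomials `Q` at the points. -/
noncomputable def valueTable (n : ℕ) : List (List (ℤ × ℤ)) :=
  tab (fun k => tab (fun i => gdot (nth [] Q i) (nth [] M k)) n) 11

/-- The values of the cubics `Q` at the points. -/
noncomputable def cubicValueTable (n : ℕ) : List (List (ℤ × ℤ)) :=
  tab (fun k => tab (fun i => gdot (nth [] M k) (nth [] Q i)) n) 11

/-- The matrix of derivatives in the first variable. -/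
noncomputable def columnATable : List (List (ℤ × ℤ)) :=
  tab (fun k => tab (fun u => gcolumn (nth (0, 0) s u).2
    (ent X k (2 + blockAt (nth (0, 0) s u).2)) (ent V k (nth (0, 0) s u).1) (ent X k 0) (ent X k 1)
    (ent VA k (nth (0, 0) s u).1)) 22) 11

/-- The value of `e`, with the roles of the variables exchanged. -/
noncomputable def exchange (e : ℕ) : ℕ := Bool.rec (Bool.rec 4 5 (Nat.beq e 4)) e (Nat.blt e 4)

/-- The matrix of derivatives in the second variable. -/
noncomputable def columnBTable : List (List (ℤ × ℤ)) :=
  tab (fun k => tab (fun u => gcolumn (exchange (nth (0, 0) s u).2)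
    (ent X k (2 + blockAt (nth (0, 0) s u).2)) (ent V k (nth (0, 0) s u).1) (ent X k 1) (ent X k 0)
    (ent VB k (nth (0, 0) s u).1)) 22) 11

end tables

/-- Check the bounds on the data. -/
noncomputable def checkBounds (X L Q C : List (List (ℤ × ℤ))) (s : List (ℕ × ℕ)) : Bool :=
  andThen (allBelow 11 fun i => allBelow 6 fun z => small (55 * 10 ^ 30) (ent X i z)) <|
  andThen (allBelow 11 fun i => allBelow 4 fun j => small (2 * 10 ^ 27) (ent X i (2 + j))) <|
  andThen (allBelow 11 fun i => allBelow 15 fun m => small (4 * 10 ^ 7) (ent L i m)) <|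
  andThen (allBelow 4 fun i => allBelow 15 fun m => small (10 ^ 15) (ent Q i m)) <|
  andThen (allBelow 22 fun t => allBelow 22 fun u => small (2 * 10 ^ 6) (ent C t u)) <|
  allBelow 22 fun u => andThen (Nat.blt (nth (0, 0) s u).1 4) (Nat.blt (nth (0, 0) s u).2 6)

/-- Check the values of the dual quartics and of their derivatives at the points. -/
noncomputable def checkDual (V VA VB : List (List (ℤ × ℤ))) : Bool :=
  allBelow 11 fun k => allBelow 11 fun i =>
    -- The unit is 10^162 = 10^155 · 10^7: monomials homogenized to degree 5 in units 10^(-31),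
    -- times quartics in units 10^(-7). The tolerance is 1/10^3.
    andThen (small (10 ^ 159) (gsubIf (Nat.beq i k) (10 ^ 162 : ℕ) (ent V k i))) <|
    andThen (small (40 * 10 ^ 162) (ent VA k i)) (small (40 * 10 ^ 162) (ent VB k i))

/-- Check that the product of the matrices is close to the identity. -/
noncomputable def checkInverse (C GA GB : List (List (ℤ × ℤ))) : Bool :=
  -- Row `2 i + z` of the inverse recovers `a` (z = 0) or `b` (z = 1) at the point `i`. The unit
  -- 10^232 collects 31 for the coefficient `c`, 31 for a possible variable, 155 for monomials and
  -- 15 for quartics.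
  allBelow 11 fun k => allBelow 22 fun t =>
    andThen (small (5 * 10 ^ 229)
      (gsubIf (Nat.beq t (2 * k)) (10 ^ 232 : ℕ) (gdot (nth [] C t) (nth [] GA k))))
      (small (5 * 10 ^ 229)
        (gsubIf (Nat.beq t (2 * k + 1)) (10 ^ 232 : ℕ) (gdot (nth [] C t) (nth [] GB k))))

/-- Check that the data are an approximate solution. -/
noncomputable def checkResidual (F : List ℤ) (X M : List (List (ℤ × ℤ))) : Bool :=
  -- The sum is in units of 10^(-186), with 155 for the monomial and 31 for `c`; the right-hand
  -- side, in units of 10^(-5), is multiplied by 10^181. The tolerance is 10^(-27).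
  allBelow 66 fun k => small (10 ^ 159) (gsubIf true (Int.mul (nth 0 F k) (10 ^ 181 : ℕ))
    (gdot (nth [] M (monoAt k)) (tab (fun i => ent X i (2 + compAt k)) 11)))

/-- Check all conditions for a certificate for `waringMap x = 10 ^ (-5) * F`. -/
noncomputable def check (F : List ℤ) (c : CertificateData) : Bool :=
  forceMatrix c.points fun X => forceMatrix c.dual fun L => forceMatrix c.vanishing fun Q =>
  forceMatrix c.inverse fun C =>
  andThen (checkBounds X L Q C c.choice) <|
  forceMatrix (monomialTable X) fun M =>
  andThen (checkResidual F X M) <|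
  -- From here on `M` has the points as rows and only the fifteen monomials of degree at most four
  -- as columns.
  forceMatrix (quarticTable M) fun M =>
  forceMatrix (derivATable L 11) fun LA => forceMatrix (derivBTable L 11) fun LB =>
  forceMatrix (valueTable L M 11) fun V => forceMatrix (cubicValueTable LA M 11) fun VA =>
  forceMatrix (cubicValueTable LB M 11) fun VB =>
  andThen (checkDual V VA VB) <|
  forceMatrix (derivATable Q 4) fun QA => forceMatrix (derivBTable Q 4) fun QB =>
  forceMatrix (valueTable Q M 4) fun V => forceMatrix (cubicValueTable QA M 4) fun VA =>
  forceMatrix (cubicValueTable QB M 4) fun VB =>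
  andThen (allBelow 11 fun k => allBelow 4 fun i => small (10 ^ 159) (ent V k i)) <|
  forceMatrix (columnATable X V VA c.choice) fun GA =>
  forceMatrix (columnBTable X V VB c.choice) fun GB => checkInverse C GA GB

/-- The list of `n` Gaussian integers with offset digits `N` in base `10 ^ d`, last one first. -/
noncomputable def unpackGauss (d n N : ℕ) : List (ℤ × ℤ) :=
  Nat.rec (fun _ => []) (fun _ ih N => (Int.subNatNat (N % 10 ^ d) (10 ^ d / 2),
    Int.subNatNat (N / 10 ^ d % 10 ^ d) (10 ^ d / 2)) :: ih (N / 10 ^ d / 10 ^ d)) n N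

end SimWaring

/-! ### Soundness of the verification -/

namespace SimWaring

open Filter Topology Metric

theorem pairAt_eq (m : ℕ) : pairAt m = expo m := nth_eq_getD _ _ _

theorem toC_gmonomial (a b : ℤ × ℤ) {m : ℕ} (hm : m < 21) :
    toC (gmonomial a b m) = 10 ^ 155 *
      ((toC a / 10 ^ 31) ^ (expo m).1 * (toC b / 10 ^ 31) ^ (expo m).2) := by
  have h5 : ∀ m < 21, (expo m).1 + (expo m).2 ≤ 5 := by decide
  have h := h5 m hm
  simp only [gmonomial, forceGauss_eq, toC_gsmul, toC_gmul, toC_gpow, pairAt_eq]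
  have e : (10 : ℂ) ^ 155 = (10 ^ 31) ^ (5 - (expo m).1 - (expo m).2) *
      ((10 ^ 31) ^ (expo m).1 * (10 ^ 31) ^ (expo m).2) := by
    rw [← pow_add, ← pow_add, ← pow_mul]
    congr 1
    omega
  rw [e, div_pow, div_pow]
  simp only [Nat.cast_pow, Nat.cast_ofNat]
  field_simp

/-- The quartic with coefficients `f`, in units of `1 / T`. -/
noncomputable def quarticOf (T : ℂ) (f : List (ℤ × ℤ)) (m : Fin 21) : ℂ :=
  if m.1 < 15 then toC (nth (0, 0) f m.1) / T else 0

theorem isQuartic_quarticOf (T : ℂ) (f : List (ℤ × ℤ)) : IsQuartic (quarticOf T f) :=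
  fun _ hm => if_neg hm.not_gt

theorem polyVal_quarticOf (T : ℂ) (f : List (ℤ × ℤ)) (a b : ℂ) :
    polyVal (quarticOf T f) a b =
      (∑ m ∈ Finset.range 15, toC (nth (0, 0) f m) * (a ^ (expo m).1 * b ^ (expo m).2)) / T := by
  simp only [polyVal, sum_fin21, Finset.sum_range_succ, quarticOf]
  simp
  ring

theorem polyDerivA_quarticOf (T : ℂ) (f : List (ℤ × ℤ)) (a b : ℂ) :
    polyDerivA (quarticOf T f) a b =
      (∑ n ∈ Finset.range 10, (a ^ (expo n).1 * b ^ (expo n).2) * toC (gderivA f n)) / T := by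
  simp only [polyDerivA, sum_fin21, Finset.sum_range_succ, quarticOf, gderivA, toC_gsmul, pairAt_eq]
  simp [expo, exponents]
  ring

theorem polyDerivB_quarticOf (T : ℂ) (f : List (ℤ × ℤ)) (a b : ℂ) :
    polyDerivB (quarticOf T f) a b =
      (∑ n ∈ Finset.range 10, (a ^ (expo n).1 * b ^ (expo n).2) * toC (gderivB f n)) / T := by
  simp only [polyDerivB, sum_fin21, Finset.sum_range_succ, quarticOf, gderivB, toC_gsmul, pairAt_eq]
  simp [expo, exponents]
  ring

section tables

variable (X : List (List (ℤ × ℤ)))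

/-- The matrix with entries `X`, in units of `10 ^ (-31)`. -/
noncomputable def scaled (k z : ℕ) : ℂ := toC (ent X k z) / 10 ^ 31

theorem toC_eq_scaled (k z : ℕ) : toC (ent X k z) = 10 ^ 31 * scaled X k z := by
  rw [scaled]; field_simp

theorem toC_ent_monomialTable {m k : ℕ} (hm : m < 21) (hk : k < 11) :
    toC (ent (monomialTable X) m k) =
      10 ^ 155 * (scaled X k 0 ^ (expo m).1 * scaled X k 1 ^ (expo m).2) := by
  rw [monomialTable, ent_tab (fun m k => gmonomial (ent X k 0) (ent X k 1) m) hm hk,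
    toC_gmonomial _ _ hm, scaled, scaled]

theorem nth_quarticTable {k : ℕ} (hk : k < 11) :
    nth [] (quarticTable (monomialTable X)) k = tab (fun m => ent (monomialTable X) m k) 15 :=
  nth_tab _ _ hk

theorem toC_valueTable (L : List (List (ℤ × ℤ))) (T : ℂ) (hT : T ≠ 0) {n i k : ℕ} (hi : i < n)
    (hk : k < 11) :
    toC (ent (valueTable L (quarticTable (monomialTable X)) n) k i) =
      10 ^ 155 * T * polyVal (quarticOf T (nth [] L i)) (scaled X k 0) (scaled X k 1) := by
  rw [valueTable, ent_tab (fun k i => gdot (nth [] L i) (nth [] _ k)) hk hi,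
    nth_quarticTable X hk, toC_gdot, polyVal_quarticOf, mul_assoc, mul_div_cancel₀ _ hT,
    Finset.mul_sum]
  refine Finset.sum_congr rfl fun m hm => ?_
  rw [toC_ent_monomialTable X (by have := Finset.mem_range.1 hm; omega) hk]
  ring

theorem toC_cubicValueTableA (L : List (List (ℤ × ℤ))) (T : ℂ) (hT : T ≠ 0) {n i k : ℕ}
    (hi : i < n) (hk : k < 11) :
    toC (ent (cubicValueTable (derivATable L n) (quarticTable (monomialTable X)) n) k i) =
      10 ^ 155 * T * polyDerivA (quarticOf T (nth [] L i)) (scaled X k 0) (scaled X k 1) := by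
  rw [cubicValueTable, ent_tab (fun k i => gdot (nth [] _ k) (nth [] _ i)) hk hi,
    nth_quarticTable X hk, derivATable, nth_tab _ _ hi, toC_gdot, polyDerivA_quarticOf, mul_assoc,
    mul_div_cancel₀ _ hT, Finset.mul_sum]
  refine Finset.sum_congr rfl fun m hm => ?_
  have hm := Finset.mem_range.1 hm
  rw [nth_tab _ _ (by omega), toC_ent_monomialTable X (by omega) hk]
  ring

theorem toC_cubicValueTableB (L : List (List (ℤ × ℤ))) (T : ℂ) (hT : T ≠ 0) {n i k : ℕ}
    (hi : i < n) (hk : k < 11) :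
    toC (ent (cubicValueTable (derivBTable L n) (quarticTable (monomialTable X)) n) k i) =
      10 ^ 155 * T * polyDerivB (quarticOf T (nth [] L i)) (scaled X k 0) (scaled X k 1) := by
  rw [cubicValueTable, ent_tab (fun k i => gdot (nth [] _ k) (nth [] _ i)) hk hi,
    nth_quarticTable X hk, derivBTable, nth_tab _ _ hi, toC_gdot, polyDerivB_quarticOf, mul_assoc,
    mul_div_cancel₀ _ hT, Finset.mul_sum]
  refine Finset.sum_congr rfl fun m hm => ?_
  have hm := Finset.mem_range.1 hm
  rw [nth_tab _ _ (by omega), toC_ent_monomialTable X (by omega) hk]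
  ring

end tables

/-- The three cases are the derivative of a quartic multiplied by the variable of differentiation
(product rule), by the other variable, or by nothing. The factor 10^31 gives all of them the same
unit. -/
theorem toC_gcolumn (e : Fin 6) (c v z z' d : ℤ × ℤ) :
    toC (gcolumn e.1 c v z z' d) = toC c *
      if e = 4 then 10 ^ 31 * toC v + toC z * toC d
      else if e = 5 then toC z' * toC d else 10 ^ 31 * toC d := by
  have h4 : gcolumn 4 c v z z' d = gmul c (gadd (gsmul (10 ^ 31) v) (gmul z d)) := by
    simp only [gcolumn, forceGauss_eq]; rfl
  have h5 : gcolumn 5 c v z z' d = gmul c (gmul z' d) := by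
    simp only [gcolumn, forceGauss_eq]; rfl
  have h0 : ∀ e < 4, gcolumn e c v z z' d = gmul c (gsmul (10 ^ 31) d) := by
    intro e he
    have : Nat.blt e 4 = true := by simpa [Nat.blt_eq] using he
    simp only [gcolumn, forceGauss_eq, this]
  split_ifs with e4 e5
  · subst e4
    rw [show ((4 : Fin 6) : ℕ) = 4 from rfl, h4, toC_gmul, toC_gadd, toC_gsmul, toC_gmul]
    simp only [Nat.cast_pow, Nat.cast_ofNat]
  · subst e5
    rw [show ((5 : Fin 6) : ℕ) = 5 from rfl, h5, toC_gmul, toC_gmul]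
  · rw [h0 e.1 (by omega), toC_gmul, toC_gsmul]
    simp only [Nat.cast_pow, Nat.cast_ofNat]

theorem exchange_eq (e : Fin 6) :
    exchange e.1 = ((if e = 4 then 5 else if e = 5 then 4 else e : Fin 6) : ℕ) := by
  revert e
  decide

theorem blockAt_eq (e : Fin 6) : blockAt e.1 = (block e : ℕ) := by
  revert e
  decide

theorem compAt_eq (k : Fin 66) : compAt k.1 = (comp k : ℕ) := by
  revert k
  decide +kernel

theorem monoAt_eq (k : Fin 66) : monoAt k.1 = (mono k : ℕ) := by
  revert k
  decide +kernel

theorem norm_le_of_eq_mul {z w : ℂ} {b T : ℝ} (hT : 0 < T) (h : ‖z‖ ≤ b) (hz : z = (T : ℂ) * w) :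
    ‖w‖ ≤ b / T := by
  rw [hz, norm_mul, Complex.norm_real, Real.norm_of_nonneg hT.le] at h
  rwa [le_div_iff₀' hT]

namespace CertificateData

variable (c : CertificateData)

/-- The parameters of the approximate solution. -/
noncomputable def x (p : Fin 11 × Fin 6) : ℂ := scaled c.points p.1 p.2

/-- The dual quartics. -/
noncomputable def l (i : Fin 11) : Fin 21 → ℂ := quarticOf (10 ^ 7) (nth [] c.dual i)

/-- The quartic used in the column `u`. -/
noncomputable def q (u : Fin 22) : Fin 21 → ℂ :=
  quarticOf (10 ^ 15) (nth [] c.vanishing (nth (0, 0) c.choice u).1)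

/-- The way in which the quartic is used in the column `u`. -/
noncomputable def e (u : Fin 22) : Fin 6 := Fin.ofNat 6 (nth (0, 0) c.choice u).2

/-- The inverse matrix. -/
noncomputable def C (i : Fin 11) (z : Fin 2) (u : Fin 22) : ℂ := toC (ent c.inverse (2 * i + z) u)

end CertificateData

/-- Every integer that is tested equals a fixed power of ten times the complex number in the
corresponding condition, and `small` bounds the sum of the absolute values of its two parts, which
dominates the norm. So each condition follows by dividing by its unit. -/
theorem isCertificate_of_check {F : List ℤ} {c : CertificateData} (h : check F c = true) :
    IsCertificate c.x (fun k => ((nth 0 F k : ℤ) : ℂ) / 10 ^ 5) c.l c.C c.e c.q := by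
  simp only [check, forceMatrix_eq, andThen_eq_true, checkBounds, checkDual, checkInverse,
    checkResidual, allBelow_eq_true] at h
  obtain ⟨⟨hX, hXc, hL, hQ, hC, hs⟩, hR, hD, hV, hI⟩ := h
  have hs1 : ∀ u : Fin 22, (nth (0, 0) c.choice u).1 < 4 := fun u => by
    simpa [Nat.blt_eq] using (hs u u.2).1
  have hs2 : ∀ u : Fin 22, (nth (0, 0) c.choice u).2 = (c.e u : ℕ) := fun u => by
    have : (nth (0, 0) c.choice u).2 < 6 := by simpa [Nat.blt_eq] using (hs u u.2).2
    simp [CertificateData.e, Fin.ofNat, Nat.mod_eq_of_lt this]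
  have hT7 : (10 : ℂ) ^ 7 ≠ 0 := by norm_num
  have hT15 : (10 : ℂ) ^ 15 ≠ 0 := by norm_num
  constructor
  · exact fun i => isQuartic_quarticOf _ _
  · exact fun u => isQuartic_quarticOf _ _
  · rintro ⟨i, z⟩
    refine (norm_le_of_eq_mul (T := 10 ^ 31) (by norm_num) (norm_le_of_small (hX i i.2 z z.2))
      (w := c.x (i, z)) ?_).trans (by norm_num)
    rw [toC_eq_scaled]; push_cast; rfl
  · intro i j
    refine (norm_le_of_eq_mul (T := 10 ^ 31) (by norm_num) (norm_le_of_small (hXc i i.2 j j.2))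
      (w := c.x (i, cpos j)) ?_).trans (by norm_num)
    rw [toC_eq_scaled]; push_cast; rfl
  · intro i m
    rw [CertificateData.l, quarticOf]
    split_ifs with hm
    · refine (norm_le_of_eq_mul (T := 10 ^ 7) (by norm_num) (norm_le_of_small (hL i i.2 m hm))
        ?_).trans (le_of_eq (by norm_num))
      rw [ent]; push_cast; field_simp
    · simp
  · intro u m
    rw [CertificateData.q, quarticOf]
    split_ifs with hm
    · refine (norm_le_of_eq_mul (T := 10 ^ 15) (by norm_num)
        (norm_le_of_small (hQ _ (hs1 u) m hm)) ?_).trans (le_of_eq (by norm_num))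
      rw [ent]; push_cast; field_simp
    · simp
  · intro i z u
    exact (norm_le_of_small (hC (2 * i + z) (by omega) u u.2)).trans (le_of_eq (by norm_num))
  · intro i k
    refine (norm_le_of_eq_mul (T := 10 ^ 162) (by norm_num)
      (norm_le_of_small (hD k k.2 i i.2).1) ?_).trans (b := _) (by norm_num)
    rw [toC_gsubIf, toC_valueTable _ _ _ hT7 i.2 k.2]
    have h162 : ((10 ^ 162 : ℝ) : ℂ) = 10 ^ 155 * 10 ^ 7 := by norm_num
    simp only [Nat.beq_eq, Fin.val_inj]
    rw [mul_sub, h162]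
    congr 1
    split_ifs
    · norm_num
    · simp
  · intro i k
    refine (norm_le_of_eq_mul (T := 10 ^ 162) (by norm_num)
      (norm_le_of_small (hD k k.2 i i.2).2.1) ?_).trans (b := _) (by norm_num)
    rw [toC_cubicValueTableA _ _ _ hT7 i.2 k.2, ← pow_add]
    push_cast; rfl
  · intro i k
    refine (norm_le_of_eq_mul (T := 10 ^ 162) (by norm_num)
      (norm_le_of_small (hD k k.2 i i.2).2.2) ?_).trans (b := _) (by norm_num)
    rw [toC_cubicValueTableB _ _ _ hT7 i.2 k.2, ← pow_add]
    push_cast; rfl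
  · intro u k
    refine (norm_le_of_eq_mul (T := 10 ^ 170) (by norm_num)
      (norm_le_of_small (hV k k.2 _ (hs1 u))) ?_).trans (b := _) (by norm_num)
    rw [toC_valueTable _ _ _ hT15 (hs1 u) k.2, ← pow_add]
    push_cast; rfl
  · intro i z k
    refine (norm_le_of_eq_mul (T := 10 ^ 232) (by norm_num)
      (norm_le_of_small (hI k k.2 (2 * i + z) (by omega)).1) ?_).trans (b := _) (by norm_num)
    have hiff : Nat.beq (2 * i + z) (2 * k) = true ↔ i = k ∧ z = 0 := by
      rw [Nat.beq_eq, ← Fin.val_inj, ← Fin.val_inj]; simp; omega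
    rw [toC_gsubIf, columnATable, nth_tab _ _ k.2, toC_gdot, mul_sub, Finset.sum_range,
      Finset.mul_sum]
    congr 1
    · refine Finset.sum_congr rfl fun u _ => ?_
      rw [hs2 u, toC_gcolumn, toC_valueTable _ _ _ hT15 (hs1 u) k.2,
        toC_cubicValueTableA _ _ _ hT15 (hs1 u) k.2, blockAt_eq]
      simp only [toC_eq_scaled]
      have hq : IsQuartic (c.q u) := isQuartic_quarticOf _ _
      change c.C i z u * (10 ^ 31 * c.x (k, cpos (block (c.e u))) * if c.e u = 4 then
        10 ^ 31 * (10 ^ 155 * 10 ^ 15 * polyVal (c.q u) (c.x (k, 0)) (c.x (k, 1))) +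
          10 ^ 31 * c.x (k, 0) * (10 ^ 155 * 10 ^ 15 * polyDerivA (c.q u) (c.x (k, 0)) (c.x (k, 1)))
        else if c.e u = 5 then 10 ^ 31 * c.x (k, 1) *
          (10 ^ 155 * 10 ^ 15 * polyDerivA (c.q u) (c.x (k, 0)) (c.x (k, 1)))
        else 10 ^ 31 * (10 ^ 155 * 10 ^ 15 * polyDerivA (c.q u) (c.x (k, 0)) (c.x (k, 1)))) = _
      rw [shift]
      push_cast
      split_ifs
      · rw [polyDerivA_shiftA hq]; ring
      · rw [polyDerivA_shiftB hq]; ring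
      · ring
    · simp only [hiff]
      split_ifs
      · norm_num
      · simp
  · intro i z k
    refine (norm_le_of_eq_mul (T := 10 ^ 232) (by norm_num)
      (norm_le_of_small (hI k k.2 (2 * i + z) (by omega)).2) ?_).trans (b := _) (by norm_num)
    have hiff : Nat.beq (2 * i + z) (2 * k + 1) = true ↔ i = k ∧ z = 1 := by
      rw [Nat.beq_eq, ← Fin.val_inj, ← Fin.val_inj]; simp; omega
    rw [toC_gsubIf, columnBTable, nth_tab _ _ k.2, toC_gdot, mul_sub, Finset.sum_range,
      Finset.mul_sum]
    congr 1
    · refine Finset.sum_congr rfl fun u _ => ?_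
      rw [hs2 u, exchange_eq, toC_gcolumn, toC_valueTable _ _ _ hT15 (hs1 u) k.2,
        toC_cubicValueTableB _ _ _ hT15 (hs1 u) k.2, blockAt_eq]
      simp only [toC_eq_scaled]
      have hq : IsQuartic (c.q u) := isQuartic_quarticOf _ _
      -- For the derivative in the second variable the cases 4 and 5 trade places; `exchange` is
      -- undone here.
      have h45 : ∀ (e : Fin 6) (s t v : ℂ), (if (if e = 4 then 5 else if e = 5 then 4 else e) = 4
          then s else if (if e = 4 then 5 else if e = 5 then 4 else e) = 5 then t else v) =
          if e = 4 then t else if e = 5 then s else v := by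
        intro e s t v
        fin_cases e <;> simp
      rw [h45]
      change c.C i z u * (10 ^ 31 * c.x (k, cpos (block (c.e u))) * if c.e u = 4 then
          10 ^ 31 * c.x (k, 0) * (10 ^ 155 * 10 ^ 15 * polyDerivB (c.q u) (c.x (k, 0)) (c.x (k, 1)))
        else if c.e u = 5 then
          10 ^ 31 * (10 ^ 155 * 10 ^ 15 * polyVal (c.q u) (c.x (k, 0)) (c.x (k, 1))) +
          10 ^ 31 * c.x (k, 1) * (10 ^ 155 * 10 ^ 15 * polyDerivB (c.q u) (c.x (k, 0)) (c.x (k, 1)))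
        else 10 ^ 31 * (10 ^ 155 * 10 ^ 15 * polyDerivB (c.q u) (c.x (k, 0)) (c.x (k, 1)))) = _
      rw [shift]
      push_cast
      split_ifs
      · rw [polyDerivB_shiftA hq]; ring
      · rw [polyDerivB_shiftB hq]; ring
      · ring
    · simp only [hiff]
      split_ifs
      · norm_num
      · simp
  · intro k
    refine (norm_le_of_eq_mul (T := 10 ^ 186) (by norm_num)
      (norm_le_of_small (hR k k.2)) ?_).trans (b := _) (by norm_num)
    rw [toC_gsubIf, toC_gdot, mul_sub, waringMap, Finset.sum_range, Finset.mul_sum]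
    congr 1
    · refine Finset.sum_congr rfl fun i _ => ?_
      have hm : monoAt k < 21 := by rw [monoAt_eq]; exact (mono k).2
      change toC (ent (monomialTable c.points) (monoAt k) i) * _ = _
      rw [toC_ent_monomialTable _ hm i.2, toC_eq_scaled, monoAt_eq, compAt_eq]
      change 10 ^ 155 * (c.x (i, 0) ^ (expo (mono k)).1 * c.x (i, 1) ^ (expo (mono k)).2) *
        (10 ^ 31 * c.x (i, cpos (comp k))) = _
      push_cast
      ring
    · rw [if_pos rfl]
      change ((nth 0 F k * ((10 ^ 181 : ℕ) : ℤ) : ℤ) : ℂ) = _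
      have h186 : ((10 ^ 186 : ℝ) : ℂ) = 10 ^ 181 * 10 ^ 5 := by norm_num
      rw [h186, Int.cast_mul, Int.cast_natCast, Nat.cast_pow, Nat.cast_ofNat]
      field_simp

theorem eventually_exists_of_check {F : List ℤ} {c : CertificateData} (h : check F c = true) :
    ∀ᶠ y in 𝓝 (fun k : Fin 66 => ((nth 0 F k : ℤ) : ℂ) / 10 ^ 5),
      ∃ x ∈ closedBall c.x (1 / 10 ^ 17), ∀ k, waringMap x k = y k :=
  (isCertificate_of_check h).eventually_exists

end SimWaring

/-! ### The special vector and five approximate solutions -/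

namespace SimWaring

/-- The coefficients of the special vector, in units of `10 ^ (-5)`. -/
def specialVector : List ℤ :=
  [0, 0, 0, 0, 2, 0, 1, 0, 0, 1, 0, 0, 2, 0, 0, 0, 1, 0, 0, 0, 2, 0, -2, 0, 0, 1, 0, 0, -1, 0, 0,
    0, 1, 2, 0, 0, 0, 0, -2, 0, 0, -1, 0, 0, 1, 1, 0, 0, 0, 1, 0, -1, 0, 0, -1, 0, 0, 0, 0, 0, 0,
    2, 0, 0, 2, 0]

/-- Data for a solution without symmetry. -/
noncomputable def certificateA : CertificateData where
  points :=
    [499999996772229240645007944622274500000046591483672942684684924537499999954273182173746202592092711499999983346404630097820544986258499999931570945430912504930073010500000077378662020987445790413757500000085917607343629016023376423500000155787540906432120630978686494178195854940720973042609394714493673467186380475334610954400430502407877908005129992575925272420498947448142814695709142276418821,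
      500000011056112914918075212827231500000003161170479480694630542882499999981484832732270070246384169499999991033824963515573514034406499999998482236631153146955875002500000037549045949982508605498143499999992114666107773806193638483500000017564088342601060721877694506974176626788224076283456677413489219147773945459286393060340309506701689599040396467538603546863509210831741807687658269619650557,
      499999976125696508675544023230298499999976987643286476674844353821500000017894283380173125260379753499999996886452132057911210479756499999947292096282997178969737942500000004399740851250279488746883499999938563825934304132382261190500000007310232051284261123262958491809040197055106728447613700534492575591721897546228530515497413494763481469294704503992874533397510321292838232165185064443149237,
      500000066823653110325142871612139499999982356329788179580954270790500000051536024602052793248906097499999976341183302298361560789685500000111408355005396258067503171499999950816076903412985100439417500000114717087493714284298276632499999858120931554389060067356125494182709577016977441336171395464496065022070817053920335989219723491839196190640074946383454197015504824578163807082987695434104893,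
      499999987971034550549925355777188499999995219583980925786488035395500000016169468094878868963667688499999993000600214564832795320215499999996987838209916036173401774500000032122924386711160589584498499999997660110301415867781114397499999998053315683790881940395395497606594466727380833445675378841510853082292956067536435689783728511713137969504412560556609919505494985723918932362724559709268208,
      499999980499708426054368444890900500000059091641473690256813651526499999986972088385225268191899926500000103644804478139367287599725500000051069120623870728434516280499999924090828345649041431430960499999951980287637887570562221994499999829904858838489204218120826500750476204195736414041693246168500558644264702064134706832500154500159267184538185794727110921271493671738652045334707320393036599,
      499999993752259208338889191040289499999965485148648185334448247766499999977341534822310508125518984499999940995717580623475462720354500000004820380043580145512411697499999930034291667279181451722276500000060263666996494766175614404499999956714963431160712174401100508585870361843541298363482622323496157538953919257644383352722611507422196608720576368722472909709498680785226185599768955622663472,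
      500000004329346123273605125391214499999996155753375660653685574390499999987438491810727304559585842500000004236768223407911226590526499999999649631605714553506873413500000016785257989983611657971609499999997332448155572407836880120500000004355026027235674548599535502339228488194457914572583684296515420865964113469241401180226166490716242278468287652394553377099491397764137617532382644992785557,
      499999982612308833155622484344051500000075124223930370168337123641500000026924393252352493411209818500000010716662775908991912836063499999957214698658537094487150394500000027566232606528296737844584499999860884693838241981279303205500000172884964235485901021098315505296153564427415916122807382047497565199366692001505486584386588494110866256695603029618879947588501727767639980245334953106741882,
      500000000019968656987632936017579499999999879739209853643663376217500000000086359110441492579736640499999999867970762465304592149010500000001592605615366230492803202499999999198125851482826563310145499999999877264143551388420070344499999999675808392280958121496273497885261777349122338960094944992507308264963860971526692376475354467252356850286282267888349477419480220172671713031011836626532979,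
      500000000037682427076186410246836499999999947282154234521449899034499999999879341635821872820618372499999999929610936920449892494003499999999912091892556122469654114500000000058813426732662583037730500000000688342047414779047242809499999999628270536850165432413094480903082677990393845404799668381530449701164300093234614581359430482007769913123115660815912953900532848670484480032000962582435039].map (unpackGauss 33 6)
  dual :=
    [489415284928202348577745483710145137754552078830499742345059442149717079500470735181953651358600518891524845377550286467489565644999686050510857472295335131554952010137547758194897133748906719522956534874115048131627513438354948348251752787,
      502136204974310349665334495465954996363350709749502764095003803649935416499607504944593350121580504009525033361850245492490908524961196049956021500807015054967250113154501296554958767550025869498378285001381449907724504231095005035150264063,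
      500656604936586351292206502042334857065950551430497453984924693250075745500997725007177150431119492187705065755851089943497654925034630350741597490680015031014548148496492277245026263850578591493814314972764749989557494551314988214849643756,
      513080795065569048553957512094385198532447735143501249955115061749816373496710104978583950012355491790104947536147226400504835364913892948357157508916644825546754288146459861485017695448696755519746304968625652547893510761725131898750618998,
      501669235009426949674621498624005016938249559631500626185040692749817581500803665027669650161723495237675013070050268625490994315025231650533128500895255062848149449117499956095032534349742612499094905038889449914023499362264987699850221200,
      502861865022720449911484527109484970756747833059503732464989080150871840501908594932715046802313497445275075216148470868502552015050710047627121507734705025557747974322464474674942134855158942494306285121451649541354449284214990989953891131,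
      494292254985950049506827500300705016999249475583497160135026440450051041502453225093813051057166505398525119828350484589515708575119279650148486509153574820601051777728477573394995682048743268491870054941450549076288495178704972842449996828,
      497655985021822750338668497053224978279449941293501534185006249949931107500476174979843250401341503625234990613449790189496895645001086650096029499715855030511050179180500277734990342649969684500498635014084950009731501051415006305350085172,
      496940295030366352056634487697124774442852014573504075574910819950004572495888654889007150587755491934494862933352533277501304634892277450433614508534834994126546393385561189905224020848561535473124505001179851133121523158664968069252414801,
      500049495000164449971065500165754999600649992607500040335001377150031765499772985000629349994686499910144999486849973433500080804999477350009907500156954999045349997324499888864999076049996388500082284999588450014036499943425000573950003681,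
      500049304999620750009033499923875001755949988853500082764999614350002666500008945000390050002677500060165000037250003782500004965000497949996503500023334999792850012419499929705000262049996293499980725000105650000476500025105000022850000939].map (unpackGauss 8 15)
  vanishing :=
    [502822845167121545372524643327865089525700486136481628893441513948295540057072874955785783897134500000000000000056353400172512784922923027009032506365042751207750741396271342135018542672353191495670794419779647991693843148545061171542985186496278522149983851282831489880104929848246606866510461440481260448126958912523895069234606231601507001875662283849805481133556035347203761572110492409121001317350020187984039815079716949822269505281716739795851331881698906224878372162337220,
      499805801922741950041453320182405091776516133864473676899112826049749164143927955103207934284313500000000000000050000000000000004862806139902459508914713905498950077550442146934458767103699231516161084597152150649742358984924869398066821483506211237850283650000000000000005616595342845700495897727398233948078929564818145021206063499858485911084244322151070932370568215044697934605075511097719860198350364072705685945049811961909694515606069611531649865489807148355216251604101710,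
      497692972825999646442633785572744961152714711056508924858228852949373624734222295079242753278905500000000000000050000000000000005004246983406002502025480403611050104017984018155025886584234849494232432064999050042399726539984962078175476684548149063005913150000000000000005000000000000000493728715949751354169939370066535057436627376863490781395460367149538594565199924884247774621757500000000000000055957210175072095006487763263396519798716435737549529651710249525118072629631178,
      500000000000000052198902219480554780442606412866483414624108910150057117711299884730157658425132500000000000000050000000000000005030629040724617500105309089617450763888355183445195700184058397500000000000000055497255548701385027266299627532521805773453062850000000000000005000000000000000480882981973942549798690944082444956093811110839517199224954566950000000000000005439780443896110500000000000000050000000000000005186686525464461530947043043769451202950244075055023707934512728].map (unpackGauss 16 15)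
  inverse :=
    [49086485064016506048048934325142987483670650026315029132491721151168024930912500654251203774989700495631950639864974913508705749844264929956507709649236434951283509679649982235025087504845749229964977414503710850325744990877501079449593014972300502633850013224990251499760650518675027508499538250003694986523,
      49353565043515502120048683945023935490149350492265023515495117450389674950607504419351460215026805494604150536764996056510069150310304997949504887849391314975786508498650019125025913501021849414014930661504160450245144981810498370950118694993552500755349962964990520504215950559465015289497796349950564978569,
      49861115006450504724150149945047022497404550417264958220502732050315004972291498358149754775012277496037850090344981338507258449938055037404499170149525785011516500093749845965004219499642549979445007440502995950014164992187498457149870144996216500570150103075004699495081150323045020330499396149957564977039,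
      50211125068781496994648734904907765488761749615115008243502135450114995008240504544650661254941709503411250421945088242503005150128594977299497157650015865009974502438650206675020281496164849847135023564501515249897324982013498733850264214998612500183649893785002054506088250244684991800497698649838415004705,
      51039374969516496746650460554858228507831550080174862332506109749196005027463493841348484045093528502378349846064953039503049749353535135669506126050674784988331489419249906575006227500509050728434982764496090149753285045617495161850099455008957497333250041014994895500312650532765008176500019850175084985394,
      49429234995655501364549835725075017494931950487385075568498379150292004995689503508850256634955261498781450043304978901496858250217124953913495662150197035022283502375449921594997237500754949707645000329498780650017564980801502941450134125011771500768850050184999825497914449790564998051500628549950215008552,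
      50186114949199492995451051534997643509575649833375012525500480649493785019926500253250035644981902500457450074455000797492544750785325006680494279850322455013978496580349890254975409502772650020194999214497962050093145006103503042550666185007779499729250129325004070501849749395694980481501036549894955010520,
      50265604926162510853650218755029152506704350502054958231500607649347145020161495893249139365097363498062349494774932381499991649631505053716504983050800484977561495016949666445014569501831050652744985146496823549839635028847498407149928005002985498089649913754995178495026750344555010109501059650140914995967,
      50584854953370489941750907504965618512095249574914992266502429250156325059559496703849440484985590499166349747225043527494523349984985002590500091250082775037650495904450020364979598498025649998024996325502242350079835002858500540950096405008565498561749939965005132501467549659474977667499239949944955008615,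
      49634235066540506275048782354989353491096350163474976262495175650149595003268502406550288775019090499350250168074977007504959349950695013703501039649916064984318505185550044885013691502809449666654961683498629550061805004729501314449988894990095500323049994644995737501116450541155016157499207649998754995125,
      49812284989453498149949778405014522501017950091134996067497335249735664997210501692950568175055740499612650500965011594506394250320174954601501003049684174996708503403850050125015397499150349849144986682503108150060954994740501180650379624997649499681149892354961552501943450062655009310499107049960434992893,
      49575335022870503770350157905055373493400549960525014140497111351060084979489495957750312714979688498867350050654982244499420849890264957510502482049882404982207499271849918275006749502387650014544985367499033950113614980874500820549559134990558500386349940565016397498673049937155002012500455950054145010888,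
      49449115033293500781049769244998795496112449638704985603498303150150924957261499227550372664968025500339950062835030319501846349927274966207499224050001644996293503133050145595010308498758249916475000072504073050130884992241498169949986604990712500900649934805011724500627449970464998300499441049989715002272,
      49793564954262500853250048994999689504193549592394981547501047249808064992337500395349767755040911499024449843564980153500260150164935036568498863750130114977362499836750020475008502500392850159205002053500548550069945006553499534050059104998218499540950098155000298498662950152245002287500457450009754995508,
      49677584942549503091750852665054159507985250210635025943492179849900824989043489978949893465057179498361749668424926577494610750475784991981504871650068164968953496034949836404996547509062849982994979116500293850315485003194498956649997084982246498573349906665013311492593050174894989437501920449985615016189,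
      50089994959145503836150035705034675507017649786914942546508386550062824986379505489949464185070286498608749957144980812498095449836745099764497971150291884980893498531649995655000894496337549784075028849494916649697755001678498049450228125012774500270550256044993793499300250061905008469500846750072384983420,
      49941995042748495778949679474948949492724950277045015692498105950513154971275500188250994544985196494991850611754997787503922850643595004879502769449599684992894503635350077685001585500133849430184933019500806150084805001404498465250140275002246501097650087244978809505778150193964998840498730550069794999298,
      50456925004324495324750316864953404498607949807735005399501835650509585023878503853149463454982036504942350166235018724499399849759844989331497512749754225026395499548250179704996343496623549907235036267500298749765484985832501364349998665008926499877250033655008502500297049850204999285500126450022134989876,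
      42814554085405629258051489656134305563709347672655280018407775645392905002163516304750760846378927429359749627313812069496503855297395498601562873853170024207454491937047017075147849587396546919664226832461715953636775145482512617252881954607523512150452446524720765476250753544545118148504090050490184942094,
      51759845345950454645847741924592679473492251682084933087523098252986745184063516990250872194508040511508350875995353644518992048385054825750482599248224855327246518411851080675000552467946849454295143487523702849062364894158496640149176105105890504445049064514977264516030348491924857420488409949847204996012,
      60756405541323420704546750094368271419181855057374739765554041753595365032249564835943353804167483527985953268735272938508802242239385255931471732247059845331690531330153773854849521483215347236775288336516725550384524689458473714550014945090291515324150945915096461503997150888955007994491889849870325041720,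
      60993085669280419595746099024352253409711755463114760586561542253614845005227561154242736894122783527753852192125305858501427141537545278233469188647286965335319529750353871834877850483766147528385322978513440850315324684417468430049620325085103517323751313555079695503172551115705006605492691349989584996002].map (unpackGauss 7 22)
  choice :=
    [(0, 0), (0, 1), (0, 2), (1, 0), (1, 1), (1, 2), (2, 0), (2, 1), (2, 2), (3, 0), (3, 1),
      (3, 2), (0, 3), (0, 4), (0, 5), (1, 3), (1, 4), (2, 3), (2, 4), (2, 5), (3, 3), (3, 4)]

/-- Data for a first solution fixed by the exchange of the variables. -/
noncomputable def certificateB : CertificateData where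
  points :=
    [500000148212962436086189752569632500000128547562704128293987826120499999779054766943874960369839291500000033077533912716197167325379499999779054766943874960369839291500000033077533912716197167325379499999865383749446036336502071481500000097111549023325096711580656499272621287424270388181209564657503273052495802112345581876699920499272621287424270388181209564657503273052495802112345581876699920,
      499999987778069124485446691882488500000003313233350713484527827257499999991194963066862903607477902499999983462901367911785544958483499999991194963066862903607477902499999983462901367911785544958483500000017704670280196344933744681500000043945290697910646089515036491151705390142639010183020562878490709191561908546688465619690872491151705390142639010183020562878490709191561908546688465619690872,
      500000021661205787537429894845030499999961276262318619322317010563499999852508724369610390034283019500000013714746172797225759845933500000034509250580173461276126103500000064189995571793362204976610499999886413473839147771701596505499999936724587197708275533352688505470229380616997718837069812314492386040744124172113053019850736499361314406557209225630855438879506691296357060554575062323592809,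
      499999912360285147344463409061076500000019246823896810147690109141500000263903439146135064614982727499999944465286239346706100387924500000052411606707229237417585362499999960197864654979598253966594500000182661164056657193197732764499999954570048894963040609221983500456415540586835379109794850433496496390960805249787421474822399496196108966878447850841363984134506745021311268469569682876807874,
      499999912360285147344463409061076500000019246823896810147690109141500000052411606707229237417585362499999960197864654979598253966594500000263903439146135064614982727499999944465286239346706100387924500000182661164056657193197732764499999954570048894963040609221983496196108966878447850841363984134506745021311268469569682876807874500456415540586835379109794850433496496390960805249787421474822399,
      500000000307512530672381463776843499999999525332900914552756907878499999997951557699723392626089411500000000045439177667394593766134499999999819471395272282522554332499999999612565250706834942742986499999998330636155293726239088287499999997141650478504211778444588499946718289205589065709459864192519829123403652537742601969544988477594406646553402355318693894020482725132343696693459573430775100,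
      499999997651042769673304766874700500000004130216809587411586117604500000008962716772314183277721483499999997231711537106859745842086500000018219241152476137642360466500000005605154314281428588356861499999991025130793842056827853227500000039299971539406026483970824497332784188535979641507139214760491451751287862717272784553368713506302011342919580602579168217678483224061361710098845814824983078,
      500000021661205787537429894845030499999961276262318619322317010563500000034509250580173461276126103500000064189995571793362204976610499999852508724369610390034283019500000013714746172797225759845933499999886413473839147771701596505499999936724587197708275533352688499361314406557209225630855438879506691296357060554575062323592809505470229380616997718837069812314492386040744124172113053019850736,
      500000000048875968973204486432584499999999781932093295352784056253500000001464262166327986610979905499999998396801800692607097831010500000001464262166327986610979905499999998396801800692607097831010500000000050770583885822631642271500000003470644057601148388924139526429396750632146869704998442173491088993931500459672446170422093526429396750632146869704998442173491088993931500459672446170422093,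
      499999997651042769673304766874700500000004130216809587411586117604500000018219241152476137642360466500000005605154314281428588356861500000008962716772314183277721483499999997231711537106859745842086499999991025130793842056827853227500000039299971539406026483970824506302011342919580602579168217678483224061361710098845814824983078497332784188535979641507139214760491451751287862717272784553368713,
      500000000307512530672381463776843499999999525332900914552756907878499999999819471395272282522554332499999999612565250706834942742986499999997951557699723392626089411500000000045439177667394593766134499999998330636155293726239088287499999997141650478504211778444588477594406646553402355318693894020482725132343696693459573430775100499946718289205589065709459864192519829123403652537742601969544988].map (unpackGauss 33 6)
  dual :=
    [473014475077687853274973494776234744873250480881532749734947762347301447507768784455196249684833530831955054460653083195505446064455196249684833457607244944040551268494546898634576072449440405485239445421690148523944542169015265672657534559,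
      504160094973353649688770498384795050212250466704496887704983847950416009497335365048788850528964505461535039840350546153503984035048788850528964496172574992711049895224512015964961725749927110502500514939382050250051493938204985835950187656,
      490710634966602949875355503630774940296149841331515988954921810149513411507427164791360850017552529562404976195749664631487271214803460350767739518957395131390046943607466022534777812150222832481349425000179849350653508658045117072550310664,
      518093974975967048365370501648395191778349232731473731415155622351574497486044815344271549607324460835565074717548830228506516505566498648297534488046084889880652661424495433425637657450801579513680514613427552083272510858344768230650286198,
      515744974860448147373141515562235191778349232731483653705016483951809397497596705566498648297534488302285065165046083556507471755344271549607324563765745080157952661424495433424880460848898806520832725108583451368051461342754768230650286198,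
      499841545000430350045421499911514992967049957800500249175007049950003267499582904997125249979686500305194998643049992615499948935000607349990705500151604999224849998200499140874995395750014102499890435001539749979012499994075000987650008836,
      501620854996293849436687497892894984755550618293501123184988600650490794501141085012274750402725498911225011092149778988499306764976260250175186500300415010651849761027510577505017440350036940502799444979420150265711498840114988942549933183,
      495134115074271651598895492181014940296149841331498753555036307749071063496660294803460350767739496646314872712152956240497619574791360850017552477781215022283246943607466022535189573951313900493506535086580448134942500017985117072550310664,
      500100874999766749952597500101614997402750069177499525975001016150010087499976675000129150043308499838995004334449983899500433445000129150043308500146974998266850027220500610475001469749982668500273394997352750027339499735274998025050003763,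
      504907945011410850112318498860064984755550618293494366874978928950162085499629384976260250175186497789884993067649891122501109215012274750402725501744035003694049761027510577505003004150106518502657114988401150279944497942014988942549933183,
      500032674995829050024917500704994992967049957800500454214999115149984154500043035000607349990705499926154999489350030519499864304997125249979686499539575001410249998200499140875001516049992248499790124999940749989043500153975000987650008836].map (unpackGauss 8 15)
  vanishing :=
    [509401336008682351688891537684145054196623866355514103144545955649775034735156884926827481866682504578622849133349427575167946674990446108309593490402977826977350193995911744925037715799082558500000000000000057116741425187295000000000000000486508209467733350743931268518134927021969039232505101199330288650190961013343694975600167471159509080363407242350771240151869415473503329729958479752483803062952502099886037964961726528950989492897365387571151181925505551454873934134049367,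
      500842171474403349348663220436125057096129721771496893058032409349727443584068424911347917195067506403798363671351325838435251325093905060074590515347852881034750795127811130924932956266232808500000000000000050000000000000005000000000000000569876837646899350341216818941555024321816029467508839781641330254859356742402054970438410089534511001304167379550668452218847245110872617539669492192582512323249759722864021814786395436820578524111745597132351431960529177134847265040588480,
      500632726032640948822468401362984950552916771689480744700148172449758766944869064920355497328011521852370898613651552624039258844899317469462819527069630562898250000000000000004531856270168018500000000000000050000000000000005000000000000000500000000000000050000000000000005558573679574502491699207325929648976791033580525024123305513094503442952780072952206327957616055116011350637984477093085713651750409928625136195217251300790278474139248913663949758766944869065056000421941792,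
      513844185767992346670913234025274678678531652280504748940976715851108205453074995257576108766194476926357053346151411597534514195119791135963445478520521956781349658835302192874697209527524229500000000000000050000000000000005000000000000000500000000000000050000000000000005000000000000000471860891030676249758911496230964906237689582857489381912747169148154108564267695030190194585595500000000000000054136880408777025121669575075312531050189095315450596458406364304803390400052538].map (unpackGauss 16 15)
  inverse :=
    [50042215007102502227649961785016694505729649285935000263494881550370914929701499286050586365036992503504650031284974242500939349280985012345500273950150814989772499344850011574995293496888749946294968164501777250010644988628502314350108255016521500604249920565008347497972750139724977532499832850012074994053,
      50054504978666499679749838775054182497826550291275034820505616549764535052110496625549629584968320496234150456624992340504374950552555041304500977049868205018833501745149996985002155503262749880325023670499649449987695012153498107249995044984482501577149996794995743502048050062495026567500798049919715009323,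
      49543935018469495440750221834790908497441751733454954954496392348572975012877508759349206325033496510985450218285127334490850950626915001512498213150208265004915498520650063274994738499135750024585013573497747750184564999494500657450131915042036501722350010885001825498234650065905004751499111750141004988801,
      49952985030565493563149747644887228495985550815815075863500243949898715019084504468150020614912700499611750459395085514493213451023885023538499538649989814989859501664949952684994737498686350271975015658498555949814245003663501263449945444983912500897150140504989350504037350185955009802501170249983965003915,
      50038955042863500703049963275032188510557749546974894185495363950252525091591504331551526395102489493857749370244926461490240649915214962327501776250066664966513497784049858034991126500292650050315009504501711549908524952531501414950328545021043490011050116065033448498750650260344983351500551349713174970985,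
      50052565050531505843550215705053344511084348713324883693493953450526145079591503063352335065080601493429249353014906072495447449684344949635501953250330894963884496124349864255007760497834449931005007557498798449903724957256503753850399275006236490684650234095032258496077250374014988275497696549634534984113,
      50230394976080499014349738385049029501340349951995051229504281150182115035871497730249829414924000495898550295044978702499779149933435029742500346149850904991392502382049992424991420501933350266115001029501581349748705009044499211049755544969120500177650076864987427501796350098204997630502862049896775000588,
      49528914994902498130550354544858841494026351522905040249497212049195194848086504415548584335095495515923049080125147797503454750442735043334498594250118325055138496285650218085007092497216149906584998020501294150414965023393498122250241525084598508108649572605017959498334849633395020222496627650485125002285,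
      50626854952576502351548846615164567498449749289905097500506521450741885044234496874151568424836234490861050351985021573506703150547634954480504807549619755002739501668149972124990729497403950126575030230500055749529674977882503589349822604980090496858250395305005648507923150860094984719503066449488385017200,
      49990925010247502972450140264952475509277450014754921181493596549737454983882501277150008225090111501055449864274997911494616449790164964493499319450113294994046497189850135404989441500234949733094982832498599050219974997025499181950284385016141500500849913224998194497012949963184988848497413650095044987544,
      49433384713297471444843868535799440424039446239395987233598558849625934976268507406345752623992806485856557283375000921523515951187215333242509061248383064967317529002248899574995551495673750207494966319517469047672044998070514479249625904684352486000050599554910671525815851856725048459524953548383235135541,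
      49202475224492479602053623454292547484841556576574831199456941544956355023212500347046500355642071545109747790805147101492410850886134848670484477250368295194182492938650335055081670498931850252325114795494707950984175111206493628149411865037615521528449194225011829497020747584955108473489550851492755030358,
      51189515035594517229550075445101825513862047635544882198494023451679984966242496452251688735058315494576348774404904919507922849303515104152499768950565504988903505448650046194953133496884350408394960330497302650102274931076502968450212924996035494953949948374984912494634150855214959199503772950244544949270,
      52179905056782540891650239104926707544623047985364617392477743351900205040394510432555108895383850486298446625734942090493307849859425052543505464751947164948734489324950155884930229497534349987205011902499448149775804888029499013350862645100576490995050715865058486484342351830894958553495201049819644866353,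
      49144385024958487164250441914925183480168650967065106056507392149171434961326496986247803274942628509243050645765019395506196050296715049139496490049735705027688503279649912315030262501561150288745005541498903950149545030789498967049597234968599504429249685534990517500834549129025044294503211250299135034685,
      48943674978356488472850033554963883485375950735835078042503062549093634968229499763348231624933454506531150824474998722500082149969305018263496782849715705013608500268149901615018853501154049956234987512499325550159055043727498764249864764990415503179049740374977852502381849008765016261502732250168335038342,
      48930604715206497889946370294603759506199053781905378840521863748096914676616510818749725784955511504355849796985628937514573951452645174864498904151276885025990506130050184934859737496437649330264983726499749050608705019607492592149914065121458510257750509355025602498536751054484947732492954550649744971369,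
      49206954684333487322145023104858243492087751489925648533527380349795874830251496273550253094601064490907351690355561144524250651447405163183503045050537315006035514549749837014868099499580749704625027998498624549475265060730497170649502694971588510190650734524976742512916451140734930039497157150376935030565,
      50560004848699488251549424484973453455650350579335429156521586450094904913353478545345663524574330512957253827835101354531104650010815062491495024449127965059088516539350183795003591502433550593624979150489885950146025132617497837249358094844392519612249958624879864510661049206815019995504999150737075082762,
      50851694949265509092850808765071466494917149511885030818508570450719464991727487955649209944960932501389851269724963674514448449781664956566501055650627105017447502716049941184997458503593549923945023912493497749917875083453495918750274794952941508800750230314947329500384249433025039318500469349902954994803,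
      50566735099596488387847370615262282478182448568365450810490853951594445149083501376553991264383513472440750775364740673518489450132775056842509728549624944877234501784149815245002155480284150944925090849494940848943664864572511363749382164958668475172451312925032050501636852311894943085498803648925835005859,
      47893044934912551550650783944980409540911446713884449366483625946874054823386518419553369496008573517739647011045073371452837549528734955588500153551504305100661485587850338485011536502823146943804997017507579552550314997308498774052184695280926517521348526215116148468088948152325093226492806950895194886595].map (unpackGauss 7 22)
  choice :=
    [(0, 0), (0, 1), (0, 2), (1, 0), (1, 1), (1, 2), (2, 0), (2, 1), (2, 2), (3, 0), (3, 1),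
      (3, 2), (0, 3), (0, 4), (1, 3), (1, 4), (2, 3), (2, 4), (2, 5), (3, 3), (3, 4), (3, 5)]

/-- Data for a second solution fixed by the exchange of the variables. -/
noncomputable def certificateC : CertificateData where
  points :=
    [500000001413535061410260692115278499999990517663439536628050348391500000014737664862826494975448497500000006858510262074126983930316499999984321355018348826372304313500000017133794528862299614982933500000020261760337518988131896737500000007362884266439635955114205501864836883202751487933845324772511807246561059597410281353826846511529322368715721477467137266187491709336331093699266687825874498,
      500000008056436305105181601357744499999992595373123798618366693067500000028351907353543083692070829499999995041078365277092358645181499999998859525522933748282351004499999982446648420825151232978540500000011686746192920466646705737499999984762740775767133279540581486431146291920065406587764012393495949190505803189412233497311875492176073165681777758206837987660503271660085248079413227199110854,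
      499999999878191762656210205896053499999996589721951673357458670210500000002630780618305727111703665500000005236514083774533382626868499999991026314515242362552510007500000005017301032510853481256904499999994670544746354237597542700500000003975147121838520229756654489000737918258961759019022712029491903424020711934984523844985668498272564195325578599963702116578518783466054666219390570158474534,
      499999987025215042460618347318291499999972081870446670436629656953499999987190107226539959754212933499999942553594417042639951656862499999987190107226539959754212933499999942553594417042639951656862500000011310793703728772643120383499999961721983832345563484408332508784723160485330146591656673193497607510834699838246124477760580508784723160485330146591656673193497607510834699838246124477760580,
      500000003016084467909272808398940500000000837033345875877896617824500000003304734757105606246911663499999999910405696792549723817573500000003304734757105606246911663499999999910405696792549723817573500000022327983360392950194741099500000003317715533880519961490476493986464264963849925254005620255514045825155570401123886901543590493986464264963849925254005620255514045825155570401123886901543590,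
      499999953627502805434085932180433499999962573662703234895927304737500000072605781048789686603006117500000042688308306890131975443004500000063992989590159865362575414499999962443967756627344352936563499999794049980038086999735356169499999653145501818120626009798253500289894880006821497831437246926503108222888877087242580380082443502594731692786390706619444398343494213000029139520091739387971152,
      499999999878191762656210205896053499999996589721951673357458670210499999991026314515242362552510007500000005017301032510853481256904500000002630780618305727111703665500000005236514083774533382626868499999994670544746354237597542700500000003975147121838520229756654498272564195325578599963702116578518783466054666219390570158474534489000737918258961759019022712029491903424020711934984523844985668,
      499999953627502805434085932180433499999962573662703234895927304737500000063992989590159865362575414499999962443967756627344352936563500000072605781048789686603006117500000042688308306890131975443004499999794049980038086999735356169499999653145501818120626009798253502594731692786390706619444398343494213000029139520091739387971152500289894880006821497831437246926503108222888877087242580380082443,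
      500000001413535061410260692115278499999990517663439536628050348391499999984321355018348826372304313500000017133794528862299614982933500000014737664862826494975448497500000006858510262074126983930316500000020261760337518988131896737500000007362884266439635955114205511529322368715721477467137266187491709336331093699266687825874498501864836883202751487933845324772511807246561059597410281353826846,
      500000008056436305105181601357744499999992595373123798618366693067499999998859525522933748282351004499999982446648420825151232978540500000028351907353543083692070829499999995041078365277092358645181500000011686746192920466646705737499999984762740775767133279540581492176073165681777758206837987660503271660085248079413227199110854486431146291920065406587764012393495949190505803189412233497311875,
      500000084007368620418631981183753500000242528253770966685867692413499999852978839486204639046905559500000040669877129323276941725255499999852978839486204639046905559500000040669877129323276941725255500000325023160306116892939135831500000736467752669442085605681808501004652198613899957365763447674498152220638917523539260936500394501004652198613899957365763447674498152220638917523539260936500394].map (unpackGauss 33 6)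
  dual :=
    [498351655005138149862764496149745063430350209040497930825025005249790483499144604995849450166015493453924960118950509498495981495019619550583599496132795027167350301441497842975019646750022196497295335004250750296854500668444999460250017083,
      507210565015921550249196505396665032090049866273496626375001762549866458498488434966037950373463495720605006273749775894499622585001520049731044497911384941463650425648493196115028178849817866503573154985226150238201500307325005557550044433,
      499834614992497750066575499505004976815550038102500877494981933850024681501621334995400450070872498382464986740850277041498827875003186750265777498320515000607349972437499923315005008350094711499436934996340850034506500435255000125350003291,
      499151895001362349688810503772794915181949747006496888105037727949915189500136235074881850316761509629115122797250962911512279725074881850316761505895204868300950664903480223335058952048683009492394134970894249239413497089424953525449819375,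
      501867945004537450105158500516055048745650006534501051585005160550186794500453745010005650028705501462945006347050146294500634705010005650028705502506785000640950528888501306475025067850006409500400715011139450040071501113944997283250010466,
      518192955042831349357250520858634821778344049566505649195041529152501383510160934923620348848335507559985413742349300048521572114776323146057539523741295295378742984999411547725352472153616253504687565529814947107006457210134937718550008468,
      500246815016213350087749498193384976815550038102500665754995050049983461499249775003186750265777502770414988278749838246498674084995400450070872500500835009471149972437499923314983205150006073500345065004352549943693499634085000125350003291,
      525013835101609350564919504152914821778344049566493572505208586351819295504283134776323146057539493000485215721150755998541374234923620348848335535247215361625342984999411547725237412952953787471070064572101350468756552981494937718550008468,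
      497904834991446049793082502500525063430350209040498627644961497449835165500513815019619550583599505094984959814949345392496011894995849450166015501964675002219650301441497842974961327950271673502968545006684449729533500425074999460250017083,
      498664584984884349662637500176255032090049866273502491965053966650721056501592155001520049731044497758944996225849572060500627374966037950373463502817884981786650425648493196114979113849414636502382015003073250357315498522615005557550044433,
      456744314867852850720481471610835272232361992582507204814716108345674431486785285225426053342970495852464274735049585246427473505225426053342970438066514501627861274575714878364380665145016278519011234801168751901123480116875163468259450929].map (unpackGauss 8 15)
  vanishing :=
    [508562911419353848860967566026425000000000000000561403923457312847660273936862325009860992589009500000000000000050865591915288944958898401123386466749247648176752574283066485694928599272572406502131818401807947708762422269635070815097009153491326709738609349157751284315065034071320826936503350953171389854453814583244465147370888773730500880371071132050427551607432324895842271881083487149693235615549505303756180115115712729467125488231803621465550258325463063444953866882688022,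
      494629121343575046803572078600255000000000000000500000000000000047969825115947265008556360422463500000000000000056079076311060905092345208438554493229320398033648782707141947755044581636445102506849389785499649450169134418715011449936627926478091499415144352720175051276494923027723936336503841502723146948313743974277405127873378744062500763895938681850277596697152475464704642687346513517724284374748881749647551164853724610354360496678798946706950224148405783624959970400994621,
      491540091223745747824408677437795000000000000000500000000000000048304859696183624926674847055049500000000000000050000000000000004963411831671832472546676510251050967785509676435132991558400237478850228059364252232609956384654908529579179580514183882786821749437200840652815046885170612876492682366334366450030481402796485149264712865176498338678843839548308018244749145076320953006903500000000000000055114392175193445000000000000000555211461007462948912339221677495196489940574719,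
      522322189623649649951605182380915000000000000000500000000000000049952026428306984964200897436288500000000000000050000000000000004847031975174125493493073323408149739368275084664563644509138462529069687416073551486987691453874617579937935311483732683308520350000000000000005461272801861805469406395034824948698614664681625017828943415069502334044706357852682052148526565097519352176288482176142237966451071983157001055000000000000000500000000000000049561078840933975001576863936689].map (unpackGauss 16 15)
  inverse :=
    [49493264863010491140449114954981279497601249902125171956495825848681625056542502765849142105016461498227750535535034031495137650137885092791499539149728385048150494809449829834967709506053549571154913264505136249839125004941495652150172784999055495883750043695032827499863350118225062798501465650122564992567,
      50857655011529503590549063544999974499435648577154989873512868249722274964500503940449871564934187494673349885805062157502568449029794979059503398249915635022176504206150261724983671502580750575504969445492779149999374986588499079149710735035677501587349733644998199498883349889854975683505480750008475002987,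
      48471184933118491479048687974975757498147249656925083287505883949591034991165500133449712564934192492063450683795056126494835749886394986194500324749417375001326499890649888984970529502323749967914952376500582950017405000404493002450211795003041500447549949675007712492711749770635052178498617250012604973159,
      49284885105606499788650365095020348502271651839214970975492965750282084986472499434849648574941099512693449890464940545500004050181634894230494667349540514957247502773649780605022706499165150030054996595503104950147094993929500402350483654953465499601750075844976164499492850009964995336497858249893074974960,
      51442214733163508106448019735039079496132647094664997341517444150625385067863507439651094484956669485198050460885157532505777249473845102780510103250025995074790494638950349224943537506036450174494908343493086049676354992069497789548849035039367496876949678725027053498627349867955066882505305650528895022703,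
      50353585195205498672350755984963691503213351018624887515494606850228604915770503189949529605045440500957049355964915338496299849779084933859496439950410385017131505170850152075026898497627750210055051343496388050144444983968505098850367675015031503532849882904981739497808449931224939863500709449536395019898,
      49811934984894493708549898344995818499603549578825027876498524449850314995252500759950129255009233499765550246965004130498515750123255017697499094350069835004552499259649965684996176501137450119644991592502264950044895001942499670449952245004410498377249973365011815499869149929305011546499393849985065005377,
      50505825011274501824350330035005405500668149773984963849496221050168184996070500491950125325014039500226749840044999416502694450133785007048500146350139715014461499218250046785002470499548550210125006523500951450047264999948501080949962864999169499367449988975003657500599349830794996552499427549971525012455,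
      48694694876953501464151486594980953498636049863485052313506601349223715029331497130551524615091539493988451546545034882506017351979065044025504527050295444934500497249449987604992709506081349380195020562501048850212885002223496220650331025013029492691950511735039078499806649244364988435496368250555175016542,
      49741944825910513515251285465014075499759450160014961680500173349824295027875496462252044045021784501304150466684968383515931651558565099107506805350208784949863494096650060005000313501521049832295055584496293650218325000244498671449743465003413492052450477495010868501126949225294962310502212050584885041020,
      50852154992787508909850250834971022505213249936104908803501168550575145031476500638849830745004055496489449376104992155506592650082735011549498957150417895000428501156450250654992447500488050444895003571497902049961534986892498551449941775010158501935050027744984664502373850042064988508501282549967544984623,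
      48911695028876487872750075625014073490466150328025074878498584549620304983012509021849965875015731501263950193434950140493518249731195018741499762249468534979800499154749669625017516496366549707145003696501406050052874995530500455649753884991744500715050028185035421499482450253155009359498132150064555011468,
      50092074951821495071147644525027577500362049230585031567503820549451174904552502406749767804943598492281549569625006360492691549414965039770498243949285145035153497372249835424967308503419449821114957864501593250076494995281493834550020434971116498800849557535022273500640450359755047389503543149818714984726,
      49789665139266480913653404555000994502836152412585045652484501549922865082936507402249687755095257514053050633034846041506011651305624965245489060350658274923764498149349588065061212494692349496895074694504928449950284992964506066550569294989526500315150568905018663504840249765604976181488419149756485029983,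
      50973324990193513135549772015012790511131649609004927145499993350398355017775506960449716065015827495111949336125008724502179249895925006437502396850093674985694505527550301874981200500223050048624983038496178549928284988595501042949804994994233502853250059935006360499314650044455003781497920250037005036684,
      49383024984159489038249910375035016494278850200255086911501295549416315006701500668450131405020229499461950646974966411493986149821375013308499352449840615024970496835249718035005693499965849829494989005504595850037414994483498719150099695025543500498549963964986939500843750209644989005499482850022894982649,
      49827605039813488965850332875005852502433951564044967682488112850205454968933503539749114574980878506334750347054933588498574249960474938465495021449568824992111501065849714155012542496242449484365033227506264250102954992855497089750520234990243499317350045935003211503189350234404989309496980949737494998638,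
      50314035069862510055251634445037249500933749727044832089502531951163315056486501492050161495084315504578549495414984398506609849198645009443495513850860555002178499729250142355036065494575950530445063949495351349922184992814506230450203135004776500926850115184988014500791749613144956762501877250060535031451,
      49974074994366509258348371634976700498222749226435032536512239449705314984086500574450000884896831494609350083435128227497424549568274941692504896649814355048747504584350212204973039497959150203454996746497664650020354991702500194249793574994412499416849883454978570495327249930385003268504802250060014972872,
      50771545094602516184550892015021172502027450803164909134496012850148104993091498981249999414976693505961849581494919825506575049794554927570499140750175205000468504584650107525026817495649550056155040965498676350089704991068505122849856794937709497430650019574972340501036650024814920449501773449951955003851,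
      47848834942614476371949346225019894480445349655415184915506127648948134972130505185449975655018812495983250946485006128490571650158435030619499448649406494983999495056149670024997302502113449598074968055504528949988575003985495269149983525001475499128250035585027975500374250190755040639499265450039364977489,
      51968135020357525227451001864992900520020650319914813590494483850907045041174501648950213485016971500641049040064962467509801949984535005334502324050649034996236504035250316325003642498326250271885037666494946549934054992515504002549939575010374501911750033954973770500718949903344953691500105750040785024523].map (unpackGauss 7 22)
  choice :=
    [(0, 0), (0, 1), (0, 2), (1, 0), (1, 1), (1, 2), (2, 0), (2, 1), (2, 2), (3, 0), (3, 1),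
      (3, 2), (0, 4), (0, 5), (1, 4), (1, 5), (2, 3), (2, 4), (2, 5), (3, 3), (3, 4), (3, 5)]

/-- Data for a third solution fixed by the exchange of the variables. -/
noncomputable def certificateD : CertificateData where
  points :=
    [499999957590434898121570309001514500000007206401357203848521501059500000061121485517480343942449094499999942505678696020950765637696499999988357760244652413395321903500000034613796739030847964294291499999912139242678681336342174491499999965691830155794309432218243498188500232870963645837388056113494207499833818960443090180120526491848762946387663175635626172128505120233641645382804168470079114,
      500000006694752135593893860274186499999985212315591910877786792792500000002900541226237872335342953499999982548443377829806020791588500000002900541226237872335342953499999982548443377829806020791588500000012261793879491147266862827499999998917733975973723564488076488336245972935253213049093358230496909404489263657494944183919858488336245972935253213049093358230496909404489263657494944183919858,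
      500000018811745266927866097067816499999978505424003260063140980924500000017882114838189635099272236500000072562152235502867421659863499999959167876502886180627361969500000011629778261838365711650788499999982592386459285382237280980499999933795517258248702341459430503101789620962936434393511326177510811796343956579630552709334538503283043674851413005962915387802495663549202799672693630496956857,
      500000001127202593474862555623503500000003864546891117215890161892499999986734960852524234952241963499999994713466041121453466066902500000012481395010386115376419825500000015182321925137737045863944500000008739506880545564497027954499999980802136245683590079269151498266798908195089321779604858650505881111562034367688490303547214516510829175070997504527071659469503514856724930209806314783487267,
      500000000814617067591597374750760499999999924650842488714059248946499999997568946725618738360197986500000000994076847835354864165772500000001788894879627493146571361499999999224405155456690545205458500000003040529745167907756870529499999996840798271722710079775502502629796295522483659778215468857478388681659200718501053161616312478625948823158479567509443956874512661176327546446439369197154646,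
      499999957590434898121570309001514500000007206401357203848521501059499999988357760244652413395321903500000034613796739030847964294291500000061121485517480343942449094499999942505678696020950765637696499999912139242678681336342174491499999965691830155794309432218243491848762946387663175635626172128505120233641645382804168470079114498188500232870963645837388056113494207499833818960443090180120526,
      500000020394856378791209152501495499999991478189078677702945193182500000025953537056865064686722338499999978726209382315205118722145500000025953537056865064686722338499999978726209382315205118722145500000016814315170818583420253872499999975176606612634492137370217507953929216046858539747199250414493903887210505249637794461463727507953929216046858539747199250414493903887210505249637794461463727,
      500000001127202593474862555623503500000003864546891117215890161892500000012481395010386115376419825500000015182321925137737045863944499999986734960852524234952241963499999994713466041121453466066902500000008739506880545564497027954499999980802136245683590079269151516510829175070997504527071659469503514856724930209806314783487267498266798908195089321779604858650505881111562034367688490303547214,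
      500000018811745266927866097067816499999978505424003260063140980924499999959167876502886180627361969500000011629778261838365711650788500000017882114838189635099272236500000072562152235502867421659863499999982592386459285382237280980499999933795517258248702341459430503283043674851413005962915387802495663549202799672693630496956857503101789620962936434393511326177510811796343956579630552709334538,
      500000016222391833383104314337133500000144307449141271736044228383499999946042487145531908078098373499999967299671337910721075941551499999946042487145531908078098373499999967299671337910721075941551500000157900559422329887646175392500000271645095548493160432697056499764206482728435060786231626543504391405758453556853255021616140499764206482728435060786231626543504391405758453556853255021616140,
      500000000814617067591597374750760499999999924650842488714059248946500000001788894879627493146571361499999999224405155456690545205458499999997568946725618738360197986500000000994076847835354864165772500000003040529745167907756870529499999996840798271722710079775502478625948823158479567509443956874512661176327546446439369197154646502629796295522483659778215468857478388681659200718501053161616312].map (unpackGauss 33 6)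
  dual :=
    [499178824908899750838756497791514837123250203188494251444963791549145427497389975089541450480233494373515039657649780930497865784971240448333228492444335109888946931821486746735197968248711461505347494816971851602097508769144943504150859428,
      503613735008633950212205503257495065096850215681502122055032574950361373500863394975072450418361497538025041716849753802504171684975072450418361497592524963829350211398493118454975925249638293501299875005200450129987500520044995952650046109,
      497472455072079049998852491973395022377949275664498087304907273650142645500755684887014250560867494163134831767950507748505313384954165749231491485681055093356249699941475179335043857150505356498051835123280849652280494802995059303350124967,
      499748895011278849799870497021095007828449692855502854864978965150399200504085364986913849806961501838525015518249673057496906025035850549618808501312515005582850244870496343674973162049771243498885574991608949732422500813535009549350177856,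
      500142785004175649927005499989365009110849908004500344695004681650002113499835924994918349973697500634875000332649943829500155855004398349980880500092354997971750064335499567484996077050041229499825205002866149972969500095215001029349990294,
      491454274973899749425144496379154837123250203188508387564977915149917882490889974971240448333228497809304978657849437351503965765089541450480233519796824871146146931821486746734924443351098889516020975087691450534749481697184943504150859428,
      501414674988704349614141494567104975273649058738496141414945671050141467498870434973545250361004494014015059392349401401505939234973545250361004507677204947344451352528493390895076772049473444493353914968324549335391496832455015786350530737,
      503992005040853650285486497896515007828449692855497998704970210949974889501127885035850549618808496730574969060250183852501551824986913849806961497316204977124350244870496343675013125150055828497324225008135349888557499160895009549350177856,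
      501426455007556849808730490727365022377949275664499988524919733949747245507207904954165749231491505077485053133849416313483176794887014250560867504385715050535649699941475179334856810550933562496522804948029949805183512328085059303350124967,
      494939475013189350898812521894225228126052736869508988125218942249493947501318935120214050757284514778515135977051477851513597705120214050757284497927374992476354411628600881024979273749924763493793435165751049379343516575104961489255857211,
      500021134998359250034469500468165009110849908004499270054999893650014278500417565004398349980880499438295001558550063487500033264994918349973697499607705004122950064335499567485000923549979717499729695000952149982520500286615001029349990294].map (unpackGauss 8 15)
  vanishing :=
    [488251604339871751078240801092565116194794180763477001630813200549096908769840045111229707406704498689640581903350420872292790594986439659651596523438700909228549680524788785064776828208681742500000000000000050786203736481175000000000000000566702691168797550561351985293015022314507861386511167468073129552928299189547515078215284312093498919893432173249477350869519395130442171747556520891018851643948306195529709264906405773066578528402328450616949459723930957144809943782221396,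
      500028914126534852232341973186414973012772221835506968040075386949197761224806815098808161628637511856574748805447634064204039674883300896185965508076056632217350603212276047545048960350890925500000000000000056623773378999535000000000000000500000000000000049611652978429244772613045364368493411307095049050966005895279275069480614795480499040514024371651186621279098375279402711443483488095235040303353061214759982675221485734134890479571865537584249520059106521994831168256011577,
      506233756636839447744450116839835000000000000000489756685048749449095407383064015145186760006852500000000000000055229488092262075131264354097933520693297840471852470839572190285224791113424372500000000000000050000000000000005000000000000000500000000000000048868287444383404746472270048917504375478469931149665445099557345023502910864915486918154825650450207791887894655447763813120868489610405605267748529761713004884781226076503446475754485217130951104097907924525102081835216786,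
      514630899169472851659671633417995000000000000000551281859068490948896849855063865177055165326096500000000000000050000000000000005089788432299013481132330692288849339470408874874786365071892303500000000000000050000000000000005000000000000000500000000000000052293594171538005178590641770504502992947743300454499263596592065028661785472971484046697784250050487696638982435055322387780600475615168050878747233880610970014850352612834979480164256444361051346446725683175124488735820307].map (unpackGauss 16 15)
  inverse :=
    [49735004974297495765249978265055032504211748924274948225507056149522885051374492836349648795046461499153950783585059602504906449226694986620496599049855324996853503971150026304995726498963749564475013490500376749894954968850502547249548945011213497793149835674983287499107350148934966791502162850223775009193,
      50486025036391512754849552254901903498507952337754998651494498251363105007031513585950043674938920491757648476224776403502565451390634898558500568750208504971985493240649695235009073507381050574975012098501379450660745010656497078150541894987994505438250377044990536501510449895025053782494312349678395034478,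
      49868514991513505834749897774940918497380450187285017005494133649923435001131504293950192594991126498273649665004916299499181050419064989028500487649955854989593497044449939115009316500925349877955022705497685750086584998344499194850110075002366500165450023284993457501398649951005017844499467050054125010113,
      49475654981825500684149929034996314498061249641245007742493267449666394970473498418050220254997912502830250360544995417496841050001475010364502022749715165010029498716750072975000201498534749755495002969499806149923335009460501744149945125014837499383750050995010814500445350010144993653501035350029504994695,
      49938054974690489598249866655044967500559848495614942819502307249549864945433494261449680315015935505550951308505108237495208749286675011173502959649997705031445504834550227694988104495091049351754974647501009749783415017584501450049731225013564499026050084415028975496706350005454935883501036149895504986851,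
      49735615026554506291551072095020784497014650264205138398496359449947574930049505767350323395002602507486148748954955779486706650654345067656497452249761715027966494792649734264988175497814850506214996127503651350198435024713495869549850324964645500269450172224996032504868450134915064327501997749815955000388,
      51284715072035542823747776304884248494419954477004888094496542652758475103624519904150905324832018464291848247594682399544383451596134673510498709650773744790305492803049551005035912516515650391645135310494310550256514906771488962651326975034143511649549347324944489501756949048755060385486056350305095066908,
      49036325039523491288753538355111488485367947899395386609473840348133154726386492346950887485144807534641549312205008956452841750367265248310500189649736445153305495345550328444934137482706850382494963721508883549918215108021495190548399574898960494444450545805022089503754150574365047278509491649574194976660,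
      52598115215949582928749948214561869482968558846715313226428288957494044569342537375552213264705436496305740392794191346487940856812504804786498761650531085003387473225848676854975706504064253658864994092509915552640975126859468025951319824871739520583251733395009223508448249016015242763485103947808515094267,
      47121645120914461902757535885446217470914142449695643540474566840184994857838443929051640005373903581060354914005415182437393248076205651249495014449535925240897512074850591264903054467335248471234970318496675147732405121110502212646283934908081477778049119125105107507046951344455029992529562950624484797230,
      49619034957871477925350253505091976502967148145804997147503472648434975024631487541250109185023574503044851518575152917493091748911505047219500637650002875073494506046850588245012227497015849310144991119500918349571715006810505482249371105018443498318849636195035353499441650472994972765505257450336514994666,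
      50189855044143511949450458134958072496318850628155038536489629050622864932211503856950099494957833505754349215574946036499865950340585025172501261350114724983176495445649902134968617499427150382044968679499434350046375001910496570150240794988133502010650241585011099500722149806345024242495696349863194984487,
      50176194968116494902249862085052280498938049753325025223501753449731935005243498994649923525007063499998650022925041809496162849844495024465500619349867385004385500204650016834995134499962349723035005390498558649894044993253500962549903415010132498944749961955006687499477650062034975946501074849951954997016,
      50532764992715500482549583505000319497497050429665003201502015850236775007864502356049940894999608497381549669354977168499687850136624982051500614549862665000843497024249899394992430500324450048305006146499242050037254996550497492050119174993678500729949956774996249500722649907875008942499114049956555006288,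
      50922084967679511382146477494888106514724851970834615506514181651309155237060502737349372134901592462559250119554882099541416849893734807791499445250779974830790503234549984125093028515744149369565035733496666250338104914254505885751008025042948507589949512834974219490523749560194956665484784250491815019184,
      49876324891629468805951619665234169498212644799595168781503821748760784761336487090849505365012397531663452029235384098469651048831935175465509161549301105159429505356250163604915611476786449405684954996506820449509455053477505594048478045030456488989850379895072985504102350992484892466512056049387834952762,
      50374115003340496413848938824994164505377349574864859490510639849801205051728492114749726585004674493838850996435128833510944849371034944510500168050256064973581504497350142535021918502818349417824979295496671749700544983563506804650195205053213501516149796945000853497247350050304964721498672750149334996105,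
      50026615007771514193750294794960321496919751292735058679490705350095975006336508970350432164965070492140449084154836530503103150774544971437498129750193714957658493638549832205014913503580250454315038639501247250265704984891493473150114374965583500370949886284983527500591249915495010517497337450071505027223,
      49992875002985506555350021144975072499205150398875061051495712950277454968111504894549907794981652501615649730494968823498904950385355064922500132349931834992152498922549821044996732500312950271965004911500045350089735018870498328350154844981286499752950046585002871500542950100965014259502222749971815005418,
      49934575006523497532349477095010360500104049490084969175504323450030015011007501316249892255061114499405450469445060703502433149421314994824500327949983345003328502533450052945017864499134249893455000685498798849806934993100501636650223645007362500820149966525005041498309750001664984039501656650042935003489,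
      53010874949097555381143772564622023533627456433504304286519784957453985432284562241848462934830924463321846416324649678549856351655004591341501807949910474669914484099447892145099774524204551249225015093498443651023984881210504061753197605067370517730850723954786255491225648141735030278464683049198865080475,
      48237294836577422534948576335493786519130640949914760053545121543954085240887426386549783225159683484976854821955571559514114945599165067582499487050447915037429536920152330645119643500447847180234979895498041148185184951328525618848278175121580488673147619485092523490124751868404692445511946451463005020270].map (unpackGauss 7 22)
  choice :=
    [(0, 0), (0, 1), (0, 2), (1, 0), (1, 1), (1, 2), (2, 0), (2, 1), (2, 2), (3, 0), (3, 1),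
      (3, 2), (0, 3), (0, 4), (0, 5), (1, 3), (1, 4), (1, 5), (2, 4), (2, 5), (3, 3), (3, 4)]

/-- Data for a fourth solution fixed by the exchange of the variables. -/
noncomputable def certificateE : CertificateData where
  points :=
    [500000002863069337946379022722438499999997105522158123242142123268499999998398487159186587305948475499999993608488105911565539811729499999998398487159186587305948475499999993608488105911565539811729500000015538538109697158872259278499999987509086176463059306516462490482795437575751780603703810277512185113624950032041085970479993490482795437575751780603703810277512185113624950032041085970479993,
      500000014107615769034718124790004499999991916597115084590768499138499999999132357759820049479683840499999971639384283423165057005854500000034178401888277193058885721499999996471633143124104787745133500000020990698414683100900486763499999989263398591832459582201663492405726691635250464047438724518504059729006593343614259147676414487443304155727448171610755399330497177772967419597313926714683044,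
      500000002760172150110908605246243499999999110268889628587216836104499999998830092423976832463934175500000002173440592256637001060753500000000050425730966132420872482500000002265349869693968771989134500000022786546486673217388388529499999999662887841099718974427909513641582890952619446660234881441498276538427788061635171227347033492848281416048901374312635369349486814581490130476753532670338223,
      499999999892895366915134117022083499999983517754411841290365344384500000000225738484145309364058130499999960233530310636215265863970500000000225738484145309364058130499999960233530310636215265863970500000010518048820536660767592796500000003893173577750314665897328509845152638683643031965119166919496125206601107713693504004247051509845152638683643031965119166919496125206601107713693504004247051,
      500000005159083917660483975109537499999980854038873720975151598920500000030489105729061559582327332500000023628901726616883926618773499999969147343317466653082632325500000007240901745056630751406411500000006765364141995833182580835499999968724937573178591536171979502782380026334257603270972852598509118539156627805389239443965214508222030243328780904628495532260491917202059803939119493052644678,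
      500000005159083917660483975109537499999980854038873720975151598920499999969147343317466653082632325500000007240901745056630751406411500000030489105729061559582327332500000023628901726616883926618773500000006765364141995833182580835499999968724937573178591536171979508222030243328780904628495532260491917202059803939119493052644678502782380026334257603270972852598509118539156627805389239443965214,
      500000002760172150110908605246243499999999110268889628587216836104500000000050425730966132420872482500000002265349869693968771989134499999998830092423976832463934175500000002173440592256637001060753500000022786546486673217388388529499999999662887841099718974427909492848281416048901374312635369349486814581490130476753532670338223513641582890952619446660234881441498276538427788061635171227347033,
      499999996120286842709565119202649499999988001859750456725812755650500000013293690406199198191040972500000014754888921314096110677277499999980820435061038339560960658500000025705892025059036867063818499999999681960368407505738624789499999998466975327474043131118892493389709900502631287871610560160494089797716499116844127235964214497801803874732786259445723194176513614179927030442177719641593435,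
      499999996120286842709565119202649499999988001859750456725812755650499999980820435061038339560960658500000025705892025059036867063818500000013293690406199198191040972500000014754888921314096110677277499999999681960368407505738624789499999998466975327474043131118892497801803874732786259445723194176513614179927030442177719641593435493389709900502631287871610560160494089797716499116844127235964214,
      500000014107615769034718124790004499999991916597115084590768499138500000034178401888277193058885721499999996471633143124104787745133499999999132357759820049479683840499999971639384283423165057005854500000020990698414683100900486763499999989263398591832459582201663487443304155727448171610755399330497177772967419597313926714683044492405726691635250464047438724518504059729006593343614259147676414,
      499999960949717936107135211558612500000199611194172253709593152725499999975433922039862145489655889500000002277589276907695920757148499999975433922039862145489655889500000002277589276907695920757148499999873494274246246865939986093500000096361341578616999579745325500344631185312526640849067325213499314785464776768460699497194796500344631185312526640849067325213499314785464776768460699497194796].map (unpackGauss 33 6)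
  dual :=
    [501390424977466450146421499764835026577749648127501464214997648350139042497746645007651850013463502205284995315150220528499531515007651850013463500782894968382550434632497138645007828949683825501317055010132050131705501013205000471050023615,
      498419054961331849636709499690455045391249922273503121635077271750873413502464025001056749744491500241604999984349572702498973404947372350517933503867254961739150853478494096855004103149031838503497525025934950553089499297045004157350044398,
      498956145008405049879960497166855045281850092546499552785028749849877063500204725016002749991077498044955015103449959765497023205011839749988012498701534972096650547297499010544985125250383747498491594995536650187164498854565000714449989061,
      499118354987954449715378500944184926343549989629497153785009441849911835498795445040738750603102504829315094720050482931509472005040738750603102505549864914378450855080496019285055498649143784496820084984505849682008498450584994898449956051,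
      498907825008009049802095497020875097106749786258496926225044329350039100497818204980546849898121496580954954642650574843499457764939337550477241491906965046436749767780484623085110831250580787499503185065736949446024496071744994697149998457,
      500391004978182049692622504432935097106749786258498020954970208749890782500800904939337550477241505748434994577649658095495464264980546849898121511083125058078749767780484623084919069650464367494460244960717449950318506573694994697149998457,
      498770635002047249955278502874985045281850092546498799604971668549895614500840505011839749988012499597654970232049804495501510345016002749991077498512525038374750547297499010544987015349720966501871644988545649849159499553665000714449989061,
      498257404992537550011281496148404961064650042536500980854969119650169809505996205020276150087592494244015010472650354637492966335031134550631148493241865005178050116399495214435018753850800879500754404984900449984417500755145000973649997483,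
      501698095059962050098085496911964961064650042536500112814961484049825740499253755031134550631148503546374929663349424401501047265020276150087592501875385080087950116399495214434932418650051780499844175007551450075440498490045000973649997483,
      508734135024640250312163507727175045391249922273496367094996904549841905496133184947372350517933495727024989734050024160499998435001056749744491500410314903183850853478494096855038672549617391505530894992970450349752502593495004157350044398,
      496485115008831350806336498012054749641150617159508063364980120549648511500883135003959648043389499920055017496749992005501749675003959648043389495464735043426946138708561575194954647350434269495922814942204749592281494220475003545559890378].map (unpackGauss 8 15)
  vanishing :=
    [492809271816782849893703532595314899202222269474482592305804104249677196609781235042243428548326507083086253520350586667842759414968843822710317477103687036704250991810842843784962564617454732492647808922237550211551902453054770912890180004533956101898245449054058066121775044448625853979473609208995958249759760274850255029986893573599495424994979731949978471614060625069227028859321500000000000000049731527537883785000000000000000578205617066885749745999973229575052763293511392,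
      496635548335875447705367154467555067410303159990505272196319418349665918162677905043719374244010490157576578883948278355566687724926980117110417498149936172798849087568189660355043188960941679476825235708014453404879454878714918565747516029503283134911124350959903335879674964069318497620498878084054081550684426498443415031034607455209495265148603634047358624982951864978339758809605500000000000000057815952145785495000000000000000500000000000000049737125450987925054606793402959,
      531786340940977750501608821634135172445901423234504480587114269650006453590323424937380877539970464600088889151449764856052595954809487078943345493744521513283150000000000000004497289542353570526365985686171350901306132979264782386549493214491082184454612350000000000000005544677619760531496386596073315849645021725510554999354640967658504163554140297949277285966025815053292974846017500000000000000050000000000000005000000000000000500000000000000050006453590323425000331620711122,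
      498230100931755547300385095296255000000000000000550830217671943346887687082250994968266703253373502322688766694354046090361422275014047779299171463075738674060452087833577599795019115824946471499059285479430349320098280374035035119448247928483934673193066050000000000000005000000000000000502809555859834352781191269200745206839612894911502217538427339150110557939689975269295091343705500000000000000050000000000000005000000000000000500000000000000050019437448650674996940440673079].map (unpackGauss 16 15)
  inverse :=
    [50743945099048507802050816095063013483165850846695210838493364850715625063616491896950171145019946498441849888285056276493052449947364983105501669449557055009877494288850502545053886507315550526534946905496854250365484995338506800449761405050267498533350121674987320505947549952335001681505337350200904994445,
      49850055133538512797951191684939832475895649965505144179508059249251685044928492145650090455027105499498049858145051850491029349855724988092501931149258324997793498900750494525063580502745950232444916088494345049886874986931500340650528385061775499441650204954994013505017949835095065922497631850114704987518,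
      50468804945832496079549740584941637505509550370754916385497496949836734987260502827850768745004148501737549999425005277499444349914184998855497026249956704983228502406349965834967255499568049642895023151502905550025144996362494351049898774997850503945150000655015130496683749880735058604499267050042434991694,
      49239754995352501462849803174953217499467250552404977341512138849752104986629498415950417705002216500780250054935004454496037149933154992372501179249949754923183500026250009154990633497914449702654980789503385849811524989564495556849881094981047501014950005335005096500989449933455054700499315950039054994060,
      49735184998708485320350131215181094507975448889225024954487850050899945151138507594450029395012247500333850782135084818499515949374545038348502608450369195036041499685049556755025742498291450268645070618499138650277204971586504466049795945007878506271849397084923863500721450230794903034505011250499654906628,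
      50629444974945503056549078634920923511837650312474920202493551949337424901375508603749974204989207493404749707524973495508087850052504930489496386650074675008115503001249828654933831500297449911844979793504677949949385017607502169550356884956230498037250830904976150498110950103394983311492698750518355086112,
      50146094986308501599750069865004290498349549882984999288497926550342574962694500047749685494998620499597749921504959984501259950015464993791499616849938905004189499145749986135000485499671050112344986879499622550037194996642500249750085334997269501900550053635002247499640950276244995978501304750040745004766,
      50098215008032502064149889275015612498987650034735011984501771549813754955991501066149664295000959499963349927174958608499804849984054993697500485349869534992041499349450001385001755500898350015795000560499088649967055003648499588750136924996497502790050042565004840499740850185465002619500757950052205002082,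
      50021705011679500570750031424988448496270650096274996610501449250337945052839500115349722055047533500772449968514969775493488550064135005023500433549982994992081498810150114455002651501462249971174995992498898649954964992846499327949738105014098503026649986545013099502012649736064979144501742449849314996892,
      50204665008203496395249947635047450502436949934114984234493739050311604987640505043449782814947045500138750059095060146499770949929395004037500561149979805008171500738049890245004809501869950093985008589499490650083075000244502928149975544975720500570449881364995139500961050241704989940498631350086184987047,
      49619844995506501341350311975005475502830249746484989564503431449774665055207499178149704264951505499321950004894983348504382950020275010864500979650099255002232500563349900675007631499518850018284982164498910449937915004151498911349865175010610502407250082054986888497608050061715028934499672649878474995587,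
      50071925015211501380650024044991432499005450229455022292500882849842394966817493578549752245052501500349250074695048953500192050114104993980499677249870955005619500393350131475000469499886150127834986005500094050055755002308497964050184525019883497272249848934997344501480550296504992592497473249991725013198,
      50454624913172500346049468164951607505154150512544883173505539550671614981540507141849888004981864500237449289224909732507632749328444975222498884950215964970134500772249772594937607503043949547684998849502225049787074987995498181849263564981865501155850546575085243495682949828905022331503531250812624973208,
      48314334993151494109250826635088198500564148528994963600512950349149485070498497930749911965023859493762750435295136391506003650075475077410503904450238605013177502846849709545033387493488149940255030837496650349827285044119490336250522365008743502236550478654904069501120350609615044386497881449380284927113,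
      50681374985927499777250026174979612499515349929404996638492342949501244964988503813450266144987790499751249972545010675506151049819735003849499554849714625013955499454549978404995959500466950012324996828500016150146375008311498852250115365002239503077950087424996534501126249841784997901496032650104164991910,
      50158134965798500315350041945005064502285849882285000442496024950205045011433495295450258435020720499967249925704959072499124450100814989761497560149943164992719499967249978984992625500513550071525015673498636050081604997572501167949853364992639497186950043285007982498487850186265016913500664449960495014471,
      49971015007393499915949764825002509498592649830924980443505327449690674954718498499250224785021963501130449924315006869494722749986504991073499905850052264974919499697349992784996236498515350153694992225500255249895685002788501665050056754985288501811249962005014736499206349716575012191498470550044615007481,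
      49851484993078505567349802975012445499498850021215000196507020050371325015199505038450173314981917498339850042544969888502722249954554998394501270749937554995583497549449953345002173500132749943114984596499956849848664993016499797949614065010861498458350107104991796500231050321234988142501207250083804996813,
      50490484994385493865549761964933296503796650266735007449488442550008885008350497623650540415002251499662149928764990710500080450046445002487491544949940665021549498632550041834983763501513549982045017737502274850138375008952505401749935115008363499294150039214994238497918150103774955255498834450003995005297,
      49976604988230501314549374074939024508750250212754940367503409049789135004257498977450730515005439499698050020044986531502478250125654997456497419650321034986090499309449983294970614498726849804575001284504420649850085003518505849649940284964917498773250042424992219499583950396794944682499029249999195015406,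
      49822845019680499995650046265002416499906950094085012951500844849877665003666498464249955914997280499785350039455010578498672850121295068817500312549988705002864500641850026465003708499852450052825003217499932449987475001167499903850141104998306497164149962324997511500641050015515003393499458149943114991439,
      49961245005355498500850171964996409499057050024495006322498966950141125012581498782449964364995830501169750684495005684498567449974815001818500301550071335000808499857750019515002983499959149997515001039499388750026704998038500333349936115006373500203449941854991359499819149718444998818501404949964294997807].map (unpackGauss 7 22)
  choice :=
    [(0, 0), (0, 1), (0, 2), (1, 0), (1, 1), (1, 2), (2, 0), (2, 1), (2, 2), (3, 0), (3, 1),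
      (3, 2), (0, 3), (0, 4), (1, 3), (1, 4), (1, 5), (2, 3), (2, 4), (2, 5), (3, 4), (3, 5)]

theorem check_certificateA : check specialVector certificateA = true := by
  decide +kernel

theorem check_certificateB : check specialVector certificateB = true := by
  decide +kernel

theorem check_certificateC : check specialVector certificateC = true := by
  decide +kernel

theorem check_certificateD : check specialVector certificateD = true := by
  decide +kernel

theorem check_certificateE : check specialVector certificateE = true := by
  decide +kernel

end SimWaring

/-! ### Symmetries of the special vector and separation of the 36 solutions -/

namespace SimWaring

open Filter Topology Metric

/-- The special vector. -/
noncomputable def specialPoint (k : Fin 66) : ℂ := ((nth 0 specialVector k : ℤ) : ℂ) / 10 ^ 5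

/-- The vectors near the special one have a solution for which `10 ^ 20 * ∑ i, c_{i1} ^ 2` is
close to `s`. -/
def HasSolution (s : ℂ) : Prop :=
  ∀ᶠ y in 𝓝 specialPoint, ∃ x : Fin 11 × Fin 6 → ℂ, (∀ k, waringMap x k = y k) ∧
    ‖10 ^ 20 * ∑ i, x (i, cpos 1) ^ 2 - s‖ ≤ 10

/-- For `y` near the special vector, `θ y` is near it too, because `θ` is continuous and fixes it. A
solution for `θ y` is then moved by `σ` to one for `y`; so `θ` acts on right-hand sides inversely to
`σ`. -/
theorem HasSolution.transport {s s' : ℂ} (h : HasSolution s)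
    (σ : (Fin 11 × Fin 6 → ℂ) → Fin 11 × Fin 6 → ℂ) (θ : (Fin 66 → ℂ) → Fin 66 → ℂ)
    (hθ : Continuous θ) (hf : θ specialPoint = specialPoint)
    (hσ : ∀ x y, (∀ k, waringMap x k = θ y k) → ∀ k, waringMap (σ x) k = y k)
    (hs : ∀ x : Fin 11 × Fin 6 → ℂ, ‖10 ^ 20 * ∑ i, x (i, cpos 1) ^ 2 - s‖ ≤ 10 →
      ‖10 ^ 20 * ∑ i, σ x (i, cpos 1) ^ 2 - s'‖ ≤ 10) : HasSolution s' := by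
  have ht := hθ.tendsto specialPoint
  rw [hf] at ht
  filter_upwards [ht.eventually h] with y ⟨x, hx, hxs⟩
  exact ⟨σ x, hσ x y hx, hs x hxs⟩

/-- The system has integer coefficients and the special vector is real. -/
theorem HasSolution.conj {s : ℂ} (h : HasSolution s) : HasSolution (starRingEnd ℂ s) := by
  refine h.transport (fun x p => starRingEnd ℂ (x p)) (fun y k => starRingEnd ℂ (y k))
    (continuous_pi fun k => Complex.continuous_conj.comp (continuous_apply k)) ?_ ?_ ?_
  · funext k
    simp [specialPoint, Complex.conj_ofNat]
  · intro x y hxy k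
    rw [waringMap_map, hxy, Complex.conj_conj]
  · intro x hx
    have : (10 : ℂ) ^ 20 * ∑ i, (starRingEnd ℂ (x (i, cpos 1))) ^ 2 - starRingEnd ℂ s =
        starRingEnd ℂ (10 ^ 20 * ∑ i, x (i, cpos 1) ^ 2 - s) := by
      simp [Complex.conj_ofNat]
    rw [this, Complex.norm_conj]
    exact hx

/-- The weights of the parameters under the rotation. -/
def rotWeight (z : Fin 6) : ℕ := ![1, 2, 0, 2, 1, 0] z

/-- The weights of the coefficients under the rotation. -/
def coeffWeight (k : Fin 66) : ℕ :=
  rotWeight (cpos (comp k)) + (expo (mono k)).1 + 2 * (expo (mono k)).2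

/-- Every term c_j a ^ p b ^ q of a coordinate is homogeneous for the weights, so the map is
equivariant for a diagonal action. -/
theorem waringMap_rotate (ω : ℂ) (x : Fin 11 × Fin 6 → ℂ) (k : Fin 66) :
    waringMap (fun p => ω ^ rotWeight p.2 * x p) k = ω ^ coeffWeight k * waringMap x k := by
  simp only [waringMap, Finset.mul_sum]
  refine Finset.sum_congr rfl fun i _ => ?_
  have h0 : rotWeight 0 = 1 := rfl
  have h1 : rotWeight 1 = 2 := rfl
  simp only [h0, h1, coeffWeight, pow_add, mul_pow, ← pow_mul, one_mul]
  ring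

/-- The support lies in the weights divisible by three, which is why the rotation fixes the special
vector. -/
theorem specialVector_eq_zero (k : Fin 66) :
    nth 0 specialVector k = 0 ∨ coeffWeight k % 3 = 0 := by
  revert k
  decide +kernel

theorem HasSolution.rotate {s : ℂ} (h : HasSolution s) {ω : ℂ} (hω : ω ^ 3 = 1) :
    HasSolution (ω * s) := by
  have hnorm : ‖ω‖ = 1 := Complex.norm_eq_one_of_pow_eq_one hω (by norm_num)
  -- The right-hand side is rotated by `ω ^ 2`, the inverse of `ω`. The parameter `c` at position 1
  -- has weight 2, so its square is multiplied by `ω ^ 4 = ω`.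
  refine h.transport (fun x p => ω ^ rotWeight p.2 * x p)
    (fun y k => (ω ^ 2) ^ coeffWeight k * y k)
    (continuous_pi fun k => continuous_const.mul (continuous_apply k)) ?_ ?_ ?_
  · funext k
    rcases specialVector_eq_zero k with h0 | h0
    · simp [specialPoint, h0]
    · obtain ⟨n, hn⟩ := Nat.dvd_of_mod_eq_zero h0
      have : (ω ^ 2) ^ coeffWeight k = 1 := by
        rw [hn, ← pow_mul, show 2 * (3 * n) = 3 * (2 * n) by ring, pow_mul, hω, one_pow]
      rw [this, one_mul]
  · intro x y hxy k
    rw [waringMap_rotate, hxy, ← mul_assoc, ← mul_pow, ← pow_succ', hω, one_pow, one_mul]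
  · intro x hx
    have hw : rotWeight (cpos 1) = 2 := rfl
    have h4 : ω ^ 4 = ω := by rw [pow_succ, hω, one_mul]
    have : (10 : ℂ) ^ 20 * ∑ i, (ω ^ rotWeight (cpos 1) * x (i, cpos 1)) ^ 2 - ω * s =
        ω * (10 ^ 20 * ∑ i, x (i, cpos 1) ^ 2 - s) := by
      simp only [hw, mul_pow, ← pow_mul, ← Finset.mul_sum]
      rw [show 2 * 2 = 4 from rfl, h4]
      ring
    rw [this, norm_mul, hnorm, one_mul]
    exact hx

theorem HasSolution.rotate_pow {s : ℂ} (h : HasSolution s) {ω : ℂ} (hω : ω ^ 3 = 1) (n : ℕ) :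
    HasSolution (ω ^ n * s) := by
  induction n with
  | zero => simpa using h
  | succ n ih => simpa [pow_succ', mul_assoc] using ih.rotate hω

/-- The exchange of the two variables, on parameters. -/
def swapParam (z : Fin 6) : Fin 6 := ![1, 0, 2, 4, 3, 5] z

/-- The exchange of the two variables, on coefficients. -/
def swapCoeff (k : Fin 66) : Fin 66 :=
  ![0, 2, 1, 5, 4, 3, 9, 8, 7, 6, 14, 13, 12, 11, 10,
    30, 32, 31, 35, 34, 33, 39, 38, 37, 36, 44, 43, 42, 41, 40,
    15, 17, 16, 20, 19, 18, 24, 23, 22, 21, 29, 28, 27, 26, 25,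
    45, 47, 46, 50, 49, 48, 54, 53, 52, 51, 59, 58, 57, 56, 55, 65, 64, 63, 62, 61, 60] k

theorem swapCoeff_spec (k : Fin 66) : swapParam (cpos (comp k)) = cpos (comp (swapCoeff k)) ∧
    expo (mono (swapCoeff k)) = (expo (mono k)).swap ∧ swapCoeff (swapCoeff k) = k ∧
    nth 0 specialVector (swapCoeff k) = nth 0 specialVector k := by
  revert k
  decide +kernel

theorem waringMap_swap {R : Type*} [CommSemiring R] (x : Fin 11 × Fin 6 → R) (k : Fin 66) :
    waringMap (fun p => x (p.1, swapParam p.2)) k = waringMap x (swapCoeff k) := by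
  obtain ⟨h1, h2, -, -⟩ := swapCoeff_spec k
  simp only [waringMap, h1, h2]
  refine Finset.sum_congr rfl fun i _ => ?_
  change _ * (x (i, 1) ^ (expo (mono k)).1 * x (i, 0) ^ (expo (mono k)).2) =
    _ * (x (i, 0) ^ (expo (mono k)).2 * x (i, 1) ^ (expo (mono k)).1)
  ring

/-- Check the approximate value of `∑ i, c_{ij} ^ 2`. -/
noncomputable def checkSquareSum (c : CertificateData) (j : ℕ) (s : ℤ × ℤ) : Bool :=
  forceMatrix c.points fun X =>
    small (10 ^ 42) (gadd (gdot (tab (fun i => ent X i (2 + j)) 11)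
      (tab (fun i => ent X i (2 + j)) 11)) (Int.mul (-10 ^ 42) s.1, Int.mul (-10 ^ 42) s.2))

/-- Moving `c` by 10^(-17), with |c| at most 2/10^4, changes its square by at most 5/10^21. Eleven
of these, times 10^20, make 5.5, and rounding to `s` adds at most 1. The check uses squares in units
of 10^(-62), whence the factor 10^42 on `s`. -/
theorem norm_squareSum_sub_le {F : List ℤ} {c : CertificateData} (hc : check F c = true)
    {j : Fin 4} {s : ℤ × ℤ} (hs : checkSquareSum c j s = true) {x : Fin 11 × Fin 6 → ℂ}
    (hx : x ∈ closedBall c.x (1 / 10 ^ 17)) :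
    ‖10 ^ 20 * ∑ i, x (i, cpos j) ^ 2 - toC s‖ ≤ 10 := by
  have hcx := (isCertificate_of_check hc).norm_c
  have h1 : ∀ i, ‖x (i, cpos j) ^ 2 - c.x (i, cpos j) ^ 2‖ ≤ 5 / 10 ^ 21 := by
    intro i
    have e1 : ‖x (i, cpos j) - c.x (i, cpos j)‖ ≤ 1 / 10 ^ 17 :=
      (norm_le_pi_norm (x - c.x) (i, cpos j)).trans (by rwa [mem_closedBall, dist_eq_norm] at hx)
    have e2 := hcx i j
    have e3 : ‖x (i, cpos j) + c.x (i, cpos j)‖ ≤ 5 / 10 ^ 4 := by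
      have : x (i, cpos j) + c.x (i, cpos j) =
          (x (i, cpos j) - c.x (i, cpos j)) + (c.x (i, cpos j) + c.x (i, cpos j)) := by ring
      rw [this]
      have e4 := norm_add_le (x (i, cpos j) - c.x (i, cpos j)) (c.x (i, cpos j) + c.x (i, cpos j))
      have e5 := norm_add_le (c.x (i, cpos j)) (c.x (i, cpos j))
      linarith
    rw [sq_sub_sq, norm_mul]
    exact (mul_le_mul e3 e1 (norm_nonneg _) (by norm_num)).trans (by norm_num)
  have h2 : ‖10 ^ 20 * ∑ i, c.x (i, cpos j) ^ 2 - toC s‖ ≤ 1 := by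
    rw [checkSquareSum, forceMatrix_eq] at hs
    refine (norm_le_of_eq_mul (T := 10 ^ 42) (by norm_num) (norm_le_of_small hs) ?_).trans (b := _)
      (by norm_num)
    rw [toC_gadd, toC_gdot, mul_sub, sub_eq_add_neg, Finset.sum_range]
    congr 1
    · rw [Finset.mul_sum, Finset.mul_sum]
      refine Finset.sum_congr rfl fun i _ => ?_
      rw [nth_tab _ _ i.2, toC_eq_scaled]
      change 10 ^ 31 * c.x (i, cpos j) * (10 ^ 31 * c.x (i, cpos j)) = _
      push_cast
      ring
    · change toC (-10 ^ 42 * s.1, -10 ^ 42 * s.2) = _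
      simp only [toC]
      push_cast
      ring
  have h3 : ‖∑ i, (x (i, cpos j) ^ 2 - c.x (i, cpos j) ^ 2)‖ ≤ 11 * (5 / 10 ^ 21) := by
    refine (norm_sum_le_of_le _ fun i _ => h1 i).trans ?_
    simp
  have h4 : 10 ^ 20 * ∑ i, x (i, cpos j) ^ 2 - toC s =
      10 ^ 20 * ∑ i, (x (i, cpos j) ^ 2 - c.x (i, cpos j) ^ 2) +
        (10 ^ 20 * ∑ i, c.x (i, cpos j) ^ 2 - toC s) := by
    rw [Finset.sum_sub_distrib]; ring
  rw [h4]
  refine (norm_add_le _ _).trans ?_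
  rw [norm_mul, norm_pow, Complex.norm_ofNat]
  linarith

theorem hasSolution_of_check {c : CertificateData} (hc : check specialVector c = true)
    {s : ℤ × ℤ} (hs : checkSquareSum c 1 s = true) : HasSolution (toC s) := by
  filter_upwards [eventually_exists_of_check hc] with y ⟨x, hx, hxy⟩
  exact ⟨x, hxy, norm_squareSum_sub_le hc (j := 1) hs hx⟩

/-- After the exchange the invariant is the sum of the squares of the original coefficients of
component 2. This extracts a second value from the same certificate. -/
theorem hasSolution_of_check_swap {c : CertificateData} (hc : check specialVector c = true)
    {s : ℤ × ℤ} (hs : checkSquareSum c 2 s = true) : HasSolution (toC s) := by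
  have hcont : Continuous fun (y : Fin 66 → ℂ) k => y (swapCoeff k) :=
    continuous_pi fun k => continuous_apply _
  have ht := hcont.tendsto specialPoint
  have hf : (fun k => specialPoint (swapCoeff k)) = specialPoint := by
    funext k
    rw [specialPoint, specialPoint, (swapCoeff_spec k).2.2.2]
  rw [hf] at ht
  filter_upwards [ht.eventually (eventually_exists_of_check hc)] with y ⟨x, hx, hxy⟩
  refine ⟨fun p => x (p.1, swapParam p.2), fun k => ?_, norm_squareSum_sub_le hc (j := 2) hs hx⟩
  rw [waringMap_swap, hxy, (swapCoeff_spec k).2.2.1]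

/-- Approximate values of `10 ^ 20 * ∑ i, c_{i1} ^ 2`. -/
def squareSums : Fin 6 → ℤ × ℤ :=
  ![(-1781019267, -33121137120), (8095489033, -477317650), (-134263368293, -47274653249),
    (-23599741272, -9734061384), (2198033006, -3353852787), (-259149295, 94068785)]

theorem hasSolution_squareSums (n : Fin 6) : HasSolution (toC (squareSums n)) := by
  fin_cases n
  · exact hasSolution_of_check check_certificateA (by decide +kernel)
  · exact hasSolution_of_check_swap check_certificateA (by decide +kernel)
  · exact hasSolution_of_check check_certificateB (by decide +kernel)
  · exact hasSolution_of_check check_certificateC (by decide +kernel)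
  · exact hasSolution_of_check check_certificateD (by decide +kernel)
  · exact hasSolution_of_check check_certificateE (by decide +kernel)

/-- The approximate values and their conjugates. -/
def conjSums (p : Fin 6 × Bool) : ℤ × ℤ :=
  if p.2 then squareSums p.1 else ((squareSums p.1).1, -(squareSums p.1).2)

theorem hasSolution_conjSums (p : Fin 6 × Bool) : HasSolution (toC (conjSums p)) := by
  obtain ⟨n, b⟩ := p
  cases b
  · convert (hasSolution_squareSums n).conj using 1
    simp [conjSums, toC]
  · exact hasSolution_squareSums n

/-- The cube of a Gaussian integer. -/
def gcube (z : ℤ × ℤ) : ℤ × ℤ := gmul (gmul z z) z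

/-- The rotation multiplies the invariant by a cube root of unity and so preserves its cube.
Comparing the twelve cubes, which are Gaussian integers, separates the orbits. The gap 10^25 exceeds
twice the error of `norm_cube_sub_le`. -/
theorem gcube_conjSums_ne (p q : Fin 6 × Bool) (h : p ≠ q) :
    10 ^ 25 ≤ |(gcube (conjSums p)).1 - (gcube (conjSums q)).1| ∨
      10 ^ 25 ≤ |(gcube (conjSums p)).2 - (gcube (conjSums q)).2| := by
  revert p q
  decide +kernel

theorem conjSums_bounds (p : Fin 6 × Bool) :
    10 ^ 8 ≤ |(conjSums p).1| ∧ |(conjSums p).1| + |(conjSums p).2| ≤ 2 * 10 ^ 11 := by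
  revert p
  decide +kernel

theorem toC_re (z : ℤ × ℤ) : (toC z).re = z.1 := by simp [toC]

theorem toC_im (z : ℤ × ℤ) : (toC z).im = z.2 := by simp [toC]

theorem norm_conjSums_le (p : Fin 6 × Bool) : ‖toC (conjSums p)‖ ≤ 2 * 10 ^ 11 := by
  refine (Complex.norm_le_abs_re_add_abs_im _).trans ?_
  rw [toC_re, toC_im]
  exact_mod_cast (conjSums_bounds p).2

theorem le_norm_conjSums (p : Fin 6 × Bool) : 10 ^ 8 ≤ ‖toC (conjSums p)‖ := by
  refine le_trans ?_ (Complex.abs_re_le_norm _)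
  rw [toC_re]
  exact_mod_cast (conjSums_bounds p).1

/-- The main term of the error is 10 · 3 · (2·10^11)² = 1.2·10^24. -/
theorem norm_cube_sub_le {z w : ℂ} (h : ‖z - w‖ ≤ 10) (hw : ‖w‖ ≤ 2 * 10 ^ 11) :
    ‖z ^ 3 - w ^ 3‖ ≤ 2 * 10 ^ 24 := by
  have e : z ^ 3 - w ^ 3 = (z - w) * ((z - w) ^ 2 + 3 * (z - w) * w + 3 * w ^ 2) := by ring
  have h0 := norm_nonneg (z - w)
  have h1 := norm_nonneg w
  have h2 : ‖(z - w) ^ 2 + 3 * (z - w) * w + 3 * w ^ 2‖ ≤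
      10 ^ 2 + 3 * 10 * (2 * 10 ^ 11) + 3 * (2 * 10 ^ 11) ^ 2 := by
    refine norm_add₃_le.trans ?_
    simp only [norm_mul, norm_pow, Complex.norm_ofNat]
    gcongr
  rw [e, norm_mul]
  refine (mul_le_mul h h2 (norm_nonneg _) (by norm_num)).trans (by norm_num)

/-- From (x - y)² = -3xy the distance is √3. -/
theorem one_le_norm_sub_of_cube_eq {x y : ℂ} (hx : x ^ 3 = 1) (hy : y ^ 3 = 1) (hxy : x ≠ y) :
    1 ≤ ‖x - y‖ := by
  have h1 : x ^ 2 + x * y + y ^ 2 = 0 := by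
    have : (x - y) * (x ^ 2 + x * y + y ^ 2) = 0 := by linear_combination hx - hy
    exact (mul_eq_zero.1 this).resolve_left (sub_ne_zero.2 hxy)
  have h2 : (x - y) ^ 2 = -3 * (x * y) := by linear_combination h1
  have nx : ‖x‖ = 1 := Complex.norm_eq_one_of_pow_eq_one hx (by norm_num)
  have ny : ‖y‖ = 1 := Complex.norm_eq_one_of_pow_eq_one hy (by norm_num)
  have h3 : ‖x - y‖ ^ 2 = 3 := by
    rw [← norm_pow, h2, norm_mul, norm_mul, nx, ny]
    norm_num
  nlinarith [norm_nonneg (x - y)]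

/-- The cube of `z` determines the orbit, hence `p = q`. Within an orbit, two different rotations of
a number of norm at least 10^8 are at least 10^8 apart, while both are within 10 of `z`. -/
theorem eq_of_close {ω : ℂ} (hω : IsPrimitiveRoot ω 3) {p q : Fin 6 × Bool} {m n : Fin 3} {z : ℂ}
    (h1 : ‖z - ω ^ m.1 * toC (conjSums p)‖ ≤ 10) (h2 : ‖z - ω ^ n.1 * toC (conjSums q)‖ ≤ 10) :
    p = q ∧ m = n := by
  have hroot : ∀ k : ℕ, (ω ^ k) ^ 3 = 1 := fun k => by
    rw [← pow_mul, mul_comm, pow_mul, hω.pow_eq_one, one_pow]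
  have hnorm : ∀ k : ℕ, ‖ω ^ k‖ = 1 := fun k =>
    Complex.norm_eq_one_of_pow_eq_one (hroot k) (by norm_num)
  have hcube : ∀ (k : Fin 3) (r : Fin 6 × Bool), ‖z - ω ^ k.1 * toC (conjSums r)‖ ≤ 10 →
      ‖z ^ 3 - toC (gcube (conjSums r))‖ ≤ 2 * 10 ^ 24 := by
    intro k r h
    have := norm_cube_sub_le h (by rw [norm_mul, hnorm, one_mul]; exact norm_conjSums_le r)
    rwa [mul_pow, hroot, one_mul, pow_succ, pow_succ, pow_one, pow_succ, pow_succ, pow_one,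
      ← toC_gmul, ← toC_gmul, ← pow_two, ← pow_succ] at this
  have hpq : p = q := by
    by_contra hne
    have hd : ‖toC (gcube (conjSums p)) - toC (gcube (conjSums q))‖ ≤ 4 * 10 ^ 24 := by
      have e1 := hcube m p h1
      have e2 := hcube n q h2
      rw [norm_sub_rev] at e1
      refine (norm_sub_le_norm_sub_add_norm_sub _ (z ^ 3) _).trans ?_
      linarith
    rcases gcube_conjSums_ne p q hne with h | h
    · have := (Complex.abs_re_le_norm _).trans hd
      rw [Complex.sub_re, toC_re, toC_re] at this
      have h' : (10 : ℝ) ^ 25 ≤ |((gcube (conjSums p)).1 : ℝ) - (gcube (conjSums q)).1| := by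
        exact_mod_cast h
      linarith
    · have := (Complex.abs_im_le_norm _).trans hd
      rw [Complex.sub_im, toC_im, toC_im] at this
      have h' : (10 : ℝ) ^ 25 ≤ |((gcube (conjSums p)).2 : ℝ) - (gcube (conjSums q)).2| := by
        exact_mod_cast h
      linarith
  subst hpq
  refine ⟨rfl, ?_⟩
  by_contra hne
  have hω' : ω ^ m.1 ≠ ω ^ n.1 := fun h => hne (Fin.ext (hω.pow_inj m.2 n.2 h))
  have e1 := one_le_norm_sub_of_cube_eq (hroot m) (hroot n) hω'
  have e2 : ‖(ω ^ m.1 - ω ^ n.1) * toC (conjSums p)‖ ≤ 20 := by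
    have : (ω ^ m.1 - ω ^ n.1) * toC (conjSums p) =
        (z - ω ^ n.1 * toC (conjSums p)) - (z - ω ^ m.1 * toC (conjSums p)) := by ring
    rw [this]
    refine (norm_sub_le _ _).trans ?_
    linarith
  rw [norm_mul] at e2
  have e3 := le_norm_conjSums p
  nlinarith

theorem eventually_exists_solutions :
    ∀ᶠ y in 𝓝 specialPoint, ∃ x : Fin 36 → Fin 11 × Fin 6 → ℂ,
      (∀ n k, waringMap (x n) k = y k) ∧ Function.Injective fun n => ∑ i, x n (i, cpos 1) ^ 2 := by
  obtain ⟨ω, hω⟩ : ∃ ω : ℂ, IsPrimitiveRoot ω 3 := ⟨_, Complex.isPrimitiveRoot_exp 3 (by norm_num)⟩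
  -- The solutions are indexed by six certified values, conjugation and three rotations: 6 · 2 · 3 =
  -- 36. Finitely many neighbourhoods are intersected.
  have h : ∀ᶠ y in 𝓝 specialPoint, ∀ n : (Fin 6 × Bool) × Fin 3, ∃ x : Fin 11 × Fin 6 → ℂ,
      (∀ k, waringMap x k = y k) ∧
        ‖10 ^ 20 * ∑ i, x (i, cpos 1) ^ 2 - ω ^ n.2.1 * toC (conjSums n.1)‖ ≤ 10 :=
    eventually_all.2 fun n => (hasSolution_conjSums n.1).rotate_pow hω.pow_eq_one n.2
  filter_upwards [h] with y hy
  choose x hx hxs using hy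
  let φ : Fin 36 ≃ (Fin 6 × Bool) × Fin 3 := (Fintype.equivFinOfCardEq (by decide)).symm
  refine ⟨fun n => x (φ n), fun n => hx (φ n), fun n m hnm => φ.injective ?_⟩
  have e1 := hxs (φ n)
  have e2 := hxs (φ m)
  have hnm' : ∑ i, x (φ n) (i, cpos 1) ^ 2 = ∑ i, x (φ m) (i, cpos 1) ^ 2 := hnm
  -- Equal invariants would make one number close to two of the 36 separated values.
  rw [hnm'] at e1
  obtain ⟨h1, h2⟩ := eq_of_close hω e1 e2
  exact Prod.ext h1 h2

end SimWaring

theorem theorem1p2 :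
    SimWaring.Generally 2 ![4, 4, 4, 5] (fun f =>
      36 ≤ (SimWaring.decompositions f 11).encard ∧ ¬ SimWaring.Identifiable f) ∧
    ¬ SimWaring.ConjectureAt 4 := by
  refine SimWaring.main_of_eventually
    (fun k => (SimWaring.nth 0 SimWaring.specialVector k : ℤ) / 10 ^ 5) ?_
  have h : (fun k : Fin 66 =>
      ((((SimWaring.nth 0 SimWaring.specialVector k : ℤ) : ℚ) / 10 ^ 5 : ℚ) : ℂ)) =
      SimWaring.specialPoint := by
    funext k
    simp [SimWaring.specialPoint]
  rw [h]
  exact SimWaring.eventually_exists_solutions
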